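/- **Theorem.** Let $p\ge 2$ be an integer, $\mathfrak q=e^{i\pi/p}$ and $[n]=\frac{\mathfrak q^n-\mathfrak q^{-n}}{\mathfrak q-\mathfrak q^{-1}}$. Let $\mathscr U=\overline{\mathcal U}_{\mathfrak q}s\ell(2)$ be the Hopf algebra over $\mathbb C$ with generators $E,K,F$, relations $$KEK^{-1}=\mathfrak q^2E,\quad KFK^{-1}=\mathfrak q^{-2}F,\quad [E,F]=\frac{K-K^{-1}}{\mathfrak q-\mathfrak q^{-1}},\quad E^p=F^p=0,\quad K^{2p}=1,$$ coproduct $\Delta(E)=E\otimes K+1\otimes E$, $\Delta(K)=K\otimes K$, $\Delta(F)=F\otimes 1+K^{-1}\otimes F$, counit $\epsilon(E)=\epsilon(F)=0$, $\epsilon(K)=1$, and antipode $S(E)=-EK^{-1}$, $S(K)=K^{-1}$, $S(F)=-KF$. For $1\le r\le p$ let $\mathscr X^+_r$ be the irreducible $\mathscr U$-module with basis $e_0,\dots,e_{r-1}$ and $Ke_n=\mathfrak q^{r-1-2n}e_n$, $Ee_n=[n][r-n]e_{n-1}$, $Fe_n=e_{n+1}$ (with $Ee_0=0$, $Fe_{r-1}=0$),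 and let $\mathscr P^+_r$ be its projective cover. A $\mathscr U$-module algebra is a unital algebra $V$ with a $\mathscr U$-module structure such that $h(vw)=\sum h'(v)h''(w)$ and $h(1)=\epsilon(h)1$, where $\Delta(h)=\sum h'\otimes h''$. 1. The formulas (for $X=(x_{ij})_{1\le i,j\le p}$, with $x_{ij}=0$ whenever $i$ or $j$ is outside $\{1,\dots,p\}$) $$(EX)_{ij}=\frac{x_{i,j+1}-\mathfrak q^{2(i-j-1)}x_{i-1,j}}{\mathfrak q-\mathfrak q^{-1}},\qquad (KX)_{ij}=\mathfrak q^{2(i-j)}x_{ij},$$ $$(FX)_{ij}=\mathfrak q^{1-i}[i]\,x_{i+1,j}-\mathfrak q^{j-2i}[j-1]\,x_{i,j-1}$$ define a representation of $\mathscr U$ on $\mathrm{Mat}_p(\mathbb C)$. 2. With this action, $\mathrm{Mat}_p(\mathbb C)$ (with matrix multiplication) is a $\mathscr U$-module algebra. 3. $\mathrm{Mat}_p(\mathbb C)$ decomposes into indecomposable $\mathscr U$-modules as $\mathscr P^+_1\oplus\mathscr P^+_3\oplus\dots\oplus\mathscr P^+_\nu$ (sum over odd $r\le\nu$), where $\nu=p$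 if $p$ is odd and $\nu=p-1$ if $p$ is even. 4. Let $\overline{\mathbb C}_{\mathfrak q}[z,\partial]$ be the unital associative algebra with generators $z,\partial$ and relations $\partial z=\mathfrak q-\mathfrak q^{-1}+\mathfrak q^{-2}z\partial$, $z^p=\partial^p=0$. It is a $\mathscr U$-module algebra, with, for all $m\ge0$, $$Ez^m=-\mathfrak q^m[m]z^{m+1},\quad Kz^m=\mathfrak q^{2m}z^m,\quad Fz^m=[m]\mathfrak q^{1-m}z^{m-1},$$ $$E\partial^m=\mathfrak q^{1-m}[m]\partial^{m-1},\quad K\partial^m=\mathfrak q^{-2m}\partial^m,\quad F\partial^m=-\mathfrak q^m[m]\partial^{m+1}$$ (where the terms with coefficient $[0]=0$ are zero). There is an isomorphism of $\mathscr U$-module algebras $\mathrm{Mat}_p(\mathbb C)\cong\overline{\mathbb C}_{\mathfrak q}[z,\partial]$ under which $z$ corresponds to the matrix $\sum_{i=1}^{p-1}e_{i+1,i}$ and $\partial$ to $(\mathfrak q-\mathfrak q^{-1})\sum_{i=1}^{p-1}\mathfrak q^{1-i}[i]\,e_{i,i+1}$, where $e_{ij}$ are the matrix units; a decomposition as in 3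 is carried by it to a decomposition $\overline{\mathbb C}_{\mathfrak q}[z,\partial]=\mathscr P^+_1\oplus\mathscr P^+_3\oplus\dots\oplus\mathscr P^+_\nu$ into indecomposable $\mathscr U$-modules. 5. The decompositions in 3 and 4 can be chosen such that the summand $\mathscr P^+_1\subset\overline{\mathbb C}_{\mathfrak q}[z,\partial]$ has the basis consisting of the $2p$ elements $1$; $z,\dots,z^{p-1}$; $\partial,\dots,\partial^{p-1}$; and $t=\sum_{i=1}^{p-1}\frac1{[i]}z^i\partial^i$. Here $Et=z$, $Ft=\partial$, $Kt=t$; for $1\le m\le p-2$, $E$ takes $z^m$ to a nonzero multiple of $z^{m+1}$ and $F$ takes $z^{m+1}$ to a nonzero multiple of $z^m$, while $F$ takes $\partial^m$ to a nonzero multiple of $\partial^{m+1}$ and $E$ takes $\partial^{m+1}$ to a nonzero multiple of $\partial^m$; $Ez^{p-1}=0$, $F\partial^{p-1}=0$; $Fz=1$, $E\partial=1$; and $E1=F1=0$. 6. Let $\mathbb C_{\mathfrak q}[\zeta,\delta]$ be the unital algebra with generators $\zeta,\delta$ and relations $\zeta^2=\delta^2=0$, $\delta\zeta=-\mathfrak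 q^{-2}\zeta\delta$. Let $\Omega$ be the algebra generated by $z,\partial,\zeta,\delta$ with the relations of $\overline{\mathbb C}_{\mathfrak q}[z,\partial]$, those of $\mathbb C_{\mathfrak q}[\zeta,\delta]$, and $$\zeta z=\mathfrak q^{-2}z\zeta,\quad \delta\partial=\mathfrak q^2\partial\delta,\quad \zeta\partial=\mathfrak q^2\partial\zeta,\quad \delta z=\mathfrak q^{-2}z\delta$$ (that is, the quotient of the free product of the two algebras by these four relations). The linear map $\overline{\mathbb C}_{\mathfrak q}[z,\partial]\otimes\mathbb C_{\mathfrak q}[\zeta,\delta]\to\Omega$, $a\otimes b\mapsto ab$, is bijective, and $\overline{\mathbb C}_{\mathfrak q}[z,\partial]\to\Omega$ is injective. With $\Omega^0$, $\Omega^1$, $\Omega^2$ the sets of the elements $a$, of $a\zeta+b\delta$, and of $a\zeta\delta$, respectively, where $a,b\in\overline{\mathbb C}_{\mathfrak q}[z,\partial]$, and $\Omega^n=0$ for $n\ge3$, one has a graded algebra $\Omega=\bigoplus_n\Omega^n$, and the $\mathscr U$-action on $\overline{\mathbb C}_{\mathfrak q}[z,\partial]=\Omega^0$ extends to a grading-preserving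 $\mathscr U$-module algebra structure on $\Omega$ with $$E\zeta=-[2]z\zeta,\ K\zeta=\mathfrak q^2\zeta,\ F\zeta=0,\qquad E\delta=0,\ K\delta=\mathfrak q^{-2}\delta,\ F\delta=-\mathfrak q^2[2]\partial\delta.$$ There is a linear map $d:\Omega\to\Omega$ with $d(\Omega^n)\subset\Omega^{n+1}$, $d^2=0$, $d(ab)=d(a)b+(-1)^n a\,d(b)$ for $a\in\Omega^n$ and $b\in\Omega$, $d(z)=\zeta$, $d(\partial)=\delta$, $d(\zeta)=d(\delta)=0$, which commutes with the action of $\mathscr U$. The algebra $\Omega$ is generated by $\Omega^0$ and $d(\Omega^0)$. Thus $(\Omega,d)$ is a differential $\mathscr U$-module algebra, a quantum de Rham complex of $\overline{\mathbb C}_{\mathfrak q}[z,\partial]$. -/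

import Mathlib

open scoped TensorProduct

noncomputable section

/-! ### Algebras given by generators and relations -/

/-- The unital associative `ℂ`-algebra with generators `X` and relations `a = b` for `rel a b`. -/
def PresAlg {X : Type} (rel : FreeAlgebra ℂ X → FreeAlgebra ℂ X → Prop) : Type := RingQuot rel

namespace PresAlg

variable {X : Type} (rel : FreeAlgebra ℂ X → FreeAlgebra ℂ X → Prop)

instance instRing : Ring (PresAlg rel) := inferInstanceAs (Ring (RingQuot rel))

instance instAlgebra : Algebra ℂ (PresAlg rel) := inferInstanceAs (Algebra ℂ (RingQuot rel))

/-- The quotient map from the free algebra. -/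
def mk : FreeAlgebra ℂ X →ₐ[ℂ] PresAlg rel := RingQuot.mkAlgHom ℂ rel

theorem mk_surjective : Function.Surjective (mk rel) := RingQuot.mkAlgHom_surjective ℂ rel

variable {rel}

theorem mk_rel {a b : FreeAlgebra ℂ X} (h : rel a b) : mk rel a = mk rel b :=
  RingQuot.mkAlgHom_rel ℂ h

/-- The universal property of the presented algebra. -/
def lift {A : Type*} [Ring A] [Algebra ℂ A] (f : X → A)
    (h : ∀ ⦃a b⦄, rel a b → FreeAlgebra.lift ℂ f a = FreeAlgebra.lift ℂ f b) :
    PresAlg rel →ₐ[ℂ] A :=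
  RingQuot.liftAlgHom ℂ ⟨FreeAlgebra.lift ℂ f, h⟩

@[simp] theorem lift_mk {A : Type*} [Ring A] [Algebra ℂ A] (f : X → A)
    (h : ∀ ⦃a b⦄, rel a b → FreeAlgebra.lift ℂ f a = FreeAlgebra.lift ℂ f b)
    (a : FreeAlgebra ℂ X) : lift f h (mk rel a) = FreeAlgebra.lift ℂ f a :=
  RingQuot.liftAlgHom_mkAlgHom_apply ..

theorem algHom_ext {A : Type*} [Semiring A] [Algebra ℂ A] {φ ψ : PresAlg rel →ₐ[ℂ] A}
    (h : ∀ x, φ (mk rel (FreeAlgebra.ι ℂ x)) = ψ (mk rel (FreeAlgebra.ι ℂ x))) : φ = ψ := by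
  apply RingQuot.ringQuot_ext'
  ext x
  exact h x

end PresAlg

/-! ### The root of unity and `q`-integers -/

/-- `q = exp(iπ/p)`. -/
def qRoot (p : ℕ) : ℂ := Complex.exp (Complex.I * Real.pi / p)

/-- The `q`-integer `[n] = (q^n - q^{-n}) / (q - q^{-1})`. -/
def qInt (p : ℕ) (n : ℤ) : ℂ :=
  (qRoot p ^ n - qRoot p ^ (-n)) / (qRoot p - (qRoot p)⁻¹)

/-! ### The restricted quantum group -/

namespace UqSl2

/-- Generators of the restricted quantum group. -/
inductive Gen
  | E | K | F

/-- The free generators. -/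
abbrev free (g : Gen) : FreeAlgebra ℂ Gen := FreeAlgebra.ι ℂ g

/-- The defining relations.  Since `K ^ (2p) = 1`, the inverse of `K` is `K ^ (2p - 1)`; the
relations `K E K⁻¹ = q² E`, `K F K⁻¹ = q⁻² F` are written after multiplying by `K`. -/
inductive Rel (p : ℕ) : FreeAlgebra ℂ Gen → FreeAlgebra ℂ Gen → Prop
  | K_E : Rel p (free .K * free .E) ((qRoot p ^ (2 : ℤ)) • (free .E * free .K))
  | K_F : Rel p (free .K * free .F) ((qRoot p ^ (-2 : ℤ)) • (free .F * free .K))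
  | E_F : Rel p (free .E * free .F - free .F * free .E)
      ((qRoot p - (qRoot p)⁻¹)⁻¹ • (free .K - free .K ^ (2 * p - 1)))
  | E_pow : Rel p (free .E ^ p) 0
  | F_pow : Rel p (free .F ^ p) 0
  | K_pow : Rel p (free .K ^ (2 * p)) 1

end UqSl2

/-- The restricted quantum group `U = Ū_q sl(2)` at `q = exp(iπ/p)`. -/
abbrev UqSl2 (p : ℕ) : Type := PresAlg (UqSl2.Rel p)

namespace UqSl2

variable (p : ℕ)

/-- The canonical generators of `U`. -/
def gen (g : Gen) : UqSl2 p := PresAlg.mk (Rel p) (free g)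

/-- The generator `E`. -/
def E : UqSl2 p := gen p .E
/-- The generator `K`. -/
def K : UqSl2 p := gen p .K
/-- The generator `F`. -/
def F : UqSl2 p := gen p .F
/-- The inverse of the generator `K`. -/
def Kinv : UqSl2 p := K p ^ (2 * p - 1)

/-- The relations of `U` for a triple of elements of an algebra. -/
structure Sat {A : Type*} [Ring A] [Algebra ℂ A] (e k f : A) : Prop where
  K_E : k * e = (qRoot p ^ (2 : ℤ)) • (e * k)
  K_F : k * f = (qRoot p ^ (-2 : ℤ)) • (f * k)
  E_F : e * f - f * e = (qRoot p - (qRoot p)⁻¹)⁻¹ • (k - k ^ (2 * p - 1))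
  E_pow : e ^ p = 0
  F_pow : f ^ p = 0
  K_pow : k ^ (2 * p) = 1

theorem sat_gen : Sat p (E p) (K p) (F p) where
  K_E := by simpa [E, K, gen] using PresAlg.mk_rel (Rel.K_E (p := p))
  K_F := by simpa [F, K, gen] using PresAlg.mk_rel (Rel.K_F (p := p))
  E_F := by simpa [E, F, K, gen] using PresAlg.mk_rel (Rel.E_F (p := p))
  E_pow := by simpa [E, gen] using PresAlg.mk_rel (Rel.E_pow (p := p))
  F_pow := by simpa [F, gen] using PresAlg.mk_rel (Rel.F_pow (p := p))
  K_pow := by simpa [K, gen] using PresAlg.mk_rel (Rel.K_pow (p := p))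

/-- Images of the generators. -/
def genFun {A : Type*} (e k f : A) : Gen → A
  | .E => e
  | .K => k
  | .F => f

variable {p}

/-- The algebra homomorphism out of `U` defined by a triple satisfying the relations. -/
def lift {A : Type*} [Ring A] [Algebra ℂ A] {e k f : A} (h : Sat p e k f) : UqSl2 p →ₐ[ℂ] A :=
  PresAlg.lift (genFun e k f) <| by
    intro x y hxy
    cases hxy with
    | K_E => simpa [genFun] using h.K_E
    | K_F => simpa [genFun] using h.K_F
    | E_F => simpa [genFun] using h.E_F
    | E_pow => simpa [genFun] using h.E_pow
    | F_pow => simpa [genFun] using h.F_pow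
    | K_pow => simpa [genFun] using h.K_pow

section lift
variable {A : Type*} [Ring A] [Algebra ℂ A] {e k f : A} (h : Sat p e k f)

@[simp] theorem lift_E : lift h (E p) = e := by simp [lift, E, gen, genFun]
@[simp] theorem lift_K : lift h (K p) = k := by simp [lift, K, gen, genFun]
@[simp] theorem lift_F : lift h (F p) = f := by simp [lift, F, gen, genFun]

end lift

theorem algHom_ext {A : Type*} [Semiring A] [Algebra ℂ A] {φ ψ : UqSl2 p →ₐ[ℂ] A}
    (hE : φ (E p) = ψ (E p)) (hK : φ (K p) = ψ (K p)) (hF : φ (F p) = ψ (F p)) : φ = ψ := by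
  apply PresAlg.algHom_ext
  intro g
  cases g
  · exact hE
  · exact hK
  · exact hF

theorem induction_gen {P : UqSl2 p → Prop} (hc : ∀ c : ℂ, P (algebraMap ℂ _ c))
    (hE : P (E p)) (hK : P (K p)) (hF : P (F p))
    (hadd : ∀ a b, P a → P b → P (a + b)) (hmul : ∀ a b, P a → P b → P (a * b))
    (a : UqSl2 p) : P a := by
  obtain ⟨x, rfl⟩ := PresAlg.mk_surjective (Rel p) a
  induction x using FreeAlgebra.induction with
  | grade0 c => simpa using hc c
  | grade1 g => cases g <;> assumption
  | mul a b ha hb => simpa using hmul _ _ ha hb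
  | add a b ha hb => simpa using hadd _ _ ha hb

end UqSl2

theorem qRoot_ne_zero (p : ℕ) : qRoot p ≠ 0 := Complex.exp_ne_zero _

theorem qRoot_isPrimitiveRoot (p : ℕ) (hp : p ≠ 0) : IsPrimitiveRoot (qRoot p) (2 * p) := by
  have := Complex.isPrimitiveRoot_exp (2 * p) (by positivity)
  convert this using 1
  unfold qRoot
  congr 1
  push_cast
  have : (p : ℂ) ≠ 0 := by exact_mod_cast hp
  field_simp

theorem qRoot_sq_isPrimitiveRoot (p : ℕ) (hp : p ≠ 0) :
    IsPrimitiveRoot (qRoot p ^ (2 : ℤ)) p := by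
  have := (qRoot_isPrimitiveRoot p hp).pow (by positivity) (rfl : 2 * p = 2 * p)
  exact_mod_cast this

/-! #### The `q`-binomial theorem at a root of unity -/

/-- Gaussian binomial coefficients. -/
def gaussCoeff (w : ℂ) : ℕ → ℕ → ℂ
  | 0, 0 => 1
  | 0, _ + 1 => 0
  | _ + 1, 0 => 1
  | n + 1, k + 1 => gaussCoeff w n k + w ^ (k + 1) * gaussCoeff w n (k + 1)

theorem gaussCoeff_zero (w : ℂ) (n : ℕ) : gaussCoeff w n 0 = 1 := by cases n <;> rfl

theorem gaussCoeff_succ (w : ℂ) (n k : ℕ) : gaussCoeff w (n + 1) (k + 1) =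
    gaussCoeff w n k + w ^ (k + 1) * gaussCoeff w n (k + 1) := rfl

theorem gaussCoeff_of_lt (w : ℂ) (n : ℕ) : ∀ k, n < k → gaussCoeff w n k = 0 := by
  induction n with
  | zero => intro k hk; cases k with
    | zero => omega
    | succ k => rfl
  | succ n ih => intro k hk; cases k with
    | zero => omega
    | succ k => rw [gaussCoeff_succ, ih k (by omega), ih (k + 1) (by omega)]; simp

theorem gaussCoeff_self (w : ℂ) (n : ℕ) : gaussCoeff w n n = 1 := by
  induction n with
  | zero => rfl
  | succ n ih => rw [gaussCoeff_succ, ih, gaussCoeff_of_lt w n (n + 1) (by omega)]; simp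

theorem gaussCoeff_rec (w : ℂ) (n : ℕ) : ∀ k, w ^ k * (1 - w ^ (k + 1)) * gaussCoeff w n (k + 1) =
    (w ^ k - w ^ n) * gaussCoeff w n k := by
  induction n with
  | zero => intro k; cases k with
    | zero => simp [gaussCoeff]
    | succ k => simp [gaussCoeff]
  | succ n ih => intro k; cases k with
    | zero =>
      have := ih 0
      simp only [gaussCoeff_succ, gaussCoeff_zero] at this ⊢
      linear_combination w * this
    | succ k =>
      have h1 := ih (k + 1)
      have h0 := ih k
      rw [gaussCoeff_succ, gaussCoeff_succ]
      linear_combination w ^ (k + 2) * h1 + w * h0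

theorem gaussCoeff_root {w : ℂ} {p : ℕ} (hw : IsPrimitiveRoot w p) (k : ℕ) (hk : 0 < k)
    (hkp : k < p) : gaussCoeff w p k = 0 := by
  induction k with
  | zero => omega
  | succ k ih =>
    have h := gaussCoeff_rec w p k
    have hw0 : w ≠ 0 := hw.ne_zero (by omega)
    have h1 : (1 - w ^ (k + 1)) ≠ 0 := by
      intro h
      exact hw.pow_ne_one_of_pos_of_lt (by omega) hkp (sub_eq_zero.mp h).symm
    have h2 : (w ^ k - w ^ p) * gaussCoeff w p k = 0 := by
      rcases Nat.eq_zero_or_pos k with rfl | hk0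
      · simp [hw.pow_eq_one]
      · rw [ih hk0 (by omega), mul_zero]
    rw [h2] at h
    have := pow_ne_zero k hw0
    simpa [h1, this] using h

section
variable {A : Type*} [Ring A] [Algebra ℂ A] {a b : A} {w : ℂ}

theorem mul_pow_of_qcomm (h : b * a = w • (a * b)) (k : ℕ) :
    b * a ^ k = w ^ k • (a ^ k * b) := by
  induction k with
  | zero => simp
  | succ k ih =>
    rw [pow_succ, ← mul_assoc, ih, smul_mul_assoc, mul_assoc, h, mul_smul_comm, smul_smul,
      ← mul_assoc, ← pow_succ]

theorem add_pow_of_qcomm (h : b * a = w • (a * b)) (n : ℕ) :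
    (a + b) ^ n = ∑ k ∈ Finset.range (n + 1), gaussCoeff w n k • (a ^ k * b ^ (n - k)) := by
  induction n with
  | zero => simp [gaussCoeff]
  | succ n ih =>
    rw [pow_succ', ih, add_mul, Finset.sum_range_succ' _ (n + 1)]
    simp only [gaussCoeff_succ, gaussCoeff_zero, add_smul, Finset.sum_add_distrib]
    rw [add_assoc]
    congr 1
    · rw [Finset.mul_sum]
      refine Finset.sum_congr rfl fun k _ => ?_
      rw [mul_smul_comm, ← mul_assoc, ← pow_succ', Nat.add_sub_add_right]
    · rw [Finset.mul_sum, Finset.sum_range_succ', Finset.sum_range_succ,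
        gaussCoeff_of_lt w n (n + 1) (by omega), mul_zero, zero_smul, add_zero]
      congr 1
      · refine Finset.sum_congr rfl fun k hk => ?_
        have hk' : k < n := by simpa using hk
        rw [mul_smul_comm, ← mul_assoc, mul_pow_of_qcomm h, smul_mul_assoc, smul_smul, mul_assoc,
          ← pow_succ', mul_comm]
        congr 3
        omega
      · simp [gaussCoeff_zero, pow_succ']

theorem add_pow_eq_zero_of_qcomm {p : ℕ} (hp : p ≠ 0) (hw : IsPrimitiveRoot w p)
    (h : b * a = w • (a * b)) (ha : a ^ p = 0) (hb : b ^ p = 0) : (a + b) ^ p = 0 := by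
  rw [add_pow_of_qcomm h]
  refine Finset.sum_eq_zero fun k hk => ?_
  rcases Nat.eq_zero_or_pos k with rfl | hk0
  · simp [hb]
  · rcases (Nat.lt_succ_iff.mp (Finset.mem_range.mp hk)).lt_or_eq with h' | rfl
    · rw [gaussCoeff_root hw k hk0 h', zero_smul]
    · simp [ha]

theorem mul_pow_eq_zero_of_qcomm {p : ℕ} (h : b * a = w • (a * b)) (ha : a ^ p = 0) :
    (a * b) ^ p = 0 ∧ (b * a) ^ p = 0 := by
  have key : ∀ n, ∃ c : ℂ, (a * b) ^ n = c • (a ^ n * b ^ n) := by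
    intro n
    induction n with
    | zero => exact ⟨1, by simp⟩
    | succ n ih =>
      obtain ⟨c, hc⟩ := ih
      refine ⟨c * w ^ n, ?_⟩
      rw [pow_succ', hc, mul_smul_comm, mul_assoc, ← mul_assoc b, mul_pow_of_qcomm h,
        smul_mul_assoc, mul_smul_comm, smul_smul, mul_assoc (a ^ n), ← pow_succ', ← mul_assoc,
        ← pow_succ']
  obtain ⟨c, hc⟩ := key p
  have h1 : (a * b) ^ p = 0 := by rw [hc, ha]; simp
  refine ⟨h1, ?_⟩
  rw [h, smul_pow, h1, smul_zero]

end

/-! #### The Hopf algebra structure -/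

namespace UqSl2

set_option linter.unusedSectionVars false

variable (p : ℕ) [hp2 : Fact (2 ≤ p)]

theorem p_ne_zero : p ≠ 0 := by have := hp2.out; omega

theorem K_mul_Kinv : K p * Kinv p = 1 := by
  have := hp2.out
  rw [Kinv, ← pow_succ', ← (sat_gen p).K_pow]
  congr 1
  omega

theorem Kinv_mul_K : Kinv p * K p = 1 := by
  have := hp2.out
  rw [Kinv, ← pow_succ, ← (sat_gen p).K_pow]
  congr 1
  omega

theorem Kinv_pow : Kinv p ^ (2 * p) = 1 := by
  rw [Kinv, ← pow_mul, mul_comm, pow_mul, (sat_gen p).K_pow, one_pow]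

theorem Kinv_pow_pred : Kinv p ^ (2 * p - 1) = K p := by
  have h := hp2.out
  have : Kinv p * Kinv p ^ (2 * p - 1) = 1 := by
    rw [← pow_succ', ← Kinv_pow p]
    congr 1
    omega
  calc Kinv p ^ (2 * p - 1) = K p * Kinv p * Kinv p ^ (2 * p - 1) := by rw [K_mul_Kinv, one_mul]
    _ = K p := by rw [mul_assoc, this, mul_one]

theorem K_mul_E : K p * E p = (qRoot p ^ (2 : ℤ)) • (E p * K p) := (sat_gen p).K_E

theorem K_mul_F : K p * F p = (qRoot p ^ (-2 : ℤ)) • (F p * K p) := (sat_gen p).K_F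

theorem EF_sub : E p * F p - F p * E p = (qRoot p - (qRoot p)⁻¹)⁻¹ • (K p - Kinv p) :=
  (sat_gen p).E_F

theorem E_mul_Kinv : E p * Kinv p = (qRoot p ^ (2 : ℤ)) • (Kinv p * E p) := by
  calc E p * Kinv p = Kinv p * (K p * E p) * Kinv p := by
        rw [← mul_assoc, Kinv_mul_K, one_mul]
    _ = (qRoot p ^ (2 : ℤ)) • (Kinv p * E p) := by
        rw [K_mul_E, mul_smul_comm, smul_mul_assoc, mul_assoc, mul_assoc, K_mul_Kinv, mul_one]

theorem F_mul_Kinv : F p * Kinv p = (qRoot p ^ (-2 : ℤ)) • (Kinv p * F p) := by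
  calc F p * Kinv p = Kinv p * (K p * F p) * Kinv p := by
        rw [← mul_assoc, Kinv_mul_K, one_mul]
    _ = (qRoot p ^ (-2 : ℤ)) • (Kinv p * F p) := by
        rw [K_mul_F, mul_smul_comm, smul_mul_assoc, mul_assoc, mul_assoc, K_mul_Kinv, mul_one]

theorem q_two_mul_neg_two : qRoot p ^ (2 : ℤ) * qRoot p ^ (-2 : ℤ) = 1 := by
  rw [← zpow_add₀ (qRoot_ne_zero p)]; simp

theorem q_neg_two_mul_two : qRoot p ^ (-2 : ℤ) * qRoot p ^ (2 : ℤ) = 1 := by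
  rw [← zpow_add₀ (qRoot_ne_zero p)]; simp

theorem Kinv_mul_E : Kinv p * E p = (qRoot p ^ (-2 : ℤ)) • (E p * Kinv p) := by
  rw [E_mul_Kinv, smul_smul, q_neg_two_mul_two, one_smul]

theorem Kinv_mul_F : Kinv p * F p = (qRoot p ^ (2 : ℤ)) • (F p * Kinv p) := by
  rw [F_mul_Kinv, smul_smul, q_two_mul_neg_two, one_smul]

theorem E_mul_K : E p * K p = (qRoot p ^ (-2 : ℤ)) • (K p * E p) := by
  rw [K_mul_E, smul_smul, q_neg_two_mul_two, one_smul]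

theorem F_mul_K : F p * K p = (qRoot p ^ (2 : ℤ)) • (K p * F p) := by
  rw [K_mul_F, smul_smul, q_two_mul_neg_two, one_smul]

theorem sat_comul : Sat p (A := UqSl2 p ⊗[ℂ] UqSl2 p) (E p ⊗ₜ K p + 1 ⊗ₜ E p) (K p ⊗ₜ K p)
    (F p ⊗ₜ 1 + Kinv p ⊗ₜ F p) where
  K_E := by
    simp only [mul_add, add_mul, Algebra.TensorProduct.tmul_mul_tmul, mul_one, one_mul, K_mul_E,
      smul_add, TensorProduct.smul_tmul', TensorProduct.tmul_smul]
  K_F := by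
    have : K p * Kinv p = Kinv p * K p := by rw [K_mul_Kinv, Kinv_mul_K]
    simp only [mul_add, add_mul, Algebra.TensorProduct.tmul_mul_tmul, mul_one, one_mul, K_mul_F,
      smul_add, TensorProduct.smul_tmul', TensorProduct.tmul_smul, this]
  E_F := by
    have h : (E p * F p) = F p * E p + (qRoot p - (qRoot p)⁻¹)⁻¹ • (K p - Kinv p) := by
      rw [← EF_sub]; abel
    have hk : (K p ⊗ₜ[ℂ] K p) ^ (2 * p - 1) = Kinv p ⊗ₜ[ℂ] Kinv p := by
      rw [Algebra.TensorProduct.tmul_pow]; rfl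
    rw [hk]
    simp only [mul_add, add_mul, Algebra.TensorProduct.tmul_mul_tmul, mul_one, one_mul]
    rw [h, K_mul_F, E_mul_Kinv]
    simp only [TensorProduct.add_tmul, TensorProduct.tmul_add, TensorProduct.smul_tmul',
      TensorProduct.tmul_smul, smul_smul, TensorProduct.sub_tmul, TensorProduct.tmul_sub,
      smul_sub, q_neg_two_mul_two, one_smul]
    abel
  E_pow := by
    rw [add_comm]
    refine add_pow_eq_zero_of_qcomm (p_ne_zero p)
      (qRoot_sq_isPrimitiveRoot p (p_ne_zero p)) ?_ ?_ ?_
    · simp only [Algebra.TensorProduct.tmul_mul_tmul, mul_one, one_mul, K_mul_E,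
        TensorProduct.tmul_smul]
    · rw [Algebra.TensorProduct.tmul_pow, (sat_gen p).E_pow, TensorProduct.tmul_zero]
    · rw [Algebra.TensorProduct.tmul_pow, (sat_gen p).E_pow, TensorProduct.zero_tmul]
  F_pow := by
    refine add_pow_eq_zero_of_qcomm (p_ne_zero p)
      (qRoot_sq_isPrimitiveRoot p (p_ne_zero p)) ?_ ?_ ?_
    · simp only [Algebra.TensorProduct.tmul_mul_tmul, mul_one, one_mul, Kinv_mul_F,
        TensorProduct.smul_tmul']
    · rw [Algebra.TensorProduct.tmul_pow, (sat_gen p).F_pow, TensorProduct.zero_tmul]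
    · rw [Algebra.TensorProduct.tmul_pow, (sat_gen p).F_pow, TensorProduct.tmul_zero]
  K_pow := by
    rw [Algebra.TensorProduct.tmul_pow, (sat_gen p).K_pow]; rfl

theorem sat_counit : Sat p (A := ℂ) 0 1 0 where
  K_E := by simp
  K_F := by simp
  E_F := by simp
  E_pow := zero_pow (p_ne_zero p)
  F_pow := zero_pow (p_ne_zero p)
  K_pow := one_pow _

/-- `Δ(E) = E ⊗ K + 1 ⊗ E`, `Δ(K) = K ⊗ K`, `Δ(F) = F ⊗ 1 + K⁻¹ ⊗ F`. -/
def comulHom : UqSl2 p →ₐ[ℂ] UqSl2 p ⊗[ℂ] UqSl2 p := lift (sat_comul p)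

/-- `ε(E) = ε(F) = 0`, `ε(K) = 1`. -/
def counitHom : UqSl2 p →ₐ[ℂ] ℂ := lift (sat_counit p)

@[simp] theorem comulHom_E : comulHom p (E p) = E p ⊗ₜ K p + 1 ⊗ₜ E p := lift_E _
@[simp] theorem comulHom_K : comulHom p (K p) = K p ⊗ₜ K p := lift_K _
@[simp] theorem comulHom_F : comulHom p (F p) = F p ⊗ₜ 1 + Kinv p ⊗ₜ F p := lift_F _
@[simp] theorem counitHom_E : counitHom p (E p) = 0 := lift_E _
@[simp] theorem counitHom_K : counitHom p (K p) = 1 := lift_K _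
@[simp] theorem counitHom_F : counitHom p (F p) = 0 := lift_F _
@[simp] theorem comulHom_Kinv : comulHom p (Kinv p) = Kinv p ⊗ₜ Kinv p := by
  rw [Kinv, map_pow, comulHom_K, Algebra.TensorProduct.tmul_pow]
@[simp] theorem counitHom_Kinv : counitHom p (Kinv p) = 1 := by
  rw [Kinv, map_pow, counitHom_K, one_pow]

instance instBialgebra : Bialgebra ℂ (UqSl2 p) :=
  Bialgebra.ofAlgHom (comulHom p) (counitHom p)
    (by
      apply algHom_ext
      · simp [TensorProduct.add_tmul, TensorProduct.tmul_add, add_assoc,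
          Algebra.TensorProduct.one_def]
      · simp
      · simp [TensorProduct.add_tmul, TensorProduct.tmul_add, add_assoc,
          Algebra.TensorProduct.one_def])
    (by apply algHom_ext <;> simp)
    (by apply algHom_ext <;> simp)

open MulOpposite in
theorem sat_antipode : Sat p (A := (UqSl2 p)ᵐᵒᵖ) (op (-(E p * Kinv p))) (op (Kinv p))
    (op (-(K p * F p))) where
  K_E := by
    rw [← op_mul, ← op_mul, ← op_smul]
    congr 1
    rw [neg_mul, mul_neg, smul_neg, ← mul_assoc, Kinv_mul_E, smul_mul_assoc, smul_smul,
      q_two_mul_neg_two, one_smul]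
  K_F := by
    rw [← op_mul, ← op_mul, ← op_smul]
    congr 1
    rw [neg_mul, mul_neg, smul_neg, mul_assoc, F_mul_Kinv, mul_smul_comm, ← mul_assoc,
      ← mul_assoc, K_mul_Kinv, Kinv_mul_K]
  E_F := by
    rw [← op_mul, ← op_mul, ← op_pow, ← op_sub, ← op_sub, ← op_smul, Kinv_pow_pred]
    congr 1
    have h : (E p * F p) = F p * E p + (qRoot p - (qRoot p)⁻¹)⁻¹ • (K p - Kinv p) := by
      rw [← EF_sub]; abel
    have h1 : K p * F p * (E p * Kinv p) = F p * E p := by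
      rw [K_mul_F, E_mul_Kinv, smul_mul_smul_comm, q_neg_two_mul_two, one_smul, mul_assoc,
        ← mul_assoc (K p), K_mul_Kinv, one_mul]
    have h2 : E p * Kinv p * (K p * F p) = E p * F p := by
      rw [mul_assoc, ← mul_assoc (Kinv p), Kinv_mul_K, one_mul]
    rw [neg_mul_neg, neg_mul_neg, h1, h2, h, smul_sub, smul_sub]
    abel
  E_pow := by
    rw [← op_pow, neg_pow,
      (mul_pow_eq_zero_of_qcomm (Kinv_mul_E p) (sat_gen p).E_pow).1, mul_zero, op_zero]
  F_pow := by
    rw [← op_pow, neg_pow,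
      (mul_pow_eq_zero_of_qcomm (K_mul_F p) (sat_gen p).F_pow).2, mul_zero, op_zero]
  K_pow := by rw [← op_pow, Kinv_pow, op_one]

/-- `S(E) = -E K⁻¹`, `S(K) = K⁻¹`, `S(F) = -K F`, extended as an anti-homomorphism. -/
def antipodeHom : UqSl2 p →ₐ[ℂ] (UqSl2 p)ᵐᵒᵖ := lift (sat_antipode p)

/-- The antipode as a linear map. -/
def antipodeLin : UqSl2 p →ₗ[ℂ] UqSl2 p :=
  (MulOpposite.opLinearEquiv ℂ).symm.toLinearMap ∘ₗ (antipodeHom p).toLinearMap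

theorem antipodeLin_mul (a b : UqSl2 p) :
    antipodeLin p (a * b) = antipodeLin p b * antipodeLin p a := by simp [antipodeLin]
theorem antipodeLin_algebraMap (c : ℂ) :
    antipodeLin p (algebraMap ℂ _ c) = algebraMap ℂ _ c := by
  simp [antipodeLin, MulOpposite.algebraMap_apply]
theorem antipodeLin_one : antipodeLin p 1 = 1 := by simp [antipodeLin]
theorem antipodeLin_E : antipodeLin p (E p) = -(E p * Kinv p) := by
  simp [antipodeLin, antipodeHom]
theorem antipodeLin_K : antipodeLin p (K p) = Kinv p := by simp [antipodeLin, antipodeHom]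
theorem antipodeLin_F : antipodeLin p (F p) = -(K p * F p) := by
  simp [antipodeLin, antipodeHom]
theorem antipodeLin_Kinv : antipodeLin p (Kinv p) = K p := by
  rw [← Kinv_pow_pred p]
  simp only [Kinv, antipodeLin, antipodeHom, LinearMap.comp_apply, AlgHom.toLinearMap_apply,
    map_pow, lift_K]
  simp [← MulOpposite.op_pow]

theorem antipode_left (a : UqSl2 p) : LinearMap.mul' ℂ (UqSl2 p)
    ((antipodeLin p).rTensor _ (comulHom p a)) = algebraMap ℂ _ (counitHom p a) := by
  induction a using induction_gen with
  | hc c => simp [Algebra.TensorProduct.algebraMap_apply, antipodeLin_algebraMap]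
  | hE => simp [antipodeLin_E, antipodeLin_one, mul_assoc, Kinv_mul_K]
  | hK => simp [antipodeLin_K, Kinv_mul_K]
  | hF => simp [antipodeLin_F, antipodeLin_Kinv]
  | hadd a b ha hb => simp only [map_add, ha, hb]
  | hmul a b ha hb =>
    have key : ∀ t s : UqSl2 p ⊗[ℂ] UqSl2 p, ∀ c : ℂ,
        LinearMap.mul' ℂ (UqSl2 p) ((antipodeLin p).rTensor _ t) = algebraMap ℂ _ c →
        LinearMap.mul' ℂ (UqSl2 p) ((antipodeLin p).rTensor _ (t * s)) =
          c • LinearMap.mul' ℂ (UqSl2 p) ((antipodeLin p).rTensor _ s) := by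
      intro t s c hc
      induction s using TensorProduct.induction_on with
      | zero => simp
      | add x y hx hy => simp only [mul_add, map_add, hx, hy, smul_add]
      | tmul u v =>
        have : LinearMap.mul' ℂ (UqSl2 p) ((antipodeLin p).rTensor _ (t * (u ⊗ₜ[ℂ] v))) =
            antipodeLin p u * LinearMap.mul' ℂ (UqSl2 p) ((antipodeLin p).rTensor _ t) * v := by
          clear hc
          induction t using TensorProduct.induction_on with
          | zero => simp
          | add x y hx hy => simp only [mul_add, add_mul, map_add, hx, hy]
          | tmul x y => simp [antipodeLin_mul, mul_assoc]
        rw [this, hc, ← Algebra.commutes, mul_assoc, ← Algebra.smul_def]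
        simp
    rw [map_mul, key _ _ _ ha, hb, map_mul, map_mul, Algebra.smul_def]

theorem antipode_right (a : UqSl2 p) : LinearMap.mul' ℂ (UqSl2 p)
    ((antipodeLin p).lTensor _ (comulHom p a)) = algebraMap ℂ _ (counitHom p a) := by
  induction a using induction_gen with
  | hc c => simp [Algebra.TensorProduct.algebraMap_apply, antipodeLin_one]
  | hE => simp [antipodeLin_E, antipodeLin_K]
  | hK => simp [antipodeLin_K, K_mul_Kinv]
  | hF => simp [antipodeLin_F, antipodeLin_one, ← mul_assoc, Kinv_mul_K]
  | hadd a b ha hb => simp only [map_add, ha, hb]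
  | hmul a b ha hb =>
    have key : ∀ t s : UqSl2 p ⊗[ℂ] UqSl2 p, ∀ c : ℂ,
        LinearMap.mul' ℂ (UqSl2 p) ((antipodeLin p).lTensor _ s) = algebraMap ℂ _ c →
        LinearMap.mul' ℂ (UqSl2 p) ((antipodeLin p).lTensor _ (t * s)) =
          c • LinearMap.mul' ℂ (UqSl2 p) ((antipodeLin p).lTensor _ t) := by
      intro t s c hc
      induction t using TensorProduct.induction_on with
      | zero => simp
      | add x y hx hy => simp only [add_mul, map_add, hx, hy, smul_add]
      | tmul u v =>
        have : LinearMap.mul' ℂ (UqSl2 p) ((antipodeLin p).lTensor _ ((u ⊗ₜ[ℂ] v) * s)) =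
            u * LinearMap.mul' ℂ (UqSl2 p) ((antipodeLin p).lTensor _ s) * antipodeLin p v := by
          clear hc
          induction s using TensorProduct.induction_on with
          | zero => simp
          | add x y hx hy => simp only [mul_add, add_mul, map_add, hx, hy]
          | tmul x y => simp [antipodeLin_mul, mul_assoc]
        rw [this, hc, ← Algebra.commutes, mul_assoc, ← Algebra.smul_def]
        simp
    rw [map_mul, key _ _ _ hb, ha, map_mul, map_mul, Algebra.smul_def, Algebra.commutes]

instance instHopfAlgebra : HopfAlgebra ℂ (UqSl2 p) where
  antipode := antipodeLin p
  mul_antipode_rTensor_comul := LinearMap.ext (antipode_left p)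
  mul_antipode_lTensor_comul := LinearMap.ext (antipode_right p)

end UqSl2

/-! ### The irreducible representations `X⁺_r` -/

namespace XPlus

variable (p r : ℕ)

/-- `E e_n = [n] [r - n] e_{n-1}`, in coordinates. -/
def opE : (Fin r → ℂ) →ₗ[ℂ] (Fin r → ℂ) where
  toFun v n := if h : (n : ℕ) + 1 < r then
    qInt p ((n : ℤ) + 1) * qInt p ((r : ℤ) - (n + 1)) * v ⟨n + 1, h⟩ else 0
  map_add' v w := by
    ext n; by_cases h : (n : ℕ) + 1 < r <;> simp [h, mul_add]
  map_smul' c v := by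
    ext n; by_cases h : (n : ℕ) + 1 < r <;> simp [h, mul_left_comm]

/-- `K e_n = q^(r - 1 - 2n) e_n`, in coordinates. -/
def opK : (Fin r → ℂ) →ₗ[ℂ] (Fin r → ℂ) where
  toFun v n := qRoot p ^ ((r : ℤ) - 1 - 2 * (n : ℤ)) * v n
  map_add' v w := by ext n; simp [mul_add]
  map_smul' c v := by ext n; simp [mul_left_comm]

/-- `F e_n = e_{n+1}` (and `F e_{r-1} = 0`), in coordinates. -/
def opF : (Fin r → ℂ) →ₗ[ℂ] (Fin r → ℂ) where
  toFun v n := if 0 < (n : ℕ) then v ⟨(n : ℕ) - 1, by omega⟩ else 0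
  map_add' v w := by
    ext n; by_cases h : 0 < (n : ℕ) <;> simp [h]
  map_smul' c v := by
    ext n; by_cases h : 0 < (n : ℕ) <;> simp [h]

variable {p r}

theorem opE_apply (v : Fin r → ℂ) (n : Fin r) : opE p r v n = if h : (n : ℕ) + 1 < r then
    qInt p ((n : ℤ) + 1) * qInt p ((r : ℤ) - (n + 1)) * v ⟨n + 1, h⟩ else 0 := rfl

theorem opK_apply (v : Fin r → ℂ) (n : Fin r) :
    opK p r v n = qRoot p ^ ((r : ℤ) - 1 - 2 * (n : ℤ)) * v n := rfl

theorem opF_apply (v : Fin r → ℂ) (n : Fin r) :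
    opF r v n = if 0 < (n : ℕ) then v ⟨(n : ℕ) - 1, by omega⟩ else 0 := rfl

theorem opE_pow (k : ℕ) : ∀ (v : Fin r → ℂ) (n : Fin r), r ≤ n + k →
    (opE p r ^ k) v n = 0 := by
  induction k with
  | zero => intro v n h; omega
  | succ k ih =>
    intro v n h
    rw [pow_succ', Module.End.mul_apply, opE_apply]
    split_ifs with h'
    · rw [ih v ⟨n + 1, h'⟩ (by simp only; omega), mul_zero]
    · rfl

theorem opF_pow (k : ℕ) : ∀ (v : Fin r → ℂ) (n : Fin r), (n : ℕ) < k →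
    (opF r ^ k) v n = 0 := by
  induction k with
  | zero => intro v n h; omega
  | succ k ih =>
    intro v n h
    rw [pow_succ', Module.End.mul_apply, opF_apply]
    split_ifs with h'
    · exact ih v _ (by simp only; omega)
    · rfl

theorem opK_pow (k : ℕ) (v : Fin r → ℂ) (n : Fin r) :
    (opK p r ^ k) v n = (qRoot p ^ ((r : ℤ) - 1 - 2 * (n : ℤ))) ^ k * v n := by
  induction k with
  | zero => simp
  | succ k ih => rw [pow_succ', Module.End.mul_apply, opK_apply, ih]; ring

theorem qInt_zero : qInt p 0 = 0 := by simp [qInt]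

theorem qInt_identity (n r : ℤ) : qInt p (n + 1) * qInt p (r - (n + 1)) - qInt p n * qInt p (r - n)
    = (qRoot p - (qRoot p)⁻¹)⁻¹ *
      (qRoot p ^ (r - 1 - 2 * n) - (qRoot p ^ (r - 1 - 2 * n))⁻¹) := by
  have hq := qRoot_ne_zero p
  by_cases hw : qRoot p - (qRoot p)⁻¹ = 0
  · simp [qInt, hw]
  · have h1 : ∀ a : ℤ, qRoot p ^ (-a) = (qRoot p ^ a)⁻¹ := fun a => zpow_neg _ _
    have e1 : qRoot p ^ (n + 1) = qRoot p ^ n * qRoot p := zpow_add_one₀ hq n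
    have e2 : qRoot p ^ (r - n) = qRoot p ^ r / qRoot p ^ n := zpow_sub₀ hq r n
    have e3 : qRoot p ^ (r - (n + 1)) = qRoot p ^ r / (qRoot p ^ n * qRoot p) := by
      rw [zpow_sub₀ hq, e1]
    have e4 : qRoot p ^ (r - 1 - 2 * n) = qRoot p ^ r / (qRoot p * (qRoot p ^ n) ^ 2) := by
      rw [show r - 1 - 2 * n = r - (1 + (n + n)) by ring, zpow_sub₀ hq, zpow_add₀ hq,
        zpow_add₀ hq, zpow_one, pow_two]
    have a0 : qRoot p ^ n ≠ 0 := zpow_ne_zero _ hq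
    have b0 : qRoot p ^ r ≠ 0 := zpow_ne_zero _ hq
    simp only [qInt, h1, e1, e2, e3, e4]
    generalize qRoot p ^ n = a at *
    generalize qRoot p ^ r = b at *
    generalize qRoot p = q at *
    have hw' : q ^ 2 - 1 ≠ 0 := by
      intro h; apply hw; field_simp; linear_combination h
    field_simp
    ring

theorem qRoot_pow_two_mul (p : ℕ) (hp : p ≠ 0) (a : ℤ) : (qRoot p ^ a) ^ (2 * p) = 1 := by
  rw [← zpow_natCast, ← zpow_mul, mul_comm, zpow_mul, zpow_natCast,
    (qRoot_isPrimitiveRoot p hp).pow_eq_one, one_zpow]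

theorem sat [hp2 : Fact (2 ≤ p)] (hr : r ≤ p) :
    UqSl2.Sat p (A := Module.End ℂ (Fin r → ℂ)) (opE p r) (opK p r) (opF r) where
  K_E := by
    ext v n
    simp only [LinearMap.comp_apply, Module.End.mul_apply, LinearMap.smul_apply, Pi.smul_apply,
      smul_eq_mul, opE_apply, opK_apply]
    split_ifs with h
    · have : qRoot p ^ ((r : ℤ) - 1 - 2 * (n : ℤ)) =
          qRoot p ^ (2 : ℤ) * qRoot p ^ ((r : ℤ) - 1 - 2 * ((n + 1 : ℕ) : ℤ)) := by
        rw [← zpow_add₀ (qRoot_ne_zero p)]; congr 1; push_cast; ring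
      rw [this]; ring
    · simp
  K_F := by
    ext v n
    simp only [LinearMap.comp_apply, Module.End.mul_apply, LinearMap.smul_apply, Pi.smul_apply,
      smul_eq_mul, opF_apply, opK_apply]
    split_ifs with h
    · have : qRoot p ^ ((r : ℤ) - 1 - 2 * (n : ℤ)) =
          qRoot p ^ (-2 : ℤ) * qRoot p ^ ((r : ℤ) - 1 - 2 * (((n : ℕ) - 1 : ℕ) : ℤ)) := by
        rw [← zpow_add₀ (qRoot_ne_zero p)]; congr 1; push_cast [Nat.cast_sub h]; ring
      rw [this]; ring
    · simp
  E_F := by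
    have hp := hp2.out
    apply LinearMap.ext
    intro v
    funext n
    have hk : (qRoot p ^ ((r : ℤ) - 1 - 2 * (n : ℤ))) ^ (2 * p - 1) =
        (qRoot p ^ ((r : ℤ) - 1 - 2 * (n : ℤ)))⁻¹ := by
      apply eq_inv_of_mul_eq_one_left
      rw [← pow_succ,
        ← qRoot_pow_two_mul p (by omega) ((r : ℤ) - 1 - 2 * (n : ℤ))]
      congr 1
      omega
    have h1 : opE p r (opF r v) n = qInt p ((n : ℤ) + 1) * qInt p ((r : ℤ) - (n + 1)) * v n := by
      rw [opE_apply]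
      split_ifs with h
      · rw [opF_apply]; simp
      · have : (r : ℤ) - (n + 1) = 0 := by have := n.2; omega
        rw [this, qInt_zero]; simp
    have h2 : opF r (opE p r v) n = qInt p n * qInt p ((r : ℤ) - n) * v n := by
      rw [opF_apply]
      split_ifs with h
      · have e : (n : ℕ) - 1 + 1 = n := by omega
        have e' : (((n : ℕ) - 1 : ℕ) : ℤ) + 1 = n := by omega
        rw [opE_apply, dif_pos (by simp only; omega)]
        simp only [e, e']
      · have : ((n : ℕ) : ℤ) = 0 := by omega
        rw [this, qInt_zero]; simp
    have := qInt_identity (p := p) n r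
    simp only [LinearMap.sub_apply, Module.End.mul_apply, LinearMap.smul_apply, Pi.sub_apply,
      Pi.smul_apply, smul_eq_mul, h1, h2, opK_pow, opK_apply, hk]
    linear_combination v n * this
  E_pow := by
    apply LinearMap.ext
    intro v
    funext n
    exact opE_pow p v n (by omega)
  F_pow := by
    apply LinearMap.ext
    intro v
    funext n
    exact opF_pow p v n (by omega)
  K_pow := by
    have hp := hp2.out
    apply LinearMap.ext
    intro v
    funext n
    rw [opK_pow, qRoot_pow_two_mul p (by omega)]
    simp

end XPlus

/-- The irreducible representation `X⁺_r` of `U`, `1 ≤ r ≤ p`, with basis `e_0, …, e_{r-1}`,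
`K e_n = q^(r-1-2n) e_n`, `E e_n = [n][r-n] e_{n-1}`, `F e_n = e_{n+1}` (and `F e_{r-1} = 0`). -/
def XPlus (p r : ℕ) (_ : r ≤ p) : Type := Fin r → ℂ

namespace XPlus
variable (p r : ℕ) (hr : r ≤ p)

instance : AddCommGroup (XPlus p r hr) := inferInstanceAs (AddCommGroup (Fin r → ℂ))
instance : Module ℂ (XPlus p r hr) := inferInstanceAs (Module ℂ (Fin r → ℂ))

/-- The representation of `U` on `X⁺_r`. -/
def rep [Fact (2 ≤ p)] : UqSl2 p →ₐ[ℂ] Module.End ℂ (XPlus p r hr) :=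
  UqSl2.lift (A := Module.End ℂ (Fin r → ℂ)) (XPlus.sat hr)

instance [Fact (2 ≤ p)] : Module (UqSl2 p) (XPlus p r hr) :=
  Module.compHom _ (rep p r hr).toRingHom

end XPlus

/-! ### Projective covers and decompositions -/

/-- `π : P → X` is a projective cover: `P` is projective and `π` is an essential epimorphism. -/
def IsProjectiveCover (R : Type*) [Ring R] {P X : Type*} [AddCommGroup P] [Module R P]
    [AddCommGroup X] [Module R X] (π : P →ₗ[R] X) : Prop :=
  Module.Projective R P ∧ Function.Surjective π ∧
    ∀ N : Submodule R P, N ⊔ LinearMap.ker π = ⊤ → N = ⊤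

/-- A nonzero module that is not the direct sum of two nonzero submodules. -/
def IsIndecomposableModule (R M : Type*) [Ring R] [AddCommGroup M] [Module R M] : Prop :=
  Nontrivial M ∧ ∀ A B : Submodule R M, IsCompl A B → A = ⊥ ∨ B = ⊥

/-- `ν = p` for odd `p` and `ν = p - 1` for even `p`. -/
def nu (p : ℕ) : ℕ := if Odd p then p else p - 1

theorem nu_le (p : ℕ) : nu p ≤ p := by unfold nu; split_ifs <;> omega

/-- The indices `1, 3, …, ν`. -/
abbrev OddIndex (p : ℕ) : Type := {r : ℕ // Odd r ∧ r ≤ nu p}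

/-- `M` is the internal direct sum of indecomposable `U`-submodules `N 1, N 3, …, N ν`, with
`N r` a projective cover `P⁺_r` of the irreducible representation `X⁺_r`. -/
structure IsOddProjectiveDecomposition (p : ℕ) [Fact (2 ≤ p)] {M : Type*} [AddCommGroup M]
    [Module (UqSl2 p) M] (N : OddIndex p → Submodule (UqSl2 p) M) : Prop where
  isInternal : DirectSum.IsInternal N
  indecomposable : ∀ r, IsIndecomposableModule (UqSl2 p) (N r)
  cover : ∀ r : OddIndex p, ∃ π : N r →ₗ[UqSl2 p] XPlus p r (r.2.2.trans (nu_le p)),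
    IsProjectiveCover (UqSl2 p) π

/-! ### Module algebras -/

/-- For a bialgebra `H`, the `H`-module structure on the algebra `V` satisfies
`h 1 = ε(h) 1` and `h (v w) = ∑ h'(v) h''(w)` where `Δ(h) = ∑ h' ⊗ h''`. -/
structure IsModuleAlgebra (H V : Type*) [Ring H] [Bialgebra ℂ H] [Ring V] [Algebra ℂ V]
    [Module H V] [IsScalarTower ℂ H V] : Prop where
  smul_one : ∀ h : H, h • (1 : V) = algebraMap ℂ V (Coalgebra.counit (R := ℂ) h)
  smul_mul : ∀ (h : H) (v w : V), h • (v * w) =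
    LinearMap.mul' ℂ V (TensorProduct.map
      ((LinearMap.toSpanSingleton H V v).restrictScalars ℂ)
      ((LinearMap.toSpanSingleton H V w).restrictScalars ℂ)
      (Coalgebra.comul (R := ℂ) h))

/-! ### The action on matrices -/

section Matrices

variable (p : ℕ)

/-- `(E X)_{ij} = (x_{i,j+1} - q^{2(i-j-1)} x_{i-1,j}) / (q - q⁻¹)`, entries outside of the matrix
being read as `0`.  Rows and columns are numbered from `0`. -/
def matE (X : Matrix (Fin p) (Fin p) ℂ) : Matrix (Fin p) (Fin p) ℂ := fun i j =>
  (qRoot p - (qRoot p)⁻¹)⁻¹ *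
    ((if h : (j : ℕ) + 1 < p then X i ⟨j + 1, h⟩ else 0) -
      qRoot p ^ (2 * ((i : ℤ) - j - 1)) *
        (if 0 < (i : ℕ) then X ⟨(i : ℕ) - 1, by omega⟩ j else 0))

/-- `(K X)_{ij} = q^{2(i-j)} x_{ij}`. -/
def matK (X : Matrix (Fin p) (Fin p) ℂ) : Matrix (Fin p) (Fin p) ℂ := fun i j =>
  qRoot p ^ (2 * ((i : ℤ) - j)) * X i j

/-- `(F X)_{ij} = q^{1-i} [i] x_{i+1,j} - q^{j-2i} [j-1] x_{i,j-1}` for `i, j` numbered from `1`.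
Here rows and columns are numbered from `0`, whence the shift of `i` and `j` by one. -/
def matF (X : Matrix (Fin p) (Fin p) ℂ) : Matrix (Fin p) (Fin p) ℂ := fun i j =>
  qRoot p ^ (1 - ((i : ℤ) + 1)) * qInt p ((i : ℤ) + 1) *
      (if h : (i : ℕ) + 1 < p then X ⟨i + 1, h⟩ j else 0) -
    qRoot p ^ (((j : ℤ) + 1) - 2 * ((i : ℤ) + 1)) * qInt p (((j : ℤ) + 1) - 1) *
      (if 0 < (j : ℕ) then X i ⟨(j : ℕ) - 1, by omega⟩ else 0)

/-- The matrix of `z`: units below the diagonal. -/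
def matZ : Matrix (Fin p) (Fin p) ℂ := fun i j => if (i : ℕ) = j + 1 then 1 else 0

/-- The matrix of `∂`: `(q - q⁻¹) q^{1-i} [i]` at the place `(i, i+1)`, for `i` numbered
from `1`. -/
def matD : Matrix (Fin p) (Fin p) ℂ := fun i j =>
  if (j : ℕ) = i + 1 then
    (qRoot p - (qRoot p)⁻¹) * (qRoot p ^ (1 - ((i : ℤ) + 1)) * qInt p ((i : ℤ) + 1))
  else 0

end Matrices

/-! ### The algebra of `q`-differential operators -/

namespace QDiff

/-- Generators `z`, `∂`. -/
inductive Gen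
  | z | D

/-- The free generators. -/
abbrev free (g : Gen) : FreeAlgebra ℂ Gen := FreeAlgebra.ι ℂ g

/-- `∂ z = q - q⁻¹ + q⁻² z ∂`, `z^p = 0`, `∂^p = 0`. -/
inductive Rel (p : ℕ) : FreeAlgebra ℂ Gen → FreeAlgebra ℂ Gen → Prop
  | D_z : Rel p (free .D * free .z) (algebraMap ℂ _ (qRoot p - (qRoot p)⁻¹) +
      (qRoot p ^ (-2 : ℤ)) • (free .z * free .D))
  | z_pow : Rel p (free .z ^ p) 0
  | D_pow : Rel p (free .D ^ p) 0

end QDiff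

/-- The algebra of `q`-differential operators on generators `z`, `∂` with relations
`∂ z = q - q⁻¹ + q⁻² z ∂` and `z^p = ∂^p = 0`. -/
abbrev QDiff (p : ℕ) : Type := PresAlg (QDiff.Rel p)

namespace QDiff

variable (p : ℕ)

/-- The generator `z`. -/
def z : QDiff p := PresAlg.mk (Rel p) (free .z)
/-- The generator `∂`. -/
def D : QDiff p := PresAlg.mk (Rel p) (free .D)

/-- `t = ∑_{i=1}^{p-1} z^i ∂^i / [i]`. -/
def t : QDiff p := ∑ i ∈ Finset.Icc 1 (p - 1), (qInt p i)⁻¹ • (z p ^ i * D p ^ i)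

/-- The `2p` elements `1, z, …, z^{p-1}`; `∂, …, ∂^{p-1}`; `t`. -/
def wing : Fin p ⊕ Fin (p - 1) ⊕ Unit → QDiff p
  | .inl i => z p ^ (i : ℕ)
  | .inr (.inl i) => D p ^ ((i : ℕ) + 1)
  | .inr (.inr _) => t p

open UqSl2 in
/-- The action of `U` on powers of `z` and of `∂`. -/
structure IsStandardAction [Module (UqSl2 p) (QDiff p)] : Prop where
  E_z : ∀ m : ℕ, E p • z p ^ m = (-(qRoot p ^ m * qInt p m)) • z p ^ (m + 1)
  K_z : ∀ m : ℕ, K p • z p ^ m = (qRoot p ^ (2 * m)) • z p ^ m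
  F_z : ∀ m : ℕ, F p • z p ^ m = (qInt p m * qRoot p ^ (1 - (m : ℤ))) • z p ^ (m - 1)
  E_D : ∀ n : ℕ, E p • D p ^ n = (qRoot p ^ (1 - (n : ℤ)) * qInt p n) • D p ^ (n - 1)
  K_D : ∀ n : ℕ, K p • D p ^ n = (qRoot p ^ (-2 * (n : ℤ))) • D p ^ n
  F_D : ∀ n : ℕ, F p • D p ^ n = (-(qRoot p ^ n * qInt p n)) • D p ^ (n + 1)

open UqSl2 in
/-- The diagram of `P⁺₁`: the wings are the powers of `z` and of `∂`, `t` is at the top and `1`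
at the bottom. -/
structure IsWingDiagram [Module (UqSl2 p) (QDiff p)] : Prop where
  linearIndependent : LinearIndependent ℂ (wing p)
  E_t : E p • t p = z p
  F_t : F p • t p = D p
  K_t : K p • t p = t p
  left : ∀ m : ℕ, 1 ≤ m → m + 1 ≤ p - 1 →
    (∃ c : ℂ, c ≠ 0 ∧ E p • z p ^ m = c • z p ^ (m + 1)) ∧
    (∃ c : ℂ, c ≠ 0 ∧ F p • z p ^ (m + 1) = c • z p ^ m)
  right : ∀ m : ℕ, 1 ≤ m → m + 1 ≤ p - 1 →
    (∃ c : ℂ, c ≠ 0 ∧ F p • D p ^ m = c • D p ^ (m + 1)) ∧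
    (∃ c : ℂ, c ≠ 0 ∧ E p • D p ^ (m + 1) = c • D p ^ m)
  E_end : E p • z p ^ (p - 1) = 0
  F_end : F p • D p ^ (p - 1) = 0
  F_z : F p • z p = 1
  E_D : E p • D p = 1
  E_one : E p • (1 : QDiff p) = 0
  F_one : F p • (1 : QDiff p) = 0

end QDiff

/-! ### The odd counterpart and the de Rham complex -/

namespace QOdd

/-- Generators `ζ`, `δ`. -/
inductive Gen
  | zeta | delta

/-- The free generators. -/
abbrev free (g : Gen) : FreeAlgebra ℂ Gen := FreeAlgebra.ι ℂ g

/-- `ζ² = δ² = 0`, `δ ζ = -q⁻² ζ δ`. -/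
inductive Rel (p : ℕ) : FreeAlgebra ℂ Gen → FreeAlgebra ℂ Gen → Prop
  | zeta_sq : Rel p (free .zeta ^ 2) 0
  | delta_sq : Rel p (free .delta ^ 2) 0
  | delta_zeta : Rel p (free .delta * free .zeta)
      ((-qRoot p ^ (-2 : ℤ)) • (free .zeta * free .delta))

end QOdd

/-- The odd algebra on `ζ`, `δ` with relations `ζ² = δ² = 0`, `δ ζ = -q⁻² ζ δ`. -/
abbrev QOdd (p : ℕ) : Type := PresAlg (QOdd.Rel p)

namespace QDeRham

/-- Generators `z`, `∂`, `ζ = dz`, `δ = d∂`. -/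
inductive Gen
  | z | D | zeta | delta

/-- The free generators. -/
abbrev free (g : Gen) : FreeAlgebra ℂ Gen := FreeAlgebra.ι ℂ g

/-- The relations of `z`, `∂`, those of `ζ`, `δ`, and the cross relations
`ζ z = q⁻² z ζ`, `δ ∂ = q² ∂ δ`, `ζ ∂ = q² ∂ ζ`, `δ z = q⁻² z δ`. -/
inductive Rel (p : ℕ) : FreeAlgebra ℂ Gen → FreeAlgebra ℂ Gen → Prop
  | D_z : Rel p (free .D * free .z) (algebraMap ℂ _ (qRoot p - (qRoot p)⁻¹) +
      (qRoot p ^ (-2 : ℤ)) • (free .z * free .D))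
  | z_pow : Rel p (free .z ^ p) 0
  | D_pow : Rel p (free .D ^ p) 0
  | zeta_sq : Rel p (free .zeta ^ 2) 0
  | delta_sq : Rel p (free .delta ^ 2) 0
  | delta_zeta : Rel p (free .delta * free .zeta)
      ((-qRoot p ^ (-2 : ℤ)) • (free .zeta * free .delta))
  | zeta_z : Rel p (free .zeta * free .z) ((qRoot p ^ (-2 : ℤ)) • (free .z * free .zeta))
  | delta_D : Rel p (free .delta * free .D) ((qRoot p ^ (2 : ℤ)) • (free .D * free .delta))
  | zeta_D : Rel p (free .zeta * free .D) ((qRoot p ^ (2 : ℤ)) • (free .D * free .zeta))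
  | delta_z : Rel p (free .delta * free .z) ((qRoot p ^ (-2 : ℤ)) • (free .z * free .delta))

end QDeRham

/-- The algebra underlying the quantum de Rham complex. -/
abbrev QDeRham (p : ℕ) : Type := PresAlg (QDeRham.Rel p)

namespace QDeRham

variable (p : ℕ)

/-- The generator `z`. -/
def z : QDeRham p := PresAlg.mk (Rel p) (free .z)
/-- The generator `∂`. -/
def D : QDeRham p := PresAlg.mk (Rel p) (free .D)
/-- The generator `ζ`. -/
def zeta : QDeRham p := PresAlg.mk (Rel p) (free .zeta)
/-- The generator `δ`. -/
def delta : QDeRham p := PresAlg.mk (Rel p) (free .delta)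

/-- Images of `z`, `∂`. -/
def evenFun : QDiff.Gen → QDeRham p
  | .z => z p
  | .D => D p

/-- Images of `ζ`, `δ`. -/
def oddFun : QOdd.Gen → QDeRham p
  | .zeta => zeta p
  | .delta => delta p

/-- The canonical homomorphism from the algebra on `z`, `∂`. -/
def even : QDiff p →ₐ[ℂ] QDeRham p :=
  PresAlg.lift (evenFun p) <| by
    intro a b h
    cases h with
    | D_z => simpa [evenFun, z, D] using PresAlg.mk_rel (Rel.D_z (p := p))
    | z_pow => simpa [evenFun, z] using PresAlg.mk_rel (Rel.z_pow (p := p))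
    | D_pow => simpa [evenFun, D] using PresAlg.mk_rel (Rel.D_pow (p := p))

/-- The canonical homomorphism from the algebra on `ζ`, `δ`. -/
def odd : QOdd p →ₐ[ℂ] QDeRham p :=
  PresAlg.lift (oddFun p) <| by
    intro a b h
    cases h with
    | zeta_sq => simpa [oddFun, zeta] using PresAlg.mk_rel (Rel.zeta_sq (p := p))
    | delta_sq => simpa [oddFun, delta] using PresAlg.mk_rel (Rel.delta_sq (p := p))
    | delta_zeta =>
      simpa [oddFun, zeta, delta] using PresAlg.mk_rel (Rel.delta_zeta (p := p))

/-- The linear map `a ⊗ b ↦ a b` from the tensor product of the two algebras. -/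
def mulMap : QDiff p ⊗[ℂ] QOdd p →ₗ[ℂ] QDeRham p :=
  LinearMap.mul' ℂ (QDeRham p) ∘ₗ
    TensorProduct.map (even p).toLinearMap (odd p).toLinearMap

/-- The space of `n`-forms: `a`, `a ζ + b δ`, `a ζ δ` for `n = 0, 1, 2`, with `a`, `b` in the
algebra on `z`, `∂`. -/
def forms : ℕ → Submodule ℂ (QDeRham p)
  | 0 => LinearMap.range (even p).toLinearMap
  | 1 => LinearMap.range (LinearMap.mulRight ℂ (zeta p) ∘ₗ (even p).toLinearMap) ⊔
      LinearMap.range (LinearMap.mulRight ℂ (delta p) ∘ₗ (even p).toLinearMap)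
  | 2 => LinearMap.range (LinearMap.mulRight ℂ (zeta p * delta p) ∘ₗ (even p).toLinearMap)
  | _ + 3 => ⊥

open UqSl2 in
/-- The action of `U` on the differentials `ζ`, `δ`. -/
structure IsStandardAction [Module (UqSl2 p) (QDeRham p)] : Prop where
  E_zeta : E p • zeta p = (-qInt p 2) • (z p * zeta p)
  K_zeta : K p • zeta p = (qRoot p ^ (2 : ℤ)) • zeta p
  F_zeta : F p • zeta p = 0
  E_delta : E p • delta p = 0
  K_delta : K p • delta p = (qRoot p ^ (-2 : ℤ)) • delta p
  F_delta : F p • delta p = (-(qRoot p ^ (2 : ℤ) * qInt p 2)) • (D p * delta p)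

end QDeRham

/-- `(Ω, d)`, graded by `𝒜`, is a differential graded algebra and a differential `H`-module
algebra: the `H`-module algebra structure is compatible with the grading and commutes with `d`. -/
structure IsDifferentialModuleAlgebra (H : Type*) {Ω : Type*} [Ring H] [Bialgebra ℂ H] [Ring Ω]
    [Algebra ℂ Ω] [Module H Ω] [IsScalarTower ℂ H Ω] (𝒜 : ℕ → Submodule ℂ Ω)
    (d : Ω →ₗ[ℂ] Ω) : Prop where
  isInternal : DirectSum.IsInternal 𝒜
  one_mem : (1 : Ω) ∈ 𝒜 0
  mul_mem : ∀ m n, ∀ a ∈ 𝒜 m, ∀ b ∈ 𝒜 n, a * b ∈ 𝒜 (m + n)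
  d_mem : ∀ n, ∀ a ∈ 𝒜 n, d a ∈ 𝒜 (n + 1)
  d_d : ∀ a, d (d a) = 0
  leibniz : ∀ n, ∀ a ∈ 𝒜 n, ∀ b, d (a * b) = d a * b + (-1 : ℂ) ^ n • (a * d b)
  isModuleAlgebra : IsModuleAlgebra H Ω
  smul_mem : ∀ (h : H) (n), ∀ a ∈ 𝒜 n, h • a ∈ 𝒜 n
  d_smul : ∀ (h : H) (a), d (h • a) = h • d a

end

noncomputable section

/-! ### Arithmetic of `q` -/

section qArith
variable (p : ℕ) [hp2 : Fact (2 ≤ p)]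

/-! The three actions have one source. Write κ = q − q⁻¹. Let an algebra contain z, ∂ with ∂z = κ +
q⁻²z∂ and z^p = ∂^p = 0, and let k be an automorphism with k^p = 1 that scales z, ∂ by q², q⁻²
(`QWeylData`). Put K = k, E(a) = κ⁻¹(az − z k(a)), F(a) = κ⁻¹(∂a − k⁻¹(a)∂). These are twisted inner
derivations whose Leibniz rules are the given coproduct (`QWeylData.rep_mul'`); [E,F] comes from the
constant κ in ∂z; and E^p = F^p = 0 because each operator is a difference of two nilpotents
commuting up to q², so that the q-binomial theorem at a root of unity applies. Matrices, the algebra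
on z, ∂, and Ω are instances, and a homomorphism respecting z, ∂, k is automatically U-linear. The
monomials z^a∂^b with a, b < p span the algebra on z, ∂ and have independent images in matrices,
whence the isomorphism.

For the decomposition, let M be the algebra on z, ∂. It has dimension p² and is generated over U by
the K-fixed vector v = z^{p−1}∂^{p−1}. Let e ∈ U be the projector onto K = 1. As Ue is spanned by
the p² elements E^bF^a e, counting dimensions shows that uv = 0 implies ue = 0. So M is a retract of
U, hence projective, and v can be mapped to any K-fixed vector of any module. Let C be the Casimir
element. On a weight space EF is C minus a scalar, so the weight-zero part of M is ℂ[C]v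
(`exists_aeval_casimir_smul`). The summands are the generalized eigenspaces of C; only values
attached to odd r occur, because all weights of M are even powers of q. Let φ : M → X⁺_r send v to
the weight-zero vector, and let w = g(C)v have φ(w) ≠ 0. Then g does not vanish at the eigenvalue c
of C on X⁺_r, so g is coprime to (x − c)^k, and w generates the whole c-summand
(`casimirSubmodule_le_span`). This one fact yields both the essential epimorphism onto X⁺_r and
indecomposability. For r = 1 the element t is such a w: it lies in the summand since (C − c)t = EFt
= 1 and (C − c)1 = 0, and φ(t) ≠ 0 by a geometric sum. Hence the summand is Ut, the span of the
wing.

For Ω, the map d is the corner entry of an algebra homomorphism a ↦ [[parity(a), da], [0, a]], so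
its existence amounts to checking relations. It commutes with U because parity(a)ζ = ζk(a) and δa =
parity(k⁻¹(a))δ. The forms of degree n are the 2^n-eigenspace of a scaling automorphism. Finally Ω
maps to End(M) ⊗ ℂ_q[ζ,δ], with ζ, δ twisted by k⁻¹; evaluating operators at 1 inverts a ⊗ b ↦ ab.
-/

theorem qRoot_zpow_eq_one_iff (n : ℤ) : qRoot p ^ n = 1 ↔ (2 * p : ℤ) ∣ n := by
  have := (qRoot_isPrimitiveRoot p (UqSl2.p_ne_zero p)).zpow_eq_one_iff_dvd n
  exact_mod_cast this

theorem qRoot_sub_inv_ne_zero : qRoot p - (qRoot p)⁻¹ ≠ 0 := by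
  intro h
  have h1 : qRoot p ^ (2 : ℤ) = 1 := by
    rw [zpow_two]
    nth_rewrite 2 [sub_eq_zero.mp h]
    exact mul_inv_cancel₀ (qRoot_ne_zero p)
  have := Int.le_of_dvd (by norm_num) ((qRoot_zpow_eq_one_iff p 2).mp h1)
  have := hp2.out
  omega

theorem qInt_mul (n : ℤ) :
    qInt p n * (qRoot p - (qRoot p)⁻¹) = qRoot p ^ n - qRoot p ^ (-n) :=
  div_mul_cancel₀ _ (qRoot_sub_inv_ne_zero p)

/-- Vanishing would give q^{2n} = 1, so 2p would divide 2n, which is too small. -/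
theorem qInt_ne_zero {n : ℤ} (h0 : 0 < n) (hn : n < p) : qInt p n ≠ 0 := by
  intro h
  have h1 := qInt_mul p n
  rw [h, zero_mul] at h1
  have h2 : qRoot p ^ (2 * n) = 1 := by
    rw [two_mul, zpow_add₀ (qRoot_ne_zero p)]
    nth_rewrite 2 [sub_eq_zero.mp h1.symm]
    rw [← zpow_add₀ (qRoot_ne_zero p)]
    simp
  have := Int.le_of_dvd (by omega) ((qRoot_zpow_eq_one_iff p _).mp h2)
  omega

theorem qInt_one : qInt p 1 = 1 := by
  rw [qInt, zpow_one, zpow_neg_one, div_self (qRoot_sub_inv_ne_zero p)]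

theorem qInt_p : qInt p p = 0 := by
  have : qRoot p ^ (p : ℤ) = qRoot p ^ (-(p : ℤ)) := by
    rw [← mul_inv_eq_one₀ (zpow_ne_zero _ (qRoot_ne_zero p)), ← zpow_neg,
      ← zpow_add₀ (qRoot_ne_zero p), qRoot_zpow_eq_one_iff]
    exact ⟨1, by ring⟩
  rw [qInt, this, sub_self, zero_div]

/-- The number q^{1−n}[n] is the sum 1 + q⁻² + … + q^{−2(n−1)}, and this is its recursion. It
governs both the passage of ∂ through powers of z and the entries of the matrix of ∂. -/
theorem qRoot_zpow_mul_qInt_succ (n : ℤ) : qRoot p ^ (1 - (n + 1)) * qInt p (n + 1) =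
    1 + qRoot p ^ (-2 : ℤ) * (qRoot p ^ (1 - n) * qInt p n) := by
  apply mul_right_cancel₀ (qRoot_sub_inv_ne_zero p)
  have h1 := qInt_mul p (n + 1)
  have h0 := qInt_mul p n
  rw [mul_assoc, h1, add_mul, mul_assoc, mul_assoc, h0, mul_sub, mul_sub, mul_sub, one_mul]
  simp only [← zpow_add₀ (qRoot_ne_zero p)]
  rw [mul_sub, ← zpow_add₀ (qRoot_ne_zero p), ← zpow_add₀ (qRoot_ne_zero p),
    show 1 - (n + 1) + (n + 1) = 1 by ring, show -2 + (1 - n + n) = -1 by ring,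
    show 1 - (n + 1) + -(n + 1) = -2 + (1 - n + -n) by ring, zpow_one, zpow_neg_one]
  ring

theorem one_sub_qRoot_zpow (n : ℤ) : (qRoot p - (qRoot p)⁻¹)⁻¹ * (1 - qRoot p ^ (2 * n)) =
    -(qRoot p ^ n * qInt p n) := by
  have h0 := qInt_mul p n
  rw [inv_mul_eq_iff_eq_mul₀ (qRoot_sub_inv_ne_zero p)]
  have : qRoot p ^ (2 * n) = qRoot p ^ n * qRoot p ^ n := by
    rw [two_mul, zpow_add₀ (qRoot_ne_zero p)]
  have h2 : qRoot p ^ n * qRoot p ^ (-n) = 1 := by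
    rw [← zpow_add₀ (qRoot_ne_zero p)]; simp
  rw [this]
  linear_combination qRoot p ^ n * h0 - h2

end qArith

/-- Since `c` and `b` commute up to `w`, the product `b * c` is nilpotent with `b`, and the
q-binomial theorem at a root of unity then leaves no middle terms. The operators of E and F have
this shape: a multiplication minus a multiplication composed with an automorphism. -/
theorem sub_mul_pow_eq_zero_of_qcomm {A : Type*} [Ring A] [Algebra ℂ A] {p : ℕ} (hp : p ≠ 0)
    {w : ℂ} (hw : IsPrimitiveRoot w p) {a b c : A} (h : b * c * a = w • (a * (b * c)))
    (hbc : c * b = w • (b * c)) (ha : a ^ p = 0) (hb : b ^ p = 0) : (a - b * c) ^ p = 0 := by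
  rw [sub_eq_add_neg]
  refine add_pow_eq_zero_of_qcomm hp hw (by simp [h]) ha ?_
  rw [neg_pow, (mul_pow_eq_zero_of_qcomm hbc hb).1, mul_zero]

/-! ### Algebras with an inner action of `U` -/

/-- An algebra with elements `z`, `∂` satisfying the relations of the `q`-differential operators,
and with an automorphism `k` of order `p` that scales them by `q²` and `q⁻²`. -/
structure QWeylData (p : ℕ) (A : Type*) [Ring A] [Algebra ℂ A] where
  z : A
  D : A
  k : A →ₐ[ℂ] A
  kinv : A →ₐ[ℂ] A
  D_mul_z : D * z = algebraMap ℂ A (qRoot p - (qRoot p)⁻¹) + (qRoot p ^ (-2 : ℤ)) • (z * D)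
  z_pow : z ^ p = 0
  D_pow : D ^ p = 0
  k_z : k z = (qRoot p ^ (2 : ℤ)) • z
  k_D : k D = (qRoot p ^ (-2 : ℤ)) • D
  k_kinv : ∀ a, k (kinv a) = a
  kinv_k : ∀ a, kinv (k a) = a
  k_pow : k.toLinearMap ^ p = 1

namespace QWeylData

set_option linter.unusedSectionVars false

variable {p : ℕ} [hp2 : Fact (2 ≤ p)] {A : Type*} [Ring A] [Algebra ℂ A] (W : QWeylData p A)

theorem kinv_z : W.kinv W.z = (qRoot p ^ (-2 : ℤ)) • W.z := by
  have h := W.kinv_k W.z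
  rw [W.k_z, map_smul] at h
  nth_rewrite 2 [← h]
  rw [smul_smul, UqSl2.q_neg_two_mul_two, one_smul]

theorem kinv_D : W.kinv W.D = (qRoot p ^ (2 : ℤ)) • W.D := by
  have h := W.kinv_k W.D
  rw [W.k_D, map_smul] at h
  nth_rewrite 2 [← h]
  rw [smul_smul, UqSl2.q_two_mul_neg_two, one_smul]

/-- The operator of `E`. -/
def opE : Module.End ℂ A := (qRoot p - (qRoot p)⁻¹)⁻¹ •
  (LinearMap.mulRight ℂ W.z - LinearMap.mulLeft ℂ W.z * W.k.toLinearMap)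

/-- The operator of `F`. -/
def opF : Module.End ℂ A := (qRoot p - (qRoot p)⁻¹)⁻¹ •
  (LinearMap.mulLeft ℂ W.D - LinearMap.mulRight ℂ W.D * W.kinv.toLinearMap)

theorem opE_apply (a : A) :
    W.opE a = (qRoot p - (qRoot p)⁻¹)⁻¹ • (a * W.z - W.z * W.k a) := rfl

theorem opF_apply (a : A) :
    W.opF a = (qRoot p - (qRoot p)⁻¹)⁻¹ • (W.D * a - W.kinv a * W.D) := rfl

theorem kinv_comp_k : W.kinv.toLinearMap * W.k.toLinearMap = 1 := LinearMap.ext W.kinv_k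

theorem k_pow_two_mul : W.k.toLinearMap ^ (2 * p) = 1 := by
  rw [mul_comm, pow_mul, W.k_pow, one_pow]

/-- In `UqSl2` the inverse of K is the power K^{2p−1}, so its operator has to be identified with
`kinv`. -/
theorem k_pow_pred : W.k.toLinearMap ^ (2 * p - 1) = W.kinv.toLinearMap := by
  have hp := hp2.out
  calc W.k.toLinearMap ^ (2 * p - 1)
      = W.kinv.toLinearMap * (W.k.toLinearMap * W.k.toLinearMap ^ (2 * p - 1)) := by
        rw [← mul_assoc, kinv_comp_k, one_mul]
    _ = W.kinv.toLinearMap := by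
        rw [← pow_succ', show 2 * p - 1 + 1 = 2 * p by omega, k_pow_two_mul, mul_one]

/-- Left and right multiplications commute, and k scales z and ∂, so the relations of K with E, F
are immediate. In [E,F] everything cancels except ∂z − q⁻²z∂ = κ, which multiplies k(a) on the left
and k⁻¹(a) on the right. -/
theorem sat : UqSl2.Sat p W.opE W.k.toLinearMap W.opF where
  K_E := by
    ext a
    simp only [Module.End.mul_apply, AlgHom.toLinearMap_apply, opE_apply, LinearMap.smul_apply,
      map_smul, map_sub, map_mul, W.k_z, smul_mul_assoc, mul_smul_comm, ← smul_sub]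
    rw [smul_comm]
  K_F := by
    ext a
    simp only [Module.End.mul_apply, AlgHom.toLinearMap_apply, opF_apply, LinearMap.smul_apply,
      map_smul, map_sub, map_mul, W.k_D, smul_mul_assoc, mul_smul_comm, ← smul_sub, W.k_kinv,
      W.kinv_k]
    rw [smul_comm]
  E_F := by
    rw [k_pow_pred]
    ext a
    have hκ := qRoot_sub_inv_ne_zero p
    have hD : W.D * W.z = _ := W.D_mul_z
    simp only [Module.End.mul_apply, AlgHom.toLinearMap_apply, opF_apply, opE_apply,
      LinearMap.smul_apply, LinearMap.sub_apply,
      map_smul, map_sub, map_mul, W.k_D, W.kinv_z, smul_mul_assoc, mul_smul_comm, W.k_kinv,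
      W.kinv_k, ← smul_sub]
    congr 1
    rw [show W.D * (W.z * W.k a) = W.D * W.z * W.k a by rw [mul_assoc],
      show W.kinv a * W.D * W.z = W.kinv a * (W.D * W.z) by rw [mul_assoc], hD]
    simp only [mul_add, add_mul, ← Algebra.commutes, ← Algebra.smul_def, smul_mul_assoc,
      mul_smul_comm, mul_assoc]
    -- Once ∂z is expanded, the mixed monomials pair off; what remains is κ(k(a) − k⁻¹(a)), and κ
    -- cancels one of the two prefactors κ⁻¹.
    rw [show ∀ x y u v s t : A, x - v - (u + s - t) - (x - s - (y + v - t)) = y - u by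
      intros; abel, ← smul_sub, smul_smul, inv_mul_cancel₀ hκ, one_smul]
  E_pow := by
    rw [opE, smul_pow, sub_mul_pow_eq_zero_of_qcomm (UqSl2.p_ne_zero p)
      (qRoot_sq_isPrimitiveRoot p (UqSl2.p_ne_zero p)), smul_zero]
    · ext a
      simp [W.k_z, mul_assoc]
    · ext a
      simp [W.k_z]
    · rw [LinearMap.pow_mulRight, W.z_pow, LinearMap.mulRight_zero_eq_zero]
    · rw [LinearMap.pow_mulLeft, W.z_pow, LinearMap.mulLeft_zero_eq_zero]
  F_pow := by
    rw [opF, smul_pow, sub_mul_pow_eq_zero_of_qcomm (UqSl2.p_ne_zero p)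
      (qRoot_sq_isPrimitiveRoot p (UqSl2.p_ne_zero p)), smul_zero]
    · ext a
      simp [W.kinv_D, mul_assoc]
    · ext a
      simp [W.kinv_D]
    · rw [LinearMap.pow_mulLeft, W.D_pow, LinearMap.mulLeft_zero_eq_zero]
    · rw [LinearMap.pow_mulRight, W.D_pow, LinearMap.mulRight_zero_eq_zero]
  K_pow := W.k_pow_two_mul

/-- The representation of `U` on `A`. -/
def rep : UqSl2 p →ₐ[ℂ] Module.End ℂ A := UqSl2.lift W.sat

/-- `A` as a `U`-module. -/
abbrev module : Module (UqSl2 p) A := Module.compHom A W.rep.toRingHom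

theorem isScalarTower : letI := W.module; IsScalarTower ℂ (UqSl2 p) A :=
  letI := W.module
  ⟨fun c u a => by
    change W.rep (c • u) a = c • W.rep u a
    rw [map_smul]; rfl⟩

theorem E_smul (a : A) : letI := W.module
    UqSl2.E p • a = (qRoot p - (qRoot p)⁻¹)⁻¹ • (a * W.z - W.z * W.k a) := by
  change W.rep (UqSl2.E p) a = _
  rw [rep, UqSl2.lift_E, opE_apply]

theorem K_smul (a : A) : letI := W.module
    UqSl2.K p • a = W.k a := by
  change W.rep (UqSl2.K p) a = _
  rw [rep, UqSl2.lift_K]; rfl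

theorem F_smul (a : A) : letI := W.module
    UqSl2.F p • a = (qRoot p - (qRoot p)⁻¹)⁻¹ • (W.D * a - W.kinv a * W.D) := by
  change W.rep (UqSl2.F p) a = _
  rw [rep, UqSl2.lift_F, opF_apply]

/-- An algebra homomorphism that respects `z`, `∂` and `k` is `U`-linear. -/
theorem map_smul_of_intertwines {B : Type*} [Ring B] [Algebra ℂ B] (V : QWeylData p B)
    (φ : A →ₐ[ℂ] B) (hz : φ W.z = V.z) (hD : φ W.D = V.D) (hk : ∀ a, φ (W.k a) = V.k (φ a))
    (u : UqSl2 p) (a : A) : letI := W.module; letI := V.module; φ (u • a) = u • φ a := by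
  change φ (W.rep u a) = V.rep u (φ a)
  have hkinv : ∀ a, φ (W.kinv a) = V.kinv (φ a) := fun a => by
    rw [← V.kinv_k (φ (W.kinv a)), ← hk, W.k_kinv]
  induction u using UqSl2.induction_gen generalizing a with
  | hc c => simp [Algebra.algebraMap_eq_smul_one]
  | hE => simp [rep, opE_apply, hz, hk]
  | hK => simp [rep, hk]
  | hF => simp [rep, opF_apply, hD, hkinv]
  | hadd u v hu hv => simp [hu, hv]
  | hmul u v hu hv => simp [hu, hv]

/-- The representation of `U ⊗ U` on `A ⊗ A`. -/
def repTensor : UqSl2 p ⊗[ℂ] UqSl2 p →ₐ[ℂ] Module.End ℂ (A ⊗[ℂ] A) :=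
  (Module.endTensorEndAlgHom (R := ℂ) (A := ℂ)).comp (Algebra.TensorProduct.map W.rep W.rep)

theorem repTensor_tmul (u v : UqSl2 p) (a b : A) :
    W.repTensor (u ⊗ₜ v) (a ⊗ₜ b) = W.rep u a ⊗ₜ W.rep v b := rfl

/-- For E one adds and subtracts a z k(b): abz − z k(a)k(b) = (az − z k(a))k(b) + a(bz − z k(b));
for F similarly with k⁻¹(a)∂b. Phrasing the rule as an equality of linear maps on `A ⊗ A` makes it
pass to products in U by composition. -/
theorem rep_mul' (h : UqSl2 p) : W.rep h ∘ₗ LinearMap.mul' ℂ A =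
    LinearMap.mul' ℂ A ∘ₗ W.repTensor (UqSl2.comulHom p h) := by
  have hKinv : ∀ a, W.rep (UqSl2.Kinv p) a = W.kinv a := fun a => by
    rw [UqSl2.Kinv, map_pow, rep, UqSl2.lift_K, k_pow_pred]; rfl
  induction h using UqSl2.induction_gen with
  | hc c => ext a b; simp [Algebra.algebraMap_eq_smul_one]
  | hE =>
    ext a b
    simp only [UqSl2.comulHom_E, map_add, TensorProduct.AlgebraTensorModule.curry_apply,
      LinearMap.restrictScalars_self, TensorProduct.curry_apply, LinearMap.comp_apply,
      LinearMap.add_apply, repTensor_tmul, LinearMap.mul'_apply, map_one, Module.End.one_apply]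
    simp only [rep, UqSl2.lift_E, UqSl2.lift_K, opE_apply, AlgHom.toLinearMap_apply, map_mul,
      smul_mul_assoc, mul_smul_comm, ← smul_add, sub_mul, mul_sub, mul_assoc]
    congr 1
    abel
  | hK =>
    ext a b
    simp only [UqSl2.comulHom_K, TensorProduct.AlgebraTensorModule.curry_apply,
      LinearMap.restrictScalars_self, TensorProduct.curry_apply, LinearMap.comp_apply,
      repTensor_tmul, LinearMap.mul'_apply]
    simp only [rep, UqSl2.lift_K, AlgHom.toLinearMap_apply, map_mul]
  | hF =>
    ext a b
    simp only [UqSl2.comulHom_F, map_add, TensorProduct.AlgebraTensorModule.curry_apply,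
      LinearMap.restrictScalars_self, TensorProduct.curry_apply, LinearMap.comp_apply,
      LinearMap.add_apply, repTensor_tmul, LinearMap.mul'_apply, map_one, Module.End.one_apply,
      hKinv]
    simp only [rep, UqSl2.lift_F, opF_apply, map_mul,
      smul_mul_assoc, mul_smul_comm, ← smul_add, sub_mul, mul_sub, mul_assoc]
    congr 1
    abel
  | hadd u v hu hv => rw [map_add, map_add, map_add, LinearMap.add_comp, hu, hv, LinearMap.comp_add]
  | hmul u v hu hv =>
    rw [map_mul, Module.End.mul_eq_comp, LinearMap.comp_assoc, hv, ← LinearMap.comp_assoc, hu,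
      map_mul, map_mul, LinearMap.comp_assoc, Module.End.mul_eq_comp]

theorem isModuleAlgebra : letI := W.module; letI := W.isScalarTower
    IsModuleAlgebra (UqSl2 p) A := by
  let := W.module
  let := W.isScalarTower
  refine ⟨fun h => ?_, fun h => ?_⟩
  · change W.rep h 1 = algebraMap ℂ A (UqSl2.counitHom p h)
    induction h using UqSl2.induction_gen with
    | hc c => simp [Algebra.algebraMap_eq_smul_one]
    | hE => simp [rep, opE_apply]
    | hK => simp [rep]
    | hF => simp [rep, opF_apply]
    | hadd u v hu hv => simp [hu, hv]
    | hmul u v hu hv =>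
      rw [map_mul, Module.End.mul_apply, hv, Algebra.algebraMap_eq_smul_one, map_smul, hu,
        Algebra.algebraMap_eq_smul_one, smul_smul, map_mul, Algebra.algebraMap_eq_smul_one,
        mul_comm]
  · intro v w
    have := LinearMap.congr_fun (W.rep_mul' h) (v ⊗ₜ w)
    change W.rep h (v * w) = _
    rw [LinearMap.comp_apply, LinearMap.mul'_apply] at this
    rw [this, LinearMap.comp_apply]
    congr 1
    change W.repTensor (UqSl2.comulHom p h) (v ⊗ₜ w) =
      TensorProduct.map _ _ (UqSl2.comulHom p h)
    induction UqSl2.comulHom p h using TensorProduct.induction_on with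
    | zero => simp
    | add s t hs ht => rw [map_add, map_add, LinearMap.add_apply, hs, ht]
    | tmul a b => rfl

end QWeylData

/-! ### The action on the monomials z^a∂^b and on t. -/

namespace QWeylData

set_option linter.unusedSectionVars false

variable {p : ℕ} [hp2 : Fact (2 ≤ p)] {A : Type*} [Ring A] [Algebra ℂ A] (W : QWeylData p A)

/-- Each further z contributes a factor q⁻² to the moved term and a new κ, so the lower term
collects κ(1 + q⁻² + … + q^{−2(m−1)}). -/
theorem D_mul_z_pow (m : ℕ) : W.D * W.z ^ m = (qRoot p ^ (-2 * (m : ℤ))) • (W.z ^ m * W.D) +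
    ((qRoot p - (qRoot p)⁻¹) * (qRoot p ^ (1 - (m : ℤ)) * qInt p m)) • W.z ^ (m - 1) := by
  induction m with
  | zero => simp [XPlus.qInt_zero]
  | succ m ih =>
    -- The truncated exponent m − 1 at m = 0 is harmless because [0] = 0.
    have hm : (qRoot p ^ (1 - (m : ℤ)) * qInt p m) • (W.z * W.z ^ (m - 1)) =
        (qRoot p ^ (1 - (m : ℤ)) * qInt p m) • W.z ^ m := by
      cases m with
      | zero => simp [XPlus.qInt_zero]
      | succ m => rw [Nat.add_sub_cancel, pow_succ']
    have h2 : qRoot p ^ (-2 * ((m + 1 : ℕ) : ℤ)) =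
        qRoot p ^ (-2 : ℤ) * qRoot p ^ (-2 * (m : ℤ)) := by
      rw [← zpow_add₀ (qRoot_ne_zero p)]; congr 1; push_cast; ring
    have h3 := qRoot_zpow_mul_qInt_succ p m
    rw [pow_succ', ← mul_assoc, W.D_mul_z, add_mul, ← Algebra.smul_def, smul_mul_assoc, mul_assoc,
      ih, mul_add, mul_smul_comm, mul_smul_comm, mul_smul, hm, h2, Nat.add_sub_cancel, mul_assoc]
    push_cast
    rw [h3]
    module

theorem D_pow_mul_z (n : ℕ) : W.D ^ n * W.z = (qRoot p ^ (-2 * (n : ℤ))) • (W.z * W.D ^ n) +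
    ((qRoot p - (qRoot p)⁻¹) * (qRoot p ^ (1 - (n : ℤ)) * qInt p n)) • W.D ^ (n - 1) := by
  induction n with
  | zero => simp [XPlus.qInt_zero]
  | succ m ih =>
    have hm : (qRoot p ^ (1 - (m : ℤ)) * qInt p m) • (W.D ^ (m - 1) * W.D) =
        (qRoot p ^ (1 - (m : ℤ)) * qInt p m) • W.D ^ m := by
      cases m with
      | zero => simp [XPlus.qInt_zero]
      | succ m => rw [Nat.add_sub_cancel, pow_succ]
    have h2 : qRoot p ^ (-2 * ((m + 1 : ℕ) : ℤ)) =
        qRoot p ^ (-2 : ℤ) * qRoot p ^ (-2 * (m : ℤ)) := by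
      rw [← zpow_add₀ (qRoot_ne_zero p)]; congr 1; push_cast; ring
    have h3 := qRoot_zpow_mul_qInt_succ p m
    rw [pow_succ, mul_assoc, W.D_mul_z, mul_add, ← Algebra.commutes, ← Algebra.smul_def,
      mul_smul_comm, ← mul_assoc,
      ih, add_mul, smul_mul_assoc, smul_mul_assoc, mul_smul, hm, h2, Nat.add_sub_cancel, mul_assoc]
    push_cast
    rw [h3]
    module

theorem k_z_pow (m : ℕ) : W.k (W.z ^ m) = (qRoot p ^ (2 * (m : ℤ))) • W.z ^ m := by
  rw [map_pow, W.k_z, smul_pow, ← zpow_natCast, ← zpow_mul]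

theorem k_D_pow (n : ℕ) : W.k (W.D ^ n) = (qRoot p ^ (-2 * (n : ℤ))) • W.D ^ n := by
  rw [map_pow, W.k_D, smul_pow, ← zpow_natCast, ← zpow_mul]

theorem kinv_z_pow (m : ℕ) : W.kinv (W.z ^ m) = (qRoot p ^ (-2 * (m : ℤ))) • W.z ^ m := by
  rw [map_pow, W.kinv_z, smul_pow, ← zpow_natCast, ← zpow_mul]

theorem kinv_D_pow (n : ℕ) : W.kinv (W.D ^ n) = (qRoot p ^ (2 * (n : ℤ))) • W.D ^ n := by
  rw [map_pow, W.kinv_D, smul_pow, ← zpow_natCast, ← zpow_mul]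

theorem opE_z_pow (m : ℕ) : W.opE (W.z ^ m) = (-(qRoot p ^ m * qInt p m)) • W.z ^ (m + 1) := by
  rw [opE_apply, k_z_pow, mul_smul_comm, ← pow_succ, ← pow_succ', ← zpow_natCast,
    ← one_sub_qRoot_zpow]
  module

theorem opE_D_pow (n : ℕ) :
    W.opE (W.D ^ n) = (qRoot p ^ (1 - (n : ℤ)) * qInt p n) • W.D ^ (n - 1) := by
  rw [opE_apply, k_D_pow, mul_smul_comm, D_pow_mul_z, add_sub_cancel_left, smul_smul,
    inv_mul_cancel_left₀ (qRoot_sub_inv_ne_zero p)]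

theorem opF_z_pow (m : ℕ) :
    W.opF (W.z ^ m) = (qInt p m * qRoot p ^ (1 - (m : ℤ))) • W.z ^ (m - 1) := by
  rw [opF_apply, kinv_z_pow, smul_mul_assoc, D_mul_z_pow, add_sub_cancel_left, smul_smul,
    inv_mul_cancel_left₀ (qRoot_sub_inv_ne_zero p), mul_comm]

theorem opF_D_pow (n : ℕ) : W.opF (W.D ^ n) = (-(qRoot p ^ n * qInt p n)) • W.D ^ (n + 1) := by
  rw [opF_apply, kinv_D_pow, smul_mul_assoc, ← pow_succ, ← pow_succ', ← zpow_natCast (qRoot p),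
    ← one_sub_qRoot_zpow]
  module

theorem opE_mul (a b : A) : W.opE (a * b) = W.opE a * W.k b + a * W.opE b := by
  simp only [opE_apply, map_mul, smul_mul_assoc, mul_smul_comm, ← smul_add, sub_mul, mul_sub,
    mul_assoc]
  congr 1
  abel

theorem opF_mul (a b : A) : W.opF (a * b) = W.opF a * b + W.kinv a * W.opF b := by
  simp only [opF_apply, map_mul, smul_mul_assoc, mul_smul_comm, ← smul_add, sub_mul, mul_sub,
    mul_assoc]
  congr 1
  abel

theorem opE_monomial (a b : ℕ) : W.opE (W.z ^ a * W.D ^ b) =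
    (-(qRoot p ^ a * qInt p a) * qRoot p ^ (-2 * (b : ℤ))) • (W.z ^ (a + 1) * W.D ^ b) +
      (qRoot p ^ (1 - (b : ℤ)) * qInt p b) • (W.z ^ a * W.D ^ (b - 1)) := by
  rw [opE_mul, opE_z_pow, opE_D_pow, k_D_pow, smul_mul_smul_comm, mul_smul_comm]

theorem opF_monomial (a b : ℕ) : W.opF (W.z ^ a * W.D ^ b) =
    (qInt p a * qRoot p ^ (1 - (a : ℤ))) • (W.z ^ (a - 1) * W.D ^ b) +
      (qRoot p ^ (-2 * (a : ℤ)) * -(qRoot p ^ b * qInt p b)) • (W.z ^ a * W.D ^ (b + 1)) := by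
  rw [opF_mul, opF_z_pow, opF_D_pow, kinv_z_pow, smul_mul_smul_comm, smul_mul_assoc]

theorem k_monomial (a b : ℕ) : W.k (W.z ^ a * W.D ^ b) =
    (qRoot p ^ (2 * ((a : ℤ) - b))) • (W.z ^ a * W.D ^ b) := by
  rw [map_mul, k_z_pow, k_D_pow, smul_mul_smul_comm, ← zpow_add₀ (qRoot_ne_zero p)]
  congr 2
  ring

/-- `t = ∑ z^i ∂^i / [i]`. -/
def t : A := ∑ i ∈ Finset.Icc 1 (p - 1), (qInt p i)⁻¹ • (W.z ^ i * W.D ^ i)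

theorem t_eq_sum_range :
    W.t = ∑ i ∈ Finset.range (p - 1), (qInt p (i + 1))⁻¹ • (W.z ^ (i + 1) * W.D ^ (i + 1)) := by
  rw [t, ← Finset.Ico_add_one_right_eq_Icc, Finset.sum_Ico_eq_sum_range, Nat.add_sub_cancel]
  refine Finset.sum_congr rfl fun i _ => ?_
  rw [add_comm 1 i, Nat.cast_add_one]

theorem k_t : W.k W.t = W.t := by
  rw [t, map_sum]
  refine Finset.sum_congr rfl fun i _ => ?_
  rw [map_smul, k_monomial]
  simp

/-- The weights 1/[i] make the sum telescope: E(z^i∂^i/[i]) = q^{1−i}z^i∂^{i−1} − q^{−i}z^{i+1}∂^i.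
The first term at i = 1 is z and the last one contains z^p = 0. -/
theorem opE_t : W.opE W.t = W.z := by
  have h : ∀ i ∈ Finset.range (p - 1),
      W.opE ((qInt p (i + 1))⁻¹ • (W.z ^ (i + 1) * W.D ^ (i + 1))) =
      (qRoot p ^ (-(i : ℤ))) • (W.z ^ (i + 1) * W.D ^ i) -
        (qRoot p ^ (-((i + 1 : ℕ) : ℤ))) • (W.z ^ (i + 1 + 1) * W.D ^ (i + 1)) := by
    intro i hi
    have hi := Finset.mem_range.mp hi
    have h0 : qInt p (i + 1) ≠ 0 := qInt_ne_zero p (by omega) (by omega)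
    rw [map_smul, opE_monomial, Nat.add_sub_cancel, smul_add, smul_smul, smul_smul,
      sub_eq_neg_add (_ • _), ← neg_smul, ← zpow_natCast (qRoot p)]
    push_cast
    congr 2
    · rw [show -((i : ℤ) + 1) = i + 1 + -2 * (i + 1) by ring,
        zpow_add₀ (qRoot_ne_zero p) ((i : ℤ) + 1)]
      field_simp
    · rw [show 1 - ((i : ℤ) + 1) = -i by ring]
      field_simp
  rw [t_eq_sum_range, map_sum, Finset.sum_congr rfl h, Finset.sum_range_sub']
  have hp : p - 1 + 1 = p := by have := hp2.out; omega
  simp [hp, W.z_pow]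

/-- The same weights make this sum telescope too; the surviving boundary term contains ∂^p = 0. -/
theorem opF_t : W.opF W.t = W.D := by
  have h : ∀ i ∈ Finset.range (p - 1),
      W.opF ((qInt p (i + 1))⁻¹ • (W.z ^ (i + 1) * W.D ^ (i + 1))) =
      (qRoot p ^ (-(i : ℤ))) • (W.z ^ i * W.D ^ (i + 1)) -
        (qRoot p ^ (-((i + 1 : ℕ) : ℤ))) • (W.z ^ (i + 1) * W.D ^ (i + 1 + 1)) := by
    intro i hi
    have hi := Finset.mem_range.mp hi
    have h0 : qInt p (i + 1) ≠ 0 := qInt_ne_zero p (by omega) (by omega)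
    rw [map_smul, opF_monomial, Nat.add_sub_cancel, smul_add, smul_smul, smul_smul,
      sub_eq_add_neg (_ • _), ← neg_smul, ← zpow_natCast (qRoot p)]
    push_cast
    congr 2
    · rw [show 1 - ((i : ℤ) + 1) = -i by ring]
      field_simp
    · rw [show -((i : ℤ) + 1) = i + 1 + -2 * (i + 1) by ring,
        zpow_add₀ (qRoot_ne_zero p) ((i : ℤ) + 1)]
      field_simp
  rw [t_eq_sum_range, map_sum, Finset.sum_congr rfl h, Finset.sum_range_sub']
  have hp : p - 1 + 1 = p := by have := hp2.out; omega
  simp [hp, W.D_pow]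

end QWeylData

/-! ### The Weyl data of matrices -/

section Matrices

set_option linter.unusedSectionVars false

variable (p : ℕ) [hp2 : Fact (2 ≤ p)]

/-- Conjugation by the diagonal matrix with entries `c^i`. -/
def matConj (c : ℂ) (hc : c ≠ 0) : Matrix (Fin p) (Fin p) ℂ →ₐ[ℂ] Matrix (Fin p) (Fin p) ℂ :=
  AlgHom.ofLinearMap
    { toFun := fun X => Matrix.of fun i j => c ^ ((i : ℤ) - j) * X i j
      map_add' := fun X Y => by ext; simp [mul_add]
      map_smul' := fun a X => by ext; simp [mul_left_comm] }
    (by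
      ext i j
      by_cases h : i = j
      · simp [h, Matrix.one_apply]
      · simp [h, Matrix.one_apply])
    (fun X Y => by
      ext i j
      simp only [LinearMap.coe_mk, AddHom.coe_mk, Matrix.mul_apply, Finset.mul_sum,
        Matrix.of_apply]
      refine Finset.sum_congr rfl fun l _ => ?_
      rw [show (i : ℤ) - j = (i - l) + (l - j) by ring, zpow_add₀ hc]
      ring)

theorem matConj_apply (c : ℂ) (hc : c ≠ 0) (X : Matrix (Fin p) (Fin p) ℂ) (i j : Fin p) :
    matConj p c hc X i j = c ^ ((i : ℤ) - j) * X i j := rfl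

theorem matZ_mul_apply (X : Matrix (Fin p) (Fin p) ℂ) (i j : Fin p) :
    (matZ p * X) i j = if 0 < (i : ℕ) then X ⟨(i : ℕ) - 1, by omega⟩ j else 0 := by
  simp only [Matrix.mul_apply, matZ, ite_mul, one_mul, zero_mul]
  split_ifs with h
  · rw [Finset.sum_eq_single ⟨(i : ℕ) - 1, by omega⟩]
    · rw [if_pos (by simp only; omega)]
    · intro b _ hb
      rw [if_neg]
      intro h'
      exact hb (Fin.ext (by simp only; omega))
    · simp
  · exact Finset.sum_eq_zero fun b _ => if_neg (by omega)

theorem mul_matZ_apply (X : Matrix (Fin p) (Fin p) ℂ) (i j : Fin p) :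
    (X * matZ p) i j = if h : (j : ℕ) + 1 < p then X i ⟨j + 1, h⟩ else 0 := by
  simp only [Matrix.mul_apply, matZ, mul_ite, mul_one, mul_zero]
  split_ifs with h
  · rw [Finset.sum_eq_single ⟨(j : ℕ) + 1, h⟩]
    · rw [if_pos rfl]
    · intro b _ hb
      rw [if_neg]
      intro h'
      exact hb (Fin.ext h')
    · simp
  · exact Finset.sum_eq_zero fun b _ => if_neg (by omega)

/-- The entry of the matrix of `∂` in the `i`-th row. -/
def matDCoeff (i : ℤ) : ℂ := (qRoot p - (qRoot p)⁻¹) * (qRoot p ^ (1 - (i + 1)) * qInt p (i + 1))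

theorem matD_apply (i j : Fin p) : matD p i j = if (j : ℕ) = i + 1 then matDCoeff p i else 0 := rfl

theorem matD_mul_apply (X : Matrix (Fin p) (Fin p) ℂ) (i j : Fin p) :
    (matD p * X) i j = matDCoeff p i * if h : (i : ℕ) + 1 < p then X ⟨i + 1, h⟩ j else 0 := by
  simp only [Matrix.mul_apply, matD, ite_mul, zero_mul]
  split_ifs with h
  · rw [Finset.sum_eq_single ⟨(i : ℕ) + 1, h⟩]
    · rw [if_pos rfl, matDCoeff]
    · intro b _ hb
      rw [if_neg]
      intro h'
      exact hb (Fin.ext h')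
    · simp
  · rw [mul_zero]
    exact Finset.sum_eq_zero fun b _ => if_neg (by omega)

theorem mul_matD_apply (X : Matrix (Fin p) (Fin p) ℂ) (i j : Fin p) :
    (X * matD p) i j =
      matDCoeff p (j - 1) * if 0 < (j : ℕ) then X i ⟨(j : ℕ) - 1, by omega⟩ else 0 := by
  simp only [Matrix.mul_apply, matD, mul_ite, mul_zero]
  split_ifs with h
  · rw [Finset.sum_eq_single ⟨(j : ℕ) - 1, by omega⟩]
    · rw [if_pos (by simp only; omega), matDCoeff, mul_comm]
      simp only [Nat.cast_sub (show 1 ≤ (j : ℕ) by omega), Nat.cast_one]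
    · intro b _ hb
      rw [if_neg]
      intro h'
      exact hb (Fin.ext (by simp only; omega))
    · simp
  · exact Finset.sum_eq_zero fun b _ => if_neg (by omega)

theorem matDCoeff_eq (i : ℤ) : matDCoeff p i = qRoot p - (qRoot p)⁻¹ +
    qRoot p ^ (-2 : ℤ) * matDCoeff p (i - 1) := by
  rw [matDCoeff, qRoot_zpow_mul_qInt_succ, matDCoeff, sub_add_cancel]
  ring

theorem matDCoeff_neg_one : matDCoeff p (-1) = 0 := by
  rw [matDCoeff, neg_add_cancel, XPlus.qInt_zero, mul_zero, mul_zero]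

/-- Together with the vanishing at −1, this lets the recursion for the entries stand for ∂z = κ +
q⁻²z∂ in the first and last rows as well, where one of the two products has no entry. It is here
that [p] = 0 is needed. -/
theorem matDCoeff_pred : matDCoeff p (p - 1) = 0 := by
  rw [matDCoeff, sub_add_cancel, qInt_p, mul_zero, mul_zero]

theorem matDCoeff_ne_zero {i : ℤ} (h0 : 0 ≤ i) (h1 : i + 1 < p) : matDCoeff p i ≠ 0 :=
  mul_ne_zero (qRoot_sub_inv_ne_zero p)
    (mul_ne_zero (zpow_ne_zero _ (qRoot_ne_zero p)) (qInt_ne_zero p (by omega) h1))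

theorem matZ_pow_mul_apply (k : ℕ) (X : Matrix (Fin p) (Fin p) ℂ) (i j : Fin p) :
    (matZ p ^ k * X) i j = if k ≤ (i : ℕ) then X ⟨(i : ℕ) - k, by omega⟩ j else 0 := by
  induction k generalizing i with
  | zero => simp
  | succ k ih =>
    rw [pow_succ', mul_assoc, matZ_mul_apply]
    by_cases h : 0 < (i : ℕ)
    · rw [if_pos h, ih]
      by_cases h2 : k + 1 ≤ i
      · rw [if_pos h2, if_pos (by simp only; omega)]
        congr 2
        simp only
        omega
      · rw [if_neg h2, if_neg (by simp only; omega)]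
    · rw [if_neg h, if_neg (by omega)]

theorem matD_pow_apply_of_ne (k : ℕ) (i j : Fin p) (h : (j : ℕ) ≠ i + k) :
    (matD p ^ k) i j = 0 := by
  induction k generalizing j with
  | zero => exact Matrix.one_apply_ne fun hij => h (by rw [hij]; rfl)
  | succ k ih =>
    rw [pow_succ, mul_matD_apply]
    split_ifs with h0
    · rw [ih _ (by simp only; omega), mul_zero]
    · rw [mul_zero]

theorem matD_pow_apply_ne_zero (k : ℕ) (i j : Fin p) (h : (j : ℕ) = i + k) :
    (matD p ^ k) i j ≠ 0 := by
  induction k generalizing j with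
  | zero =>
    obtain rfl : i = j := Fin.ext h.symm
    simp
  | succ k ih =>
    rw [pow_succ, mul_matD_apply, if_pos (by omega)]
    exact mul_ne_zero (matDCoeff_ne_zero p (by omega) (by omega)) (ih _ (by simp only; omega))

/-- Matrices with `z`, `∂` and the conjugation `k`. -/
def matWeylData : QWeylData p (Matrix (Fin p) (Fin p) ℂ) where
  z := matZ p
  D := matD p
  k := matConj p (qRoot p ^ (2 : ℤ)) (zpow_ne_zero _ (qRoot_ne_zero p))
  kinv := matConj p (qRoot p ^ (-2 : ℤ)) (zpow_ne_zero _ (qRoot_ne_zero p))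
  D_mul_z := by
    ext i j
    rw [mul_matZ_apply, Matrix.add_apply, Matrix.smul_apply, mul_matD_apply,
      Algebra.algebraMap_eq_smul_one, Matrix.smul_apply, Matrix.one_apply]
    simp only [matD_apply, matZ]
    -- Both ∂z and z∂ are diagonal: on the diagonal the relation is `matDCoeff_eq`, off it both
    -- sides vanish.
    by_cases hij : i = j
    · subst hij
      have h1 : (if (i : ℕ) + 1 < p then matDCoeff p i else 0) = matDCoeff p i := by
        split_ifs with h
        · rfl
        · rw [show (i : ℤ) = p - 1 by omega, matDCoeff_pred]
      have h2 : (if 0 < (i : ℕ) then matDCoeff p (i - 1) else 0) = matDCoeff p (i - 1) := by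
        split_ifs with h
        · rfl
        · rw [show (i : ℤ) - 1 = -1 by omega, matDCoeff_neg_one]
      simp only [if_true, dite_eq_ite, h1]
      rw [matDCoeff_eq p i, ← h2]
      simp only [smul_eq_mul, mul_one]
      congr 2
      split_ifs with h3 h4
      · rw [mul_one]
      · omega
      · rw [mul_zero]
    · have hij' : (i : ℕ) ≠ j := fun h => hij (Fin.ext h)
      rw [if_neg hij, smul_zero, zero_add]
      have h1 : (if _ : (j : ℕ) + 1 < p then
          if (j : ℕ) + 1 = i + 1 then matDCoeff p i else 0 else 0) = 0 := by
        split_ifs <;> first | rfl | omega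
      have h2 : (if 0 < (j : ℕ) then
          if (i : ℕ) = j - 1 + 1 then (1 : ℂ) else 0 else 0) = 0 := by
        split_ifs <;> first | rfl | omega
      rw [h1, h2, mul_zero, smul_zero]
  z_pow := by
    ext i j
    rw [← mul_one (matZ p ^ p), matZ_pow_mul_apply, if_neg (by omega)]
    rfl
  D_pow := by
    ext i j
    exact matD_pow_apply_of_ne p p i j (by omega)
  k_z := by
    ext i j
    simp only [matConj_apply, matZ, Matrix.smul_apply, smul_eq_mul, mul_ite, mul_one, mul_zero]
    split_ifs with h
    · rw [h]; simp
    · rfl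
  k_D := by
    ext i j
    simp only [matConj_apply, matD, Matrix.smul_apply, smul_eq_mul, mul_ite, mul_zero]
    split_ifs with h
    · rw [h]; simp
    · rfl
  k_kinv X := by
    ext i j
    rw [matConj_apply, matConj_apply, ← mul_assoc, ← mul_zpow, UqSl2.q_two_mul_neg_two, one_zpow,
      one_mul]
  kinv_k X := by
    ext i j
    rw [matConj_apply, matConj_apply, ← mul_assoc, ← mul_zpow, UqSl2.q_neg_two_mul_two, one_zpow,
      one_mul]
  k_pow := by
    have h : ∀ (n : ℕ) (X : Matrix (Fin p) (Fin p) ℂ) (i j : Fin p),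
        ((matConj p (qRoot p ^ (2 : ℤ)) (zpow_ne_zero _ (qRoot_ne_zero p))).toLinearMap ^ n) X i j =
        ((qRoot p ^ (2 : ℤ)) ^ n) ^ ((i : ℤ) - j) * X i j := by
      intro n X i j
      induction n with
      | zero => simp
      | succ n ih =>
        rw [pow_succ', Module.End.mul_apply, AlgHom.toLinearMap_apply, matConj_apply, ih,
          ← mul_assoc, ← mul_zpow, ← pow_succ']
    ext X i j
    rw [h, (qRoot_sq_isPrimitiveRoot p (UqSl2.p_ne_zero p)).pow_eq_one]
    simp

theorem matWeylData_k (X : Matrix (Fin p) (Fin p) ℂ) : (matWeylData p).k X = matK p X := by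
  ext i j
  change (qRoot p ^ (2 : ℤ)) ^ ((i : ℤ) - j) * X i j = qRoot p ^ (2 * ((i : ℤ) - j)) * X i j
  rw [zpow_mul]

theorem matWeylData_opE (X : Matrix (Fin p) (Fin p) ℂ) : (matWeylData p).opE X = matE p X := by
  ext i j
  change (qRoot p - (qRoot p)⁻¹)⁻¹ * ((X * matZ p) i j -
    (matZ p * matConj p (qRoot p ^ (2 : ℤ)) (zpow_ne_zero _ (qRoot_ne_zero p)) X) i j) = _
  rw [mul_matZ_apply, matZ_mul_apply, matE, matConj_apply, mul_ite, mul_zero, ← zpow_mul]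
  congr 2
  split_ifs with h
  · congr 2
    push_cast [Nat.cast_sub (show 1 ≤ (i : ℕ) by omega)]
    ring
  · rfl

theorem matWeylData_opF (X : Matrix (Fin p) (Fin p) ℂ) : (matWeylData p).opF X = matF p X := by
  ext i j
  change (qRoot p - (qRoot p)⁻¹)⁻¹ * ((matD p * X) i j -
    (matConj p (qRoot p ^ (-2 : ℤ)) (zpow_ne_zero _ (qRoot_ne_zero p)) X * matD p) i j) = _
  have hκ := qRoot_sub_inv_ne_zero p
  rw [matD_mul_apply, mul_matD_apply, matF, matConj_apply, ← zpow_mul, mul_sub, matDCoeff,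
    matDCoeff]
  congr 1
  · rw [mul_assoc, inv_mul_cancel_left₀ hκ]
  · split_ifs with h
    · rw [show (((⟨(j : ℕ) - 1, by omega⟩ : Fin p) : ℕ) : ℤ) = (j : ℤ) - 1 by simp only; omega,
        show (j : ℤ) + 1 - 2 * (i + 1) = (1 - ((j : ℤ) - 1 + 1)) + -2 * (i - (j - 1)) by ring,
        zpow_add₀ (qRoot_ne_zero p), sub_add_cancel, add_sub_cancel_right, mul_assoc,
        inv_mul_cancel_left₀ hκ]
      ring
    · simp

/-- The entry of z^{a'}∂^{b'} at (a, b) can be nonzero only if a' ≤ a and b − b' = a − a', hence b'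
≤ b, with equality only for a' = a. So the system for the coefficients is triangular, and induction
on b solves it. -/
theorem linearIndependent_matMonomial : LinearIndependent ℂ
    (fun ab : Fin p × Fin p => matZ p ^ (ab.1 : ℕ) * matD p ^ (ab.2 : ℕ)) := by
  rw [Fintype.linearIndependent_iff]
  intro c hc
  have key : ∀ n (a b : Fin p), (b : ℕ) = n → c (a, b) = 0 := by
    intro n
    induction n using Nat.strong_induction_on with
    | _ n ih =>
      intro a b hb
      have h := congrFun (congrFun hc a) b
      rw [Matrix.sum_apply, Finset.sum_eq_single (a, b)] at h
      · rw [Matrix.smul_apply, matZ_pow_mul_apply, if_pos le_rfl] at h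
        exact (mul_eq_zero.mp h).resolve_right
          (matD_pow_apply_ne_zero p b _ b (by simp only; omega))
      · rintro ⟨a', b'⟩ - hne
        rw [Matrix.smul_apply, matZ_pow_mul_apply]
        split_ifs with h'
        · by_cases hb' : (b' : ℕ) < n
          · rw [ih b' hb' a' b' rfl, zero_smul]
          · rw [matD_pow_apply_of_ne, smul_zero]
            intro h2
            simp only at h' h2
            exact hne (Prod.ext (Fin.ext (by simp only; omega)) (Fin.ext (by simp only; omega)))
        · exact smul_zero _
      · simp
  rintro ⟨a, b⟩
  exact key b a b rfl

end Matrices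

/-! ### The algebra on `z`, `∂` -/

namespace QDiff

set_option linter.unusedSectionVars false

variable (p : ℕ) [hp2 : Fact (2 ≤ p)]

theorem D_mul_z : D p * z p = algebraMap ℂ _ (qRoot p - (qRoot p)⁻¹) +
    (qRoot p ^ (-2 : ℤ)) • (z p * D p) := by
  simpa [z, D] using PresAlg.mk_rel (Rel.D_z (p := p))

theorem z_pow : z p ^ p = 0 := by simpa [z] using PresAlg.mk_rel (Rel.z_pow (p := p))

theorem D_pow : D p ^ p = 0 := by simpa [D] using PresAlg.mk_rel (Rel.D_pow (p := p))

section lift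
variable {p} {A : Type*} [Ring A] [Algebra ℂ A]

/-- Images of the generators. -/
def genFun (x y : A) : Gen → A
  | .z => x
  | .D => y

/-- The homomorphism defined by elements that satisfy the relations of `z`, `∂`. -/
def lift (x y : A) (h : y * x = algebraMap ℂ A (qRoot p - (qRoot p)⁻¹) +
    (qRoot p ^ (-2 : ℤ)) • (x * y)) (hx : x ^ p = 0) (hy : y ^ p = 0) : QDiff p →ₐ[ℂ] A :=
  PresAlg.lift (genFun x y) <| by
    intro a b hab
    cases hab with
    | D_z => simpa [genFun] using h
    | z_pow => simpa [genFun] using hx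
    | D_pow => simpa [genFun] using hy

variable (x y : A) (h : y * x = algebraMap ℂ A (qRoot p - (qRoot p)⁻¹) +
    (qRoot p ^ (-2 : ℤ)) • (x * y)) (hx : x ^ p = 0) (hy : y ^ p = 0)

@[simp] theorem lift_z : lift x y h hx hy (z p) = x := by simp [lift, z, genFun]
@[simp] theorem lift_D : lift x y h hx hy (D p) = y := by simp [lift, D, genFun]

theorem algHom_ext {B : Type*} [Semiring B] [Algebra ℂ B] {φ ψ : QDiff p →ₐ[ℂ] B}
    (hz : φ (z p) = ψ (z p)) (hD : φ (D p) = ψ (D p)) : φ = ψ := by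
  apply PresAlg.algHom_ext
  intro g
  cases g
  · exact hz
  · exact hD

end lift

/-- The endomorphism that scales `z` by `c` and `∂` by `c⁻¹`. -/
def scale (c : ℂˣ) : QDiff p →ₐ[ℂ] QDiff p :=
  lift ((c : ℂ) • z p) ((c⁻¹ : ℂˣ) • D p)
    (by simp only [Units.smul_def, smul_mul_smul_comm, Units.inv_mul, Units.mul_inv, one_smul,
      D_mul_z])
    (by rw [smul_pow, z_pow, smul_zero]) (by rw [smul_pow, D_pow, smul_zero])

@[simp] theorem scale_z (c : ℂˣ) : scale p c (z p) = (c : ℂ) • z p := lift_z ..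
@[simp] theorem scale_D (c : ℂˣ) : scale p c (D p) = ((c⁻¹ : ℂˣ) : ℂ) • D p := lift_D ..

theorem scale_mul (c c' : ℂˣ) : scale p (c * c') = (scale p c).comp (scale p c') :=
  algHom_ext (by simp [mul_smul, smul_comm (c : ℂ)]) (by simp [mul_smul])

theorem scale_one : scale p 1 = AlgHom.id ℂ _ := algHom_ext (by simp) (by simp)

theorem scale_pow (c : ℂˣ) (n : ℕ) : (scale p c).toLinearMap ^ n = (scale p (c ^ n)).toLinearMap := by
  induction n with
  | zero => rw [pow_zero, pow_zero, scale_one]; rfl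
  | succ n ih => rw [pow_succ, ih, pow_succ, scale_mul]; rfl

end QDiff

/-- `q²` as a unit. -/
def qSqUnit (p : ℕ) : ℂˣ := Units.mk0 (qRoot p ^ (2 : ℤ)) (zpow_ne_zero _ (qRoot_ne_zero p))

theorem qSqUnit_val (p : ℕ) : (qSqUnit p : ℂ) = qRoot p ^ (2 : ℤ) := rfl

theorem qSqUnit_inv_val (p : ℕ) : ((qSqUnit p)⁻¹ : ℂˣ) = qRoot p ^ (-2 : ℤ) := by
  rw [Units.val_inv_eq_inv_val, qSqUnit_val, zpow_neg]

theorem qSqUnit_pow (p : ℕ) [Fact (2 ≤ p)] : qSqUnit p ^ p = 1 :=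
  Units.ext (qRoot_sq_isPrimitiveRoot p (UqSl2.p_ne_zero p)).pow_eq_one

/-! ### Monomial basis of the algebra on z, ∂ and its isomorphism with matrices. -/

namespace QDiff

set_option linter.unusedSectionVars false

variable (p : ℕ) [hp2 : Fact (2 ≤ p)]

/-- The algebra on `z`, `∂` with the scaling by `q²`. -/
def weylData : QWeylData p (QDiff p) where
  z := z p
  D := D p
  k := scale p (qSqUnit p)
  kinv := scale p (qSqUnit p)⁻¹
  D_mul_z := D_mul_z p
  z_pow := z_pow p
  D_pow := D_pow p
  k_z := scale_z ..
  k_D := by rw [scale_D, qSqUnit_inv_val]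
  k_kinv a := by rw [← AlgHom.comp_apply, ← scale_mul, mul_inv_cancel, scale_one]; rfl
  kinv_k a := by rw [← AlgHom.comp_apply, ← scale_mul, inv_mul_cancel, scale_one]; rfl
  k_pow := by rw [scale_pow, qSqUnit_pow, scale_one]; rfl

theorem induction_gen {P : QDiff p → Prop} (hc : ∀ c : ℂ, P (algebraMap ℂ _ c))
    (hz : P (z p)) (hD : P (D p))
    (hadd : ∀ a b, P a → P b → P (a + b)) (hmul : ∀ a b, P a → P b → P (a * b))
    (a : QDiff p) : P a := by
  obtain ⟨x, rfl⟩ := PresAlg.mk_surjective (Rel p) a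
  induction x using FreeAlgebra.induction with
  | grade0 c => simpa using hc c
  | grade1 g => cases g <;> assumption
  | mul a b ha hb => simpa using hmul _ _ ha hb
  | add a b ha hb => simpa using hadd _ _ ha hb

theorem monomial_mem (a b : ℕ) : z p ^ a * D p ^ b ∈ Submodule.span ℂ
    (Set.range fun ab : Fin p × Fin p => z p ^ (ab.1 : ℕ) * D p ^ (ab.2 : ℕ)) := by
  by_cases ha : a < p
  · by_cases hb : b < p
    · exact Submodule.subset_span ⟨(⟨a, ha⟩, ⟨b, hb⟩), rfl⟩
    · rw [← Nat.add_sub_of_le (not_lt.mp hb), pow_add, D_pow, zero_mul, mul_zero]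
      exact zero_mem _
  · rw [← Nat.add_sub_of_le (not_lt.mp ha), pow_add, z_pow, zero_mul, zero_mul]
    exact zero_mem _

/-- The span contains 1 and is stable under left multiplication by z and by ∂, the latter after
moving ∂ past z^a. -/
theorem span_monomial : Submodule.span ℂ
    (Set.range fun ab : Fin p × Fin p => z p ^ (ab.1 : ℕ) * D p ^ (ab.2 : ℕ)) = ⊤ := by
  set S := Submodule.span ℂ
    (Set.range fun ab : Fin p × Fin p => z p ^ (ab.1 : ℕ) * D p ^ (ab.2 : ℕ)) with hS
  have key : ∀ x : QDiff p, ∀ y ∈ S, x * y ∈ S := by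
    intro x
    induction x using induction_gen with
    | hc c => intro y hy; rw [← Algebra.smul_def]; exact S.smul_mem c hy
    | hz =>
      intro y hy
      induction hy using Submodule.span_induction with
      | mem y hy =>
        obtain ⟨⟨a, b⟩, rfl⟩ := hy
        rw [← mul_assoc, ← pow_succ']
        exact monomial_mem p _ _
      | zero => rw [mul_zero]; exact zero_mem _
      | add y y' _ _ h h' => rw [mul_add]; exact add_mem h h'
      | smul c y _ h => rw [mul_smul_comm]; exact S.smul_mem c h
    | hD =>
      intro y hy
      induction hy using Submodule.span_induction with
      | mem y hy =>
        obtain ⟨⟨a, b⟩, rfl⟩ := hy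
        have h := (weylData p).D_mul_z_pow a
        change D p * z p ^ (a : ℕ) = _ • (z p ^ (a : ℕ) * D p) + _ • z p ^ ((a : ℕ) - 1) at h
        rw [← mul_assoc, h, add_mul, smul_mul_assoc, smul_mul_assoc, mul_assoc, ← pow_succ']
        exact add_mem (S.smul_mem _ (monomial_mem p _ _)) (S.smul_mem _ (monomial_mem p _ _))
      | zero => rw [mul_zero]; exact zero_mem _
      | add y y' _ _ h h' => rw [mul_add]; exact add_mem h h'
      | smul c y _ h => rw [mul_smul_comm]; exact S.smul_mem c h
    | hadd a b ha hb => intro y hy; rw [add_mul]; exact add_mem (ha y hy) (hb y hy)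
    | hmul a b ha hb => intro y hy; rw [mul_assoc]; exact ha _ (hb y hy)
  have h1 : (1 : QDiff p) ∈ S := by simpa using monomial_mem p 0 0
  exact eq_top_iff.mpr fun x _ => by simpa using key x 1 h1

/-- The homomorphism to matrices. -/
def toMat : QDiff p →ₐ[ℂ] Matrix (Fin p) (Fin p) ℂ :=
  lift (matZ p) (matD p) (matWeylData p).D_mul_z (matWeylData p).z_pow (matWeylData p).D_pow

theorem toMat_z : toMat p (z p) = matZ p := lift_z ..
theorem toMat_D : toMat p (D p) = matD p := lift_D ..

theorem linearIndependent_toMat_monomial : LinearIndependent ℂ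
    ((toMat p).toLinearMap ∘ fun ab : Fin p × Fin p => z p ^ (ab.1 : ℕ) * D p ^ (ab.2 : ℕ)) := by
  have h : ((toMat p).toLinearMap ∘
      fun ab : Fin p × Fin p => z p ^ (ab.1 : ℕ) * D p ^ (ab.2 : ℕ)) =
      fun ab : Fin p × Fin p => matZ p ^ (ab.1 : ℕ) * matD p ^ (ab.2 : ℕ) := by
    funext ab
    simp [toMat_z, toMat_D]
  rw [h]
  exact linearIndependent_matMonomial p

theorem linearIndependent_monomial : LinearIndependent ℂ
    (fun ab : Fin p × Fin p => z p ^ (ab.1 : ℕ) * D p ^ (ab.2 : ℕ)) :=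
  LinearIndependent.of_comp (toMat p).toLinearMap (linearIndependent_toMat_monomial p)

/-- The basis of monomials `z^a ∂^b`. -/
def monomialBasis : Module.Basis (Fin p × Fin p) ℂ (QDiff p) :=
  Module.Basis.mk (linearIndependent_monomial p) (span_monomial p).ge

theorem monomialBasis_apply (ab : Fin p × Fin p) :
    monomialBasis p ab = z p ^ (ab.1 : ℕ) * D p ^ (ab.2 : ℕ) := Module.Basis.mk_apply ..

instance : FiniteDimensional ℂ (QDiff p) := (monomialBasis p).finiteDimensional_of_finite

theorem finrank_eq : Module.finrank ℂ (QDiff p) = p * p := by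
  rw [Module.finrank_eq_card_basis (monomialBasis p), Fintype.card_prod, Fintype.card_fin]

/-- A spanning family has an independent image, so the map is injective; both sides have dimension
p². -/
theorem toMat_bijective : Function.Bijective (toMat p) := by
  have hinj : Function.Injective (toMat p).toLinearMap :=
    LinearMap.injective_of_linearIndependent (span_monomial p) (linearIndependent_toMat_monomial p)
  refine ⟨hinj, ?_⟩
  exact (LinearMap.injective_iff_surjective_of_finrank_eq_finrank (by
    rw [finrank_eq, Module.finrank_matrix]; simp)).mp hinj

/-- The isomorphism of matrices with the algebra on `z`, `∂`. -/
def matEquiv : Matrix (Fin p) (Fin p) ℂ ≃ₐ[ℂ] QDiff p :=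
  (AlgEquiv.ofBijective (toMat p) (toMat_bijective p)).symm

end QDiff

/-! ### The de Rham algebra -/

namespace QDeRham

set_option linter.unusedSectionVars false

/-- The relations of the de Rham algebra for four elements of an algebra. -/
structure Sat (p : ℕ) {A : Type*} [Ring A] [Algebra ℂ A] (x y u v : A) : Prop where
  D_z : y * x = algebraMap ℂ _ (qRoot p - (qRoot p)⁻¹) + (qRoot p ^ (-2 : ℤ)) • (x * y)
  z_pow : x ^ p = 0
  D_pow : y ^ p = 0
  zeta_sq : u ^ 2 = 0
  delta_sq : v ^ 2 = 0
  delta_zeta : v * u = (-qRoot p ^ (-2 : ℤ)) • (u * v)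
  zeta_z : u * x = (qRoot p ^ (-2 : ℤ)) • (x * u)
  delta_D : v * y = (qRoot p ^ (2 : ℤ)) • (y * v)
  zeta_D : u * y = (qRoot p ^ (2 : ℤ)) • (y * u)
  delta_z : v * x = (qRoot p ^ (-2 : ℤ)) • (x * v)

variable (p : ℕ) [hp2 : Fact (2 ≤ p)]

theorem sat_gen : Sat p (z p) (D p) (zeta p) (delta p) where
  D_z := by simpa [z, D] using PresAlg.mk_rel (Rel.D_z (p := p))
  z_pow := by simpa [z] using PresAlg.mk_rel (Rel.z_pow (p := p))
  D_pow := by simpa [D] using PresAlg.mk_rel (Rel.D_pow (p := p))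
  zeta_sq := by simpa [zeta] using PresAlg.mk_rel (Rel.zeta_sq (p := p))
  delta_sq := by simpa [delta] using PresAlg.mk_rel (Rel.delta_sq (p := p))
  delta_zeta := by simpa [zeta, delta] using PresAlg.mk_rel (Rel.delta_zeta (p := p))
  zeta_z := by simpa [zeta, z] using PresAlg.mk_rel (Rel.zeta_z (p := p))
  delta_D := by simpa [delta, D] using PresAlg.mk_rel (Rel.delta_D (p := p))
  zeta_D := by simpa [zeta, D] using PresAlg.mk_rel (Rel.zeta_D (p := p))
  delta_z := by simpa [delta, z] using PresAlg.mk_rel (Rel.delta_z (p := p))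

section lift
variable {p} {A : Type*} [Ring A] [Algebra ℂ A] {x y u v : A}

/-- Images of the generators. -/
def genFun (x y u v : A) : Gen → A
  | .z => x
  | .D => y
  | .zeta => u
  | .delta => v

/-- The homomorphism defined by elements that satisfy the relations. -/
def lift (h : Sat p x y u v) : QDeRham p →ₐ[ℂ] A :=
  PresAlg.lift (genFun x y u v) <| by
    intro a b hab
    cases hab with
    | D_z => simpa [genFun] using h.D_z
    | z_pow => simpa [genFun] using h.z_pow
    | D_pow => simpa [genFun] using h.D_pow
    | zeta_sq => simpa [genFun] using h.zeta_sq
    | delta_sq => simpa [genFun] using h.delta_sq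
    | delta_zeta => simpa [genFun] using h.delta_zeta
    | zeta_z => simpa [genFun] using h.zeta_z
    | delta_D => simpa [genFun] using h.delta_D
    | zeta_D => simpa [genFun] using h.zeta_D
    | delta_z => simpa [genFun] using h.delta_z

variable (h : Sat p x y u v)

@[simp] theorem lift_z : lift h (z p) = x := by simp [lift, z, genFun]
@[simp] theorem lift_D : lift h (D p) = y := by simp [lift, D, genFun]
@[simp] theorem lift_zeta : lift h (zeta p) = u := by simp [lift, zeta, genFun]
@[simp] theorem lift_delta : lift h (delta p) = v := by simp [lift, delta, genFun]

theorem algHom_ext {B : Type*} [Semiring B] [Algebra ℂ B] {φ ψ : QDeRham p →ₐ[ℂ] B}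
    (hz : φ (z p) = ψ (z p)) (hD : φ (D p) = ψ (D p)) (hzeta : φ (zeta p) = ψ (zeta p))
    (hdelta : φ (delta p) = ψ (delta p)) : φ = ψ := by
  apply PresAlg.algHom_ext
  intro g
  cases g
  · exact hz
  · exact hD
  · exact hzeta
  · exact hdelta

end lift

theorem induction_gen {P : QDeRham p → Prop} (hc : ∀ c : ℂ, P (algebraMap ℂ _ c))
    (hz : P (z p)) (hD : P (D p)) (hzeta : P (zeta p)) (hdelta : P (delta p))
    (hadd : ∀ a b, P a → P b → P (a + b)) (hmul : ∀ a b, P a → P b → P (a * b))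
    (a : QDeRham p) : P a := by
  obtain ⟨x, rfl⟩ := PresAlg.mk_surjective (Rel p) a
  induction x using FreeAlgebra.induction with
  | grade0 c => simpa using hc c
  | grade1 g => cases g <;> assumption
  | mul a b ha hb => simpa using hmul _ _ ha hb
  | add a b ha hb => simpa using hadd _ _ ha hb

theorem even_z : even p (QDiff.z p) = z p := by simp [even, QDiff.z, evenFun]
theorem even_D : even p (QDiff.D p) = D p := by simp [even, QDiff.D, evenFun]

/-- The endomorphism that scales `z`, `∂`, `ζ`, `δ` by `c`, `c⁻¹`, `c s`, `c⁻¹ s`. -/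
def scale (c s : ℂˣ) : QDeRham p →ₐ[ℂ] QDeRham p :=
  lift (x := (c : ℂ) • z p) (y := (c⁻¹ : ℂˣ) • D p) (u := ((c * s : ℂˣ) : ℂ) • zeta p)
    (v := ((c⁻¹ * s : ℂˣ) : ℂ) • delta p)
    { D_z := by simp only [Units.smul_def, smul_mul_smul_comm, Units.inv_mul, Units.mul_inv,
        one_smul, (sat_gen p).D_z]
      z_pow := by rw [smul_pow, (sat_gen p).z_pow, smul_zero]
      D_pow := by rw [smul_pow, (sat_gen p).D_pow, smul_zero]
      zeta_sq := by rw [smul_pow, (sat_gen p).zeta_sq, smul_zero]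
      delta_sq := by rw [smul_pow, (sat_gen p).delta_sq, smul_zero]
      delta_zeta := by
        rw [smul_mul_smul_comm, smul_mul_smul_comm, (sat_gen p).delta_zeta, smul_comm, mul_comm]
      zeta_z := by
        rw [smul_mul_smul_comm, smul_mul_smul_comm, (sat_gen p).zeta_z, smul_comm, mul_comm]
      delta_D := by
        rw [Units.smul_def, smul_mul_smul_comm, smul_mul_smul_comm, (sat_gen p).delta_D, smul_comm,
          mul_comm]
      zeta_D := by
        rw [Units.smul_def, smul_mul_smul_comm, smul_mul_smul_comm, (sat_gen p).zeta_D, smul_comm,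
          mul_comm]
      delta_z := by
        rw [smul_mul_smul_comm, smul_mul_smul_comm, (sat_gen p).delta_z, smul_comm, mul_comm] }

section
variable (c s : ℂˣ)
@[simp] theorem scale_z : scale p c s (z p) = (c : ℂ) • z p := lift_z ..
@[simp] theorem scale_D : scale p c s (D p) = ((c⁻¹ : ℂˣ) : ℂ) • D p := lift_D ..
@[simp] theorem scale_zeta : scale p c s (zeta p) = ((c * s : ℂˣ) : ℂ) • zeta p := lift_zeta ..
@[simp] theorem scale_delta : scale p c s (delta p) = ((c⁻¹ * s : ℂˣ) : ℂ) • delta p :=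
  lift_delta ..
end

theorem scale_mul (c s c' s' : ℂˣ) :
    scale p (c * c') (s * s') = (scale p c s).comp (scale p c' s') := by
  apply algHom_ext
  all_goals
    simp only [AlgHom.comp_apply, scale_z, scale_D, scale_zeta, scale_delta, map_smul, smul_smul,
      ← Units.val_mul]
    congr 2
  · exact mul_comm _ _
  · rw [mul_comm (c' * s'), mul_mul_mul_comm]
  · rw [mul_comm (c'⁻¹ * s'), mul_inv, mul_mul_mul_comm]

theorem scale_one : scale p 1 1 = AlgHom.id ℂ _ :=
  algHom_ext (by simp) (by simp) (by simp) (by simp)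

theorem scale_pow (c s : ℂˣ) (n : ℕ) :
    (scale p c s).toLinearMap ^ n = (scale p (c ^ n) (s ^ n)).toLinearMap := by
  induction n with
  | zero => rw [pow_zero, pow_zero, pow_zero, scale_one]; rfl
  | succ n ih => rw [pow_succ, ih, pow_succ, pow_succ, scale_mul]; rfl

/-- One commuting family contains everything needed: k is the scaling (q², 1), parity is (1, −1),
the degree operator is (1, 2). -/
theorem scale_comm (c s c' s' : ℂˣ) (a : QDeRham p) :
    scale p c s (scale p c' s' a) = scale p c' s' (scale p c s a) := by
  rw [← AlgHom.comp_apply, ← AlgHom.comp_apply, ← scale_mul, ← scale_mul, mul_comm c, mul_comm s]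

/-- The de Rham algebra with the scaling by `q²`. -/
def weylData : QWeylData p (QDeRham p) where
  z := z p
  D := D p
  k := scale p (qSqUnit p) 1
  kinv := scale p (qSqUnit p)⁻¹ 1
  D_mul_z := (sat_gen p).D_z
  z_pow := (sat_gen p).z_pow
  D_pow := (sat_gen p).D_pow
  k_z := scale_z ..
  k_D := by rw [scale_D, qSqUnit_inv_val]
  k_kinv a := by
    rw [← AlgHom.comp_apply, ← scale_mul, mul_inv_cancel, mul_one, scale_one]; rfl
  kinv_k a := by
    rw [← AlgHom.comp_apply, ← scale_mul, inv_mul_cancel, mul_one, scale_one]; rfl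
  k_pow := by rw [scale_pow, qSqUnit_pow, one_pow, scale_one]; rfl

/-- The parity automorphism. -/
def parity : QDeRham p →ₐ[ℂ] QDeRham p := scale p 1 (-1)

@[simp] theorem parity_z : parity p (z p) = z p := by simp [parity]
@[simp] theorem parity_D : parity p (D p) = D p := by simp [parity]
@[simp] theorem parity_zeta : parity p (zeta p) = -zeta p := by simp [parity]
@[simp] theorem parity_delta : parity p (delta p) = -delta p := by simp [parity]

/-! #### The differential -/

/-- Matrices `!![parity a, b; 0, a]`. -/
def dMat (a b : QDeRham p) : Matrix (Fin 2) (Fin 2) (QDeRham p) := !![parity p a, b; 0, a]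

/-- The corner of the product is the graded Leibniz rule, so a homomorphism into matrices of this
shape is the same as an odd derivation. -/
theorem dMat_mul (a b a' b' : QDeRham p) :
    dMat p a b * dMat p a' b' = dMat p (a * a') (parity p a * b' + b * a') := by
  simp [dMat]

theorem dMat_add (a b a' b' : QDeRham p) :
    dMat p a b + dMat p a' b' = dMat p (a + a') (b + b') := by
  simp [dMat]

theorem dMat_smul (c : ℂ) (a b : QDeRham p) : c • dMat p a b = dMat p (c • a) (c • b) := by
  simp [dMat]

theorem dMat_one : dMat p 1 0 = 1 := by simp [dMat, Matrix.one_fin_two]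

theorem dMat_zero : dMat p 0 0 = 0 := by
  ext i j; fin_cases i <;> fin_cases j <;> simp [dMat]

/-- For w = q^{∓2} and exponent p the geometric sum vanishes, which is why d is compatible with z^p
= ∂^p = 0. -/
theorem dMat_pow (x y : QDeRham p) (w : ℂ) (hx : parity p x = x) (hw : y * x = w • (x * y)) (n : ℕ) :
    dMat p x y ^ (n + 1) = dMat p (x ^ (n + 1)) ((∑ i ∈ Finset.range (n + 1), w ^ i) • (x ^ n * y)) := by
  induction n with
  | zero => simp
  | succ n ih =>
    have h := mul_pow_of_qcomm hw (n + 1)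
    rw [pow_succ', ih, dMat_mul, ← pow_succ', hx, h, mul_smul_comm, ← mul_assoc, ← pow_succ',
      ← add_smul, ← Finset.sum_range_succ]

/-- The diagonal entries repeat the relations of Ω; each corner is the relation obtained by
differentiating. For instance, ∂z gives ∂ζ + δz = q⁻²(ζ∂ + zδ), and ζ∂ and δz both give δζ = −q⁻²ζδ.
-/
theorem sat_dMat : Sat p (dMat p (z p) (zeta p)) (dMat p (D p) (delta p)) (dMat p (zeta p) 0)
    (dMat p (delta p) 0) where
  D_z := by
    rw [dMat_mul, dMat_mul, Algebra.algebraMap_eq_smul_one, ← dMat_one, dMat_smul, dMat_smul,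
      dMat_add, (sat_gen p).D_z, parity_z, parity_D, (sat_gen p).delta_z, (sat_gen p).zeta_D,
      smul_zero, zero_add, smul_add, smul_smul, UqSl2.q_neg_two_mul_two, one_smul, add_comm (D p * _),
      Algebra.algebraMap_eq_smul_one]
  z_pow := by
    have hp := hp2.out
    have h := dMat_pow p (z p) (zeta p) _ (parity_z p) (sat_gen p).zeta_z (p - 1)
    have hw := (qRoot_sq_isPrimitiveRoot p (UqSl2.p_ne_zero p)).inv.geom_sum_eq_zero hp
    rw [← zpow_neg] at hw
    rwa [Nat.sub_add_cancel (by omega), hw, zero_smul, (sat_gen p).z_pow, dMat_zero] at h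
  D_pow := by
    have hp := hp2.out
    have h := dMat_pow p (D p) (delta p) _ (parity_D p) (sat_gen p).delta_D (p - 1)
    have hw := (qRoot_sq_isPrimitiveRoot p (UqSl2.p_ne_zero p)).geom_sum_eq_zero hp
    rwa [Nat.sub_add_cancel (by omega), hw, zero_smul, (sat_gen p).D_pow, dMat_zero] at h
  zeta_sq := by
    rw [pow_two, dMat_mul, ← pow_two, (sat_gen p).zeta_sq, mul_zero, zero_mul, add_zero, dMat_zero]
  delta_sq := by
    rw [pow_two, dMat_mul, ← pow_two, (sat_gen p).delta_sq, mul_zero, zero_mul, add_zero, dMat_zero]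
  delta_zeta := by
    rw [dMat_mul, dMat_mul, dMat_smul, (sat_gen p).delta_zeta]
    simp
  zeta_z := by
    have h := (sat_gen p).zeta_sq
    rw [pow_two] at h
    rw [dMat_mul, dMat_mul, dMat_smul, (sat_gen p).zeta_z]
    simp [h]
  delta_D := by
    have h := (sat_gen p).delta_sq
    rw [pow_two] at h
    rw [dMat_mul, dMat_mul, dMat_smul, (sat_gen p).delta_D]
    simp [h]
  zeta_D := by
    rw [dMat_mul, dMat_mul, dMat_smul, (sat_gen p).zeta_D, parity_zeta, parity_D, zero_mul,
      mul_zero, add_zero, zero_add, (sat_gen p).delta_zeta, smul_smul, mul_neg,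
      UqSl2.q_two_mul_neg_two, neg_one_smul, neg_mul]
  delta_z := by
    rw [dMat_mul, dMat_mul, dMat_smul, (sat_gen p).delta_z, parity_delta, parity_z, zero_mul,
      mul_zero, add_zero, zero_add, neg_mul, (sat_gen p).delta_zeta, neg_smul, neg_neg]

/-- The homomorphism `a ↦ !![parity a, d a; 0, a]`. -/
def dHom : QDeRham p →ₐ[ℂ] Matrix (Fin 2) (Fin 2) (QDeRham p) := lift (sat_dMat p)

/-- The differential. -/
def d : QDeRham p →ₗ[ℂ] QDeRham p :=
  (Matrix.entryLinearMap ℂ (QDeRham p) 0 1) ∘ₗ (dHom p).toLinearMap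

theorem dHom_apply (a : QDeRham p) : dHom p a = dMat p a (d p a) := by
  -- Matrices of the shape `dMat` are closed under sums and products, so the whole image has this
  -- shape once the generators do.
  have key : ∃ b, dHom p a = dMat p a b := by
    induction a using induction_gen with
    | hc c =>
      exact ⟨0, by rw [AlgHom.commutes, Algebra.algebraMap_eq_smul_one, ← dMat_one, dMat_smul,
        Algebra.algebraMap_eq_smul_one, smul_zero]⟩
    | hz => exact ⟨zeta p, lift_z _⟩
    | hD => exact ⟨delta p, lift_D _⟩
    | hzeta => exact ⟨0, lift_zeta _⟩
    | hdelta => exact ⟨0, lift_delta _⟩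
    | hadd a b ha hb =>
      obtain ⟨a', ha⟩ := ha
      obtain ⟨b', hb⟩ := hb
      exact ⟨a' + b', by rw [map_add, ha, hb, dMat_add]⟩
    | hmul a b ha hb =>
      obtain ⟨a', ha⟩ := ha
      obtain ⟨b', hb⟩ := hb
      exact ⟨_, by rw [map_mul, ha, hb, dMat_mul]⟩
  obtain ⟨b, hb⟩ := key
  have : d p a = b := by
    change dHom p a 0 1 = b
    rw [hb]; rfl
  rw [this, hb]

theorem d_eq (a : QDeRham p) : d p a = dHom p a 0 1 := rfl

@[simp] theorem d_z : d p (z p) = zeta p := by rw [d_eq, dHom, lift_z]; rfl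
@[simp] theorem d_D : d p (D p) = delta p := by rw [d_eq, dHom, lift_D]; rfl
@[simp] theorem d_zeta : d p (zeta p) = 0 := by rw [d_eq, dHom, lift_zeta]; rfl
@[simp] theorem d_delta : d p (delta p) = 0 := by rw [d_eq, dHom, lift_delta]; rfl
@[simp] theorem d_algebraMap (c : ℂ) : d p (algebraMap ℂ _ c) = 0 := by
  rw [d_eq, AlgHom.commutes]
  simp [Matrix.algebraMap_matrix_apply]

theorem d_mul (a b : QDeRham p) : d p (a * b) = d p a * b + parity p a * d p b := by
  rw [d_eq, map_mul, dHom_apply, dHom_apply, dMat_mul, add_comm]; rfl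

/-- The differential keeps the weight measured by c and raises the degree measured by s by one,
whence a single factor s. -/
theorem d_scale (c s : ℂˣ) (a : QDeRham p) :
    scale p c s (d p a) = (s : ℂ) • d p (scale p c s a) := by
  induction a using induction_gen with
  | hc c => rw [AlgHom.commutes, d_algebraMap, map_zero, smul_zero]
  | hz => simp [smul_smul, mul_comm]
  | hD => simp [smul_smul, mul_comm]
  | hzeta => simp
  | hdelta => simp
  | hadd a b ha hb => simp only [map_add, smul_add, ha, hb]
  | hmul a b ha hb =>
    simp only [d_mul, map_add, map_mul, ha, hb, smul_add, smul_mul_assoc, mul_smul_comm, parity,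
      scale_comm p c s]

theorem parity_d (a : QDeRham p) : parity p (d p a) = -d p (parity p a) := by
  have := d_scale p 1 (-1) a
  rwa [Units.val_neg, Units.val_one, neg_one_smul] at this

/-- Applied to a product, d² leaves the cross terms parity(da)db + d(parity a)db, which cancel
because parity anticommutes with d; on generators d² is zero. -/
theorem d_d (a : QDeRham p) : d p (d p a) = 0 := by
  induction a using induction_gen with
  | hc c => simp
  | hz => simp
  | hD => simp
  | hzeta => simp
  | hdelta => simp
  | hadd a b ha hb => simp [ha, hb]
  | hmul a b ha hb => simp [d_mul, ha, hb, parity_d]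

/-- Passing ζ across any of the four generators is, up to the sign of parity, the scaling k. This is
what makes the ζ-terms cancel when d is applied to az − z k(a). -/
theorem parity_mul_zeta (a : QDeRham p) :
    parity p a * zeta p = zeta p * (weylData p).k a := by
  have hz := (sat_gen p)
  have h2 := hz.zeta_sq
  rw [pow_two] at h2
  induction a using induction_gen with
  | hc c => rw [AlgHom.commutes, AlgHom.commutes, Algebra.commutes]
  | hz => simp [weylData, hz.zeta_z, qSqUnit_val, smul_smul, qRoot_ne_zero]
  | hD =>
    simp [weylData, hz.zeta_D, qSqUnit_val, smul_smul, qRoot_ne_zero]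
  | hzeta => simp [weylData, h2]
  | hdelta =>
    simp [weylData, hz.delta_zeta, -Units.val_inv_eq_inv_val, qSqUnit_inv_val]
  | hadd a b ha hb => simp only [map_add, add_mul, mul_add, ha, hb]
  | hmul a b ha hb => rw [map_mul, mul_assoc, hb, ← mul_assoc, ha, mul_assoc, map_mul]

/-- The counterpart for F: δ passes through with the twist k⁻¹ and the parity sign, so the δ-terms
in d(∂a − k⁻¹(a)∂) cancel. -/
theorem delta_mul (a : QDeRham p) :
    delta p * a = parity p ((weylData p).kinv a) * delta p := by
  have hz := (sat_gen p)
  have h2 := hz.delta_sq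
  rw [pow_two] at h2
  induction a using induction_gen with
  | hc c => rw [AlgHom.commutes, AlgHom.commutes, Algebra.commutes]
  | hz => simp [weylData, hz.delta_z, -Units.val_inv_eq_inv_val, qSqUnit_inv_val]
  | hD => simp [weylData, hz.delta_D, qSqUnit_val]
  | hzeta =>
    simp [weylData, hz.delta_zeta, -Units.val_inv_eq_inv_val, qSqUnit_inv_val]
  | hdelta => simp [weylData, h2]
  | hadd a b ha hb => simp only [map_add, add_mul, mul_add, ha, hb]
  | hmul a b ha hb => rw [← mul_assoc, ha, mul_assoc, hb, ← mul_assoc, map_mul, map_mul]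

theorem d_k (a : QDeRham p) : d p ((weylData p).k a) = (weylData p).k (d p a) := by
  have := (d_scale p (qSqUnit p) 1 a).symm
  rwa [Units.val_one, one_smul] at this

theorem d_kinv (a : QDeRham p) : d p ((weylData p).kinv a) = (weylData p).kinv (d p a) := by
  have := (d_scale p (qSqUnit p)⁻¹ 1 a).symm
  rwa [Units.val_one, one_smul] at this

theorem d_opE (a : QDeRham p) : d p ((weylData p).opE a) = (weylData p).opE (d p a) := by
  have h1 : (weylData p).z = z p := rfl
  rw [QWeylData.opE_apply, QWeylData.opE_apply, map_smul, map_sub, d_mul, d_mul, d_k, h1, d_z,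
    parity_mul_zeta, parity_z]
  congr 1
  abel

theorem d_opF (a : QDeRham p) : d p ((weylData p).opF a) = (weylData p).opF (d p a) := by
  have h1 : (weylData p).D = D p := rfl
  rw [QWeylData.opF_apply, QWeylData.opF_apply, map_smul, map_sub, d_mul, d_mul, d_kinv, h1, d_D,
    delta_mul, parity_D]
  congr 1
  abel

theorem d_rep (u : UqSl2 p) (a : QDeRham p) :
    d p ((weylData p).rep u a) = (weylData p).rep u (d p a) := by
  induction u using UqSl2.induction_gen generalizing a with
  | hc c => simp [Algebra.algebraMap_eq_smul_one]
  | hE => rw [QWeylData.rep, UqSl2.lift_E, d_opE]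
  | hK => rw [QWeylData.rep, UqSl2.lift_K]; exact d_k p a
  | hF => rw [QWeylData.rep, UqSl2.lift_F, d_opF]
  | hadd u v hu hv => simp [hu, hv]
  | hmul u v hu hv => simp [hu, hv]

/-! #### The grading -/

/-- All four cross relations of Ω say that an odd generator passes a function a at the cost of
replacing a by k⁻¹(a). -/
theorem zeta_mul_even (x : QDiff p) :
    zeta p * even p x = even p ((QDiff.weylData p).kinv x) * zeta p := by
  induction x using QDiff.induction_gen with
  | hc c => rw [AlgHom.commutes, AlgHom.commutes, AlgHom.commutes, Algebra.commutes]
  | hz =>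
    have : (QDiff.weylData p).kinv (QDiff.z p) = _ := (QDiff.weylData p).kinv_z
    rw [this, even_z, (sat_gen p).zeta_z, map_smul, smul_mul_assoc]
    congr 2
    exact (even_z p).symm
  | hD =>
    have : (QDiff.weylData p).kinv (QDiff.D p) = _ := (QDiff.weylData p).kinv_D
    rw [this, even_D, (sat_gen p).zeta_D, map_smul, smul_mul_assoc]
    congr 2
    exact (even_D p).symm
  | hadd a b ha hb => simp only [map_add, add_mul, mul_add, ha, hb]
  | hmul a b ha hb => rw [map_mul, ← mul_assoc, ha, mul_assoc, hb, ← mul_assoc, map_mul, map_mul]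

theorem delta_mul_even (x : QDiff p) :
    delta p * even p x = even p ((QDiff.weylData p).kinv x) * delta p := by
  induction x using QDiff.induction_gen with
  | hc c => rw [AlgHom.commutes, AlgHom.commutes, AlgHom.commutes, Algebra.commutes]
  | hz =>
    have : (QDiff.weylData p).kinv (QDiff.z p) = _ := (QDiff.weylData p).kinv_z
    rw [this, even_z, (sat_gen p).delta_z, map_smul, smul_mul_assoc]
    congr 2
    exact (even_z p).symm
  | hD =>
    have : (QDiff.weylData p).kinv (QDiff.D p) = _ := (QDiff.weylData p).kinv_D
    rw [this, even_D, (sat_gen p).delta_D, map_smul, smul_mul_assoc]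
    congr 2
    exact (even_D p).symm
  | hadd a b ha hb => simp only [map_add, add_mul, mul_add, ha, hb]
  | hmul a b ha hb => rw [map_mul, ← mul_assoc, ha, mul_assoc, hb, ← mul_assoc, map_mul, map_mul]

theorem scale_even (s : ℂˣ) (x : QDiff p) : scale p 1 s (even p x) = even p x := by
  rw [← AlgHom.comp_apply]
  congr 1
  apply QDiff.algHom_ext <;> simp [even_z, even_D]

theorem scale_of_mem_forms (s : ℂˣ) (n : ℕ) (a : QDeRham p) (ha : a ∈ forms p n) :
    scale p 1 s a = (s : ℂ) ^ n • a := by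
  match n, ha with
  | 0, ha =>
    obtain ⟨x, rfl⟩ := ha
    simp [scale_even]
  | 1, ha =>
    obtain ⟨_, ⟨x, rfl⟩, _, ⟨y, rfl⟩, rfl⟩ := Submodule.mem_sup.mp ha
    simp [scale_even]
  | 2, ha =>
    obtain ⟨x, rfl⟩ := ha
    simp [scale_even, smul_smul, pow_two]
  | n + 3, ha =>
    obtain rfl := (Submodule.mem_bot ℂ).mp ha
    simp

theorem mem_forms_zero (x : QDiff p) : even p x ∈ forms p 0 := ⟨x, rfl⟩

theorem mul_zeta_mem (x : QDiff p) : even p x * zeta p ∈ forms p 1 :=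
  Submodule.mem_sup_left ⟨x, rfl⟩

theorem mul_delta_mem (x : QDiff p) : even p x * delta p ∈ forms p 1 :=
  Submodule.mem_sup_right ⟨x, rfl⟩

theorem mul_zeta_delta_mem (x : QDiff p) : even p x * (zeta p * delta p) ∈ forms p 2 := ⟨x, rfl⟩

theorem forms_induction {P : QDeRham p → Prop} (h0 : ∀ x, P (even p x))
    (h1 : ∀ x, P (even p x * zeta p)) (h2 : ∀ x, P (even p x * delta p))
    (h3 : ∀ x, P (even p x * (zeta p * delta p))) (hadd : ∀ a b, P a → P b → P (a + b))
    {a : QDeRham p} (ha : a ∈ ⨆ n, forms p n) : P a := by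
  have hzero : P 0 := by simpa using h0 0
  have hforms : ∀ n, ∀ a ∈ forms p n, P a := by
    intro n a ha
    match n, ha with
    | 0, ha =>
      obtain ⟨x, rfl⟩ := ha
      exact h0 x
    | 1, ha =>
      obtain ⟨_, ⟨x, rfl⟩, _, ⟨y, rfl⟩, rfl⟩ := Submodule.mem_sup.mp ha
      exact hadd _ _ (h1 x) (h2 y)
    | 2, ha =>
      obtain ⟨x, rfl⟩ := ha
      exact h3 x
    | n + 3, ha =>
      obtain rfl := (Submodule.mem_bot ℂ).mp ha
      exact hzero
  exact Submodule.iSup_induction _ (motive := P) ha hforms hzero hadd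

/-- The sum of the spaces of forms contains 1 and is stable under left multiplication by every
generator: odd generators are moved to the right through the coefficient and then reduced by the
relations among ζ, δ. -/
theorem iSup_forms : ⨆ n, forms p n = ⊤ := by
  have hle : ∀ n, forms p n ≤ ⨆ n, forms p n := le_iSup (forms p)
  have hz2 := (sat_gen p).zeta_sq
  have hd2 := (sat_gen p).delta_sq
  have hdz := (sat_gen p).delta_zeta
  rw [pow_two] at hz2 hd2
  have heven : ∀ (x : QDiff p), ∀ y ∈ ⨆ n, forms p n, even p x * y ∈ ⨆ n, forms p n := by
    intro x y hy
    refine forms_induction p (P := fun y => even p x * y ∈ ⨆ n, forms p n) (fun y => ?_)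
      (fun y => ?_) (fun y => ?_) (fun y => ?_) (fun a b ha hb => ?_) hy
    · rw [← map_mul]; exact hle 0 (mem_forms_zero p _)
    · rw [← mul_assoc, ← map_mul]; exact hle 1 (mul_zeta_mem p _)
    · rw [← mul_assoc, ← map_mul]; exact hle 1 (mul_delta_mem p _)
    · rw [← mul_assoc, ← map_mul]; exact hle 2 (mul_zeta_delta_mem p _)
    · rw [mul_add]; exact add_mem ha hb
  have key : ∀ x : QDeRham p, ∀ y ∈ ⨆ n, forms p n, x * y ∈ ⨆ n, forms p n := by
    intro x
    induction x using induction_gen with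
    | hc c => intro y hy; rw [← Algebra.smul_def]; exact Submodule.smul_mem _ c hy
    | hz => rw [← even_z]; exact heven _
    | hD => rw [← even_D]; exact heven _
    | hzeta =>
      intro y hy
      refine forms_induction p (P := fun y => zeta p * y ∈ ⨆ n, forms p n) (fun y => ?_)
        (fun y => ?_) (fun y => ?_) (fun y => ?_) (fun a b ha hb => ?_) hy
      · rw [zeta_mul_even]; exact hle 1 (mul_zeta_mem p _)
      · rw [← mul_assoc, zeta_mul_even, mul_assoc, hz2, mul_zero]; exact zero_mem _
      · rw [← mul_assoc, zeta_mul_even, mul_assoc]; exact hle 2 (mul_zeta_delta_mem p _)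
      · rw [← mul_assoc, zeta_mul_even, mul_assoc, ← mul_assoc (zeta p), hz2, zero_mul, mul_zero]
        exact zero_mem _
      · rw [mul_add]; exact add_mem ha hb
    | hdelta =>
      intro y hy
      refine forms_induction p (P := fun y => delta p * y ∈ ⨆ n, forms p n) (fun y => ?_)
        (fun y => ?_) (fun y => ?_) (fun y => ?_) (fun a b ha hb => ?_) hy
      · rw [delta_mul_even]; exact hle 1 (mul_delta_mem p _)
      · rw [← mul_assoc, delta_mul_even, mul_assoc, hdz, mul_smul_comm]
        exact Submodule.smul_mem _ _ (hle 2 (mul_zeta_delta_mem p _))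
      · rw [← mul_assoc, delta_mul_even, mul_assoc, hd2, mul_zero]; exact zero_mem _
      · rw [← mul_assoc, delta_mul_even, mul_assoc, ← mul_assoc (delta p), hdz, smul_mul_assoc,
          mul_assoc, hd2, mul_zero, smul_zero, mul_zero]
        exact zero_mem _
      · rw [mul_add]; exact add_mem ha hb
    | hadd a b ha hb => intro y hy; rw [add_mul]; exact add_mem (ha y hy) (hb y hy)
    | hmul a b ha hb => intro y hy; rw [mul_assoc]; exact ha _ (hb y hy)
  refine eq_top_iff.mpr fun x _ => ?_
  have := key x 1 (hle 0 (by simpa using mem_forms_zero p 1))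
  rwa [mul_one] at this

/-- The operator whose eigenspaces are the spaces of forms. -/
def degreeOp : Module.End ℂ (QDeRham p) := (scale p 1 (Units.mk0 2 two_ne_zero)).toLinearMap

theorem forms_le_eigenspace (n : ℕ) :
    forms p n ≤ Module.End.eigenspace (degreeOp p) (2 ^ n) := fun a ha =>
  Module.End.mem_eigenspace_iff.mpr (scale_of_mem_forms p _ n a ha)

/-- The scalar 2 serves only as a unit with pairwise distinct powers. -/
theorem eigenspace_iSupIndep :
    iSupIndep fun n : ℕ => Module.End.eigenspace (degreeOp p) (2 ^ n) :=
  (Module.End.eigenspaces_iSupIndep (degreeOp p)).comp (f := fun n : ℕ => (2 : ℂ) ^ n)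
    fun m n h => by
      have h' : (2 : ℂ) ^ m = 2 ^ n := h
      have h2 : 2 ^ m = 2 ^ n := by exact_mod_cast h'
      exact Nat.pow_right_injective le_rfl h2

theorem forms_isInternal : DirectSum.IsInternal (forms p) :=
  DirectSum.isInternal_submodule_of_iSupIndep_of_iSup_eq_top
    ((eigenspace_iSupIndep p).mono (forms_le_eigenspace p)) (iSup_forms p)

/-- The forms sit inside independent eigenspaces and already span Ω, so by the modular law each
inclusion is an equality. Membership in a degree thus becomes one equation for an algebra
automorphism, from which stability under products, d and U is read off. -/
theorem forms_eq_eigenspace (n : ℕ) :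
    forms p n = Module.End.eigenspace (degreeOp p) (2 ^ n) := by
  have h1 : forms p n ⊔ ⨆ (m) (_ : m ≠ n), forms p m = ⊤ := by
    rw [← iSup_forms p]
    refine le_antisymm (sup_le (le_iSup _ n) (iSup₂_le fun m _ => le_iSup _ m))
      (iSup_le fun m => ?_)
    by_cases h : m = n
    · rw [h]; exact le_sup_left
    · exact le_sup_of_le_right (le_iSup₂_of_le m h le_rfl)
  have h2 := (eigenspace_iSupIndep p n).mono_right
    (iSup₂_mono fun m (_ : m ≠ n) => forms_le_eigenspace p m)
  calc forms p n = forms p n ⊔ (⨆ (m) (_ : m ≠ n), forms p m) ⊓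
        Module.End.eigenspace (degreeOp p) (2 ^ n) := by
        rw [inf_comm, h2.eq_bot, sup_bot_eq]
    _ = _ := by rw [← sup_inf_assoc_of_le _ (forms_le_eigenspace p n), h1, top_inf_eq]

theorem mem_forms_iff (n : ℕ) (a : QDeRham p) :
    a ∈ forms p n ↔ scale p 1 (Units.mk0 2 two_ne_zero) a = (2 : ℂ) ^ n • a := by
  rw [forms_eq_eigenspace, Module.End.mem_eigenspace_iff]
  rfl

theorem mul_mem_forms (m n : ℕ) (a : QDeRham p) (ha : a ∈ forms p m) (b : QDeRham p)
    (hb : b ∈ forms p n) : a * b ∈ forms p (m + n) := by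
  rw [mem_forms_iff] at *
  rw [map_mul, ha, hb, smul_mul_smul_comm, pow_add]

theorem d_mem_forms (n : ℕ) (a : QDeRham p) (ha : a ∈ forms p n) : d p a ∈ forms p (n + 1) := by
  rw [mem_forms_iff] at *
  rw [d_scale, ha, map_smul, smul_smul, pow_succ', Units.val_mk0]

theorem leibniz (n : ℕ) (a : QDeRham p) (ha : a ∈ forms p n) (b : QDeRham p) :
    d p (a * b) = d p a * b + (-1 : ℂ) ^ n • (a * d p b) := by
  have h : parity p a = (-1 : ℂ) ^ n • a := by
    have := scale_of_mem_forms p (-1) n a ha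
    rwa [Units.val_neg, Units.val_one] at this
  rw [d_mul, h, smul_mul_assoc]

/-- The degree automorphism fixes z and ∂ and commutes with k, so it is U-linear and its eigenspaces
are submodules. -/
theorem smul_mem_forms (u : UqSl2 p) (n : ℕ) (a : QDeRham p) (ha : a ∈ forms p n) :
    (weylData p).rep u a ∈ forms p n := by
  rw [mem_forms_iff] at *
  have h := (weylData p).map_smul_of_intertwines (weylData p)
    (scale p 1 (Units.mk0 2 two_ne_zero)) (by simp [weylData]) (by simp [weylData])
    (scale_comm p _ _ _ _) u a
  change scale p 1 _ ((weylData p).rep u a) = (weylData p).rep u (scale p 1 _ a) at h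
  rw [h, ha, map_smul]

theorem isDifferentialModuleAlgebra :
    letI := (weylData p).module; letI := (weylData p).isScalarTower
    IsDifferentialModuleAlgebra (UqSl2 p) (forms p) (d p) :=
  letI := (weylData p).module
  letI := (weylData p).isScalarTower
  { isInternal := forms_isInternal p
    one_mem := by simpa using mem_forms_zero p 1
    mul_mem := mul_mem_forms p
    d_mem := d_mem_forms p
    d_d := d_d p
    leibniz := leibniz p
    isModuleAlgebra := (weylData p).isModuleAlgebra
    smul_mem := smul_mem_forms p
    d_smul := d_rep p }

theorem adjoin_eq_top : Algebra.adjoin ℂ ((forms p 0 : Set (QDeRham p)) ∪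
    d p '' (forms p 0 : Set (QDeRham p))) = ⊤ := by
  have hz : z p ∈ forms p 0 := ⟨QDiff.z p, even_z p⟩
  have hD : D p ∈ forms p 0 := ⟨QDiff.D p, even_D p⟩
  refine eq_top_iff.mpr fun x _ => ?_
  induction x using induction_gen with
  | hc c => exact Subalgebra.algebraMap_mem _ c
  | hz => exact Algebra.subset_adjoin (Or.inl hz)
  | hD => exact Algebra.subset_adjoin (Or.inl hD)
  | hzeta => exact Algebra.subset_adjoin (Or.inr ⟨_, hz, d_z p⟩)
  | hdelta => exact Algebra.subset_adjoin (Or.inr ⟨_, hD, d_D p⟩)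
  | hadd a b ha hb => exact add_mem (ha trivial) (hb trivial)
  | hmul a b ha hb => exact mul_mem (ha trivial) (hb trivial)

end QDeRham

/-! ### Generators of the odd algebra. -/

namespace QOdd

variable (p : ℕ)

/-- The generator `ζ` of the odd algebra. -/
def zeta : QOdd p := PresAlg.mk (Rel p) (free .zeta)
/-- The generator `δ` of the odd algebra. -/
def delta : QOdd p := PresAlg.mk (Rel p) (free .delta)

theorem zeta_sq : zeta p ^ 2 = 0 := by simpa [zeta] using PresAlg.mk_rel (Rel.zeta_sq (p := p))

theorem delta_sq : delta p ^ 2 = 0 := by simpa [delta] using PresAlg.mk_rel (Rel.delta_sq (p := p))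

theorem delta_zeta : delta p * zeta p = (-qRoot p ^ (-2 : ℤ)) • (zeta p * delta p) := by
  simpa [zeta, delta] using PresAlg.mk_rel (Rel.delta_zeta (p := p))

theorem induction_gen {P : QOdd p → Prop} (hc : ∀ c : ℂ, P (algebraMap ℂ _ c))
    (hzeta : P (zeta p)) (hdelta : P (delta p))
    (hadd : ∀ a b, P a → P b → P (a + b)) (hmul : ∀ a b, P a → P b → P (a * b))
    (a : QOdd p) : P a := by
  obtain ⟨x, rfl⟩ := PresAlg.mk_surjective (Rel p) a
  induction x using FreeAlgebra.induction with
  | grade0 c => simpa using hc c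
  | grade1 g => cases g <;> assumption
  | mul a b ha hb => simpa using hmul _ _ ha hb
  | add a b ha hb => simpa using hadd _ _ ha hb

end QOdd

namespace QDeRham

set_option linter.unusedSectionVars false

variable (p : ℕ) [hp2 : Fact (2 ≤ p)]

theorem odd_zeta : odd p (QOdd.zeta p) = zeta p := by simp [odd, QOdd.zeta, oddFun]
theorem odd_delta : odd p (QOdd.delta p) = delta p := by simp [odd, QOdd.delta, oddFun]

/-! #### The tensor product decomposition -/

/-- The operator of `k⁻¹` on the algebra on `z`, `∂`. -/
def kinvOp : Module.End ℂ (QDiff p) := (QDiff.weylData p).kinv.toLinearMap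

theorem kinvOp_mulLeft (x : QDiff p) : kinvOp p * LinearMap.mulLeft ℂ x =
    LinearMap.mulLeft ℂ ((QDiff.weylData p).kinv x) * kinvOp p := by
  ext a
  simp [kinvOp]

/-- Functions act by left multiplication and the odd generators carry k⁻¹ in the operator factor.
Thus the twisted commutation rules of Ω hold in an ordinary tensor product of algebras, with no
separate construction of a twisted product. -/
theorem sat_tensor : Sat p (A := Module.End ℂ (QDiff p) ⊗[ℂ] QOdd p)
    (LinearMap.mulLeft ℂ (QDiff.z p) ⊗ₜ 1) (LinearMap.mulLeft ℂ (QDiff.D p) ⊗ₜ 1)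
    (kinvOp p ⊗ₜ QOdd.zeta p) (kinvOp p ⊗ₜ QOdd.delta p) := by
  have hz : (QDiff.weylData p).kinv (QDiff.z p) = _ := (QDiff.weylData p).kinv_z
  have hD : (QDiff.weylData p).kinv (QDiff.D p) = _ := (QDiff.weylData p).kinv_D
  have hl : ∀ (c : ℂ) (x : QDiff p),
      LinearMap.mulLeft ℂ (c • x) = c • LinearMap.mulLeft ℂ x := fun c x => by
    ext; simp
  refine ⟨?_, ?_, ?_, ?_, ?_, ?_, ?_, ?_, ?_, ?_⟩
  · have h : LinearMap.mulLeft ℂ (QDiff.D p) * LinearMap.mulLeft ℂ (QDiff.z p) =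
        (qRoot p - (qRoot p)⁻¹) • 1 + (qRoot p ^ (-2 : ℤ)) •
          (LinearMap.mulLeft ℂ (QDiff.z p) * LinearMap.mulLeft ℂ (QDiff.D p)) := by
      ext a
      simp only [Module.End.mul_apply, LinearMap.mulLeft_apply, LinearMap.add_apply,
        LinearMap.smul_apply, Module.End.one_apply]
      rw [← mul_assoc, QDiff.D_mul_z, add_mul, ← Algebra.smul_def, smul_mul_assoc, mul_assoc]
    rw [Algebra.TensorProduct.tmul_mul_tmul, Algebra.TensorProduct.tmul_mul_tmul, h, one_mul,
      TensorProduct.add_tmul, Algebra.algebraMap_eq_smul_one, Algebra.TensorProduct.one_def,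
      TensorProduct.smul_tmul', TensorProduct.smul_tmul']
  · rw [Algebra.TensorProduct.tmul_pow, LinearMap.pow_mulLeft, QDiff.z_pow,
      LinearMap.mulLeft_zero_eq_zero, TensorProduct.zero_tmul]
  · rw [Algebra.TensorProduct.tmul_pow, LinearMap.pow_mulLeft, QDiff.D_pow,
      LinearMap.mulLeft_zero_eq_zero, TensorProduct.zero_tmul]
  · rw [Algebra.TensorProduct.tmul_pow, QOdd.zeta_sq, TensorProduct.tmul_zero]
  · rw [Algebra.TensorProduct.tmul_pow, QOdd.delta_sq, TensorProduct.tmul_zero]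
  · rw [Algebra.TensorProduct.tmul_mul_tmul, Algebra.TensorProduct.tmul_mul_tmul, QOdd.delta_zeta,
      TensorProduct.tmul_smul]
  all_goals
    rw [Algebra.TensorProduct.tmul_mul_tmul, Algebra.TensorProduct.tmul_mul_tmul, kinvOp_mulLeft,
      one_mul, mul_one, TensorProduct.smul_tmul']
    first | rw [hz] | rw [hD]
    rw [hl, smul_mul_assoc]
    rfl

/-- The de Rham algebra acts on the tensor product of the two algebras. -/
def toTensor : QDeRham p →ₐ[ℂ] Module.End ℂ (QDiff p) ⊗[ℂ] QOdd p := lift (sat_tensor p)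

/-- Evaluation of the operators at `1`. -/
def evalOne : Module.End ℂ (QDiff p) ⊗[ℂ] QOdd p →ₗ[ℂ] QDiff p ⊗[ℂ] QOdd p :=
  LinearMap.rTensor _ (LinearMap.applyₗ 1)

theorem toTensor_even (x : QDiff p) : toTensor p (even p x) = LinearMap.mulLeft ℂ x ⊗ₜ 1 := by
  have : (toTensor p).comp (even p) =
      Algebra.TensorProduct.includeLeft.comp (Algebra.lmul ℂ (QDiff p)) := by
    apply QDiff.algHom_ext
    · rw [AlgHom.comp_apply, even_z]
      exact lift_z _
    · rw [AlgHom.comp_apply, even_D]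
      exact lift_D _
  exact DFunLike.congr_fun this x

/-- As k⁻¹ fixes 1, the twist attached to ζ and δ becomes invisible after evaluation at 1. -/
theorem evalOne_mul_odd (T : Module.End ℂ (QDiff p) ⊗[ℂ] QOdd p) (b : QOdd p) :
    evalOne p (T * toTensor p (odd p b)) = evalOne p T * (1 ⊗ₜ b) := by
  have hgen : ∀ c : QOdd p, ∀ T, evalOne p (T * (kinvOp p ⊗ₜ c)) = evalOne p T * (1 ⊗ₜ c) := by
    intro c T
    induction T using TensorProduct.induction_on with
    | zero => simp
    | add s t hs ht => rw [add_mul, map_add, hs, ht, map_add, add_mul]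
    | tmul f e => simp [evalOne, kinvOp]
  induction b using QOdd.induction_gen generalizing T with
  | hc c =>
    rw [AlgHom.commutes, AlgHom.commutes, ← Algebra.commutes, ← Algebra.smul_def, map_smul,
      Algebra.algebraMap_eq_smul_one, TensorProduct.tmul_smul, ← Algebra.TensorProduct.one_def,
      mul_smul_comm, mul_one]
  | hzeta =>
    rw [odd_zeta, ← hgen]
    congr 2
    exact lift_zeta _
  | hdelta =>
    rw [odd_delta, ← hgen]
    congr 2
    exact lift_delta _
  | hadd a b ha hb => rw [map_add, map_add, mul_add, map_add, ha, hb, TensorProduct.tmul_add, mul_add]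
  | hmul a b ha hb =>
    rw [map_mul (odd p), map_mul (toTensor p), ← mul_assoc, hb, ha, mul_assoc, Algebra.TensorProduct.tmul_mul_tmul,
      one_mul]

theorem mulMap_tmul (a : QDiff p) (b : QOdd p) : mulMap p (a ⊗ₜ b) = even p a * odd p b := rfl

theorem evalOne_toTensor_mulMap (x : QDiff p ⊗[ℂ] QOdd p) :
    evalOne p (toTensor p (mulMap p x)) = x := by
  induction x using TensorProduct.induction_on with
  | zero => simp
  | add s t hs ht => rw [map_add, map_add, map_add, hs, ht]
  | tmul a b =>
    rw [mulMap_tmul, map_mul, evalOne_mul_odd, toTensor_even]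
    simp [evalOne]

/-- The range contains 1 and is a left ideal: odd generators are moved through the even factor by
the twist k⁻¹. -/
theorem mulMap_surjective : Function.Surjective (mulMap p) := by
  have heven : ∀ (x : QDiff p), ∀ y ∈ LinearMap.range (mulMap p),
      even p x * y ∈ LinearMap.range (mulMap p) := by
    rintro x _ ⟨y, rfl⟩
    induction y using TensorProduct.induction_on with
    | zero => simp
    | add s t hs ht => rw [map_add, mul_add]; exact add_mem hs ht
    | tmul a b => exact ⟨(x * a) ⊗ₜ b, by rw [mulMap_tmul, mulMap_tmul, map_mul, mul_assoc]⟩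
  have hodd : ∀ (c : QOdd p), (∀ x, odd p c * even p x =
      even p ((QDiff.weylData p).kinv x) * odd p c) → ∀ y ∈ LinearMap.range (mulMap p),
      odd p c * y ∈ LinearMap.range (mulMap p) := by
    rintro c hc _ ⟨y, rfl⟩
    induction y using TensorProduct.induction_on with
    | zero => simp
    | add s t hs ht => rw [map_add, mul_add]; exact add_mem hs ht
    | tmul a b =>
      exact ⟨(QDiff.weylData p).kinv a ⊗ₜ (c * b), by
        rw [mulMap_tmul, mulMap_tmul, map_mul, ← mul_assoc, ← hc, mul_assoc]⟩
  have key : ∀ x : QDeRham p, ∀ y ∈ LinearMap.range (mulMap p),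
      x * y ∈ LinearMap.range (mulMap p) := by
    intro x
    induction x using induction_gen with
    | hc c => intro y hy; rw [← Algebra.smul_def]; exact Submodule.smul_mem _ c hy
    | hz => rw [← even_z]; exact heven _
    | hD => rw [← even_D]; exact heven _
    | hzeta => rw [← odd_zeta]; exact hodd _ (by rw [odd_zeta]; exact zeta_mul_even p)
    | hdelta => rw [← odd_delta]; exact hodd _ (by rw [odd_delta]; exact delta_mul_even p)
    | hadd a b ha hb => intro y hy; rw [add_mul]; exact add_mem (ha y hy) (hb y hy)
    | hmul a b ha hb => intro y hy; rw [mul_assoc]; exact ha _ (hb y hy)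
  intro x
  have := key x 1 ⟨1 ⊗ₜ 1, by rw [mulMap_tmul, map_one, map_one, mul_one]⟩
  rwa [mul_one] at this

theorem mulMap_bijective : Function.Bijective (mulMap p) :=
  ⟨Function.LeftInverse.injective (g := fun y => evalOne p (toTensor p y))
    (evalOne_toTensor_mulMap p), mulMap_surjective p⟩

/-- Setting ζ = δ = 0 respects all relations and gives a retraction. -/
theorem even_injective : Function.Injective (even p) := by
  have h : Sat p (QDiff.z p) (QDiff.D p) 0 0 :=
    { D_z := QDiff.D_mul_z p
      z_pow := QDiff.z_pow p
      D_pow := QDiff.D_pow p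
      zeta_sq := by simp
      delta_sq := by simp
      delta_zeta := by simp
      zeta_z := by simp
      delta_D := by simp
      zeta_D := by simp
      delta_z := by simp }
  have h1 : (lift h).comp (even p) = AlgHom.id ℂ _ := by
    apply QDiff.algHom_ext
    · rw [AlgHom.comp_apply, even_z, lift_z]; rfl
    · rw [AlgHom.comp_apply, even_D, lift_D]; rfl
  exact Function.LeftInverse.injective (g := lift h) fun x => DFunLike.congr_fun h1 x

theorem even_smul (u : UqSl2 p) (a : QDiff p) :
    letI := (QDiff.weylData p).module; letI := (weylData p).module
    even p (u • a) = u • even p a := by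
  refine (QDiff.weylData p).map_smul_of_intertwines (weylData p) (even p) (even_z p) (even_D p) ?_ u a
  intro a
  change ((even p).comp (QDiff.scale p (qSqUnit p))) a =
    ((scale p (qSqUnit p) 1).comp (even p)) a
  congr 1
  apply QDiff.algHom_ext <;> simp [even_z, even_D]

theorem isStandardAction : letI := (weylData p).module; IsStandardAction p := by
  have hs := sat_gen p
  have hκ := qRoot_sub_inv_ne_zero p
  -- In Fδ the two factors q² from k⁻¹(δ) and from δ∂ multiply to q⁴.
  have h1 : (qRoot p - (qRoot p)⁻¹)⁻¹ * (1 - qRoot p ^ (4 : ℤ)) =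
    -(qRoot p ^ (2 : ℤ) * qInt p 2) := by simpa using one_sub_qRoot_zpow p 2
  have hq := qInt_mul p 2
  let := (weylData p).module
  refine ⟨?_, ?_, ?_, ?_, ?_, ?_⟩
  · rw [QWeylData.E_smul]
    change _ • (zeta p * z p - z p * scale p _ 1 (zeta p)) = _
    rw [scale_zeta, mul_one, qSqUnit_val, hs.zeta_z, mul_smul_comm, ← sub_smul, smul_smul]
    congr 1
    rw [inv_mul_eq_iff_eq_mul₀ hκ]
    linear_combination hq
  · rw [QWeylData.K_smul]
    change scale p _ 1 (zeta p) = _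
    rw [scale_zeta, mul_one, qSqUnit_val]
  · rw [QWeylData.F_smul]
    change _ • (D p * zeta p - scale p _ 1 (zeta p) * D p) = _
    rw [scale_zeta, mul_one, qSqUnit_inv_val, smul_mul_assoc, hs.zeta_D, smul_smul,
      UqSl2.q_neg_two_mul_two, one_smul, sub_self, smul_zero]
  · rw [QWeylData.E_smul]
    change _ • (delta p * z p - z p * scale p _ 1 (delta p)) = _
    rw [scale_delta, mul_one, qSqUnit_inv_val, hs.delta_z, mul_smul_comm, sub_self, smul_zero]
  · rw [QWeylData.K_smul]
    change scale p _ 1 (delta p) = _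
    rw [scale_delta, mul_one, qSqUnit_inv_val]
  · rw [QWeylData.F_smul]
    change _ • (D p * delta p - scale p _ 1 (delta p) * D p) = _
    rw [scale_delta, mul_one, inv_inv, qSqUnit_val, smul_mul_assoc, hs.delta_D, smul_smul,
      ← zpow_add₀ (qRoot_ne_zero p), ← h1, show (2 : ℤ) + 2 = 4 by norm_num]
    module

end QDeRham

/-! ### The Casimir element -/

namespace UqSl2

set_option linter.unusedSectionVars false

variable (p : ℕ) [hp2 : Fact (2 ≤ p)]

/-- The Casimir element `F E + (q K + q⁻¹ K⁻¹) / (q - q⁻¹)²`. -/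
def casimir : UqSl2 p := F p * E p +
  ((qRoot p - (qRoot p)⁻¹)⁻¹ ^ 2) • (qRoot p • K p + (qRoot p)⁻¹ • Kinv p)

theorem casimir_eq : casimir p = E p * F p +
    ((qRoot p - (qRoot p)⁻¹)⁻¹ ^ 2) • ((qRoot p)⁻¹ • K p + qRoot p • Kinv p) := by
  have h : E p * F p = F p * E p + (qRoot p - (qRoot p)⁻¹)⁻¹ • (K p - Kinv p) := by
    rw [← EF_sub]; abel
  have hκ := inv_mul_cancel₀ (qRoot_sub_inv_ne_zero p)
  have h2 : (qRoot p - (qRoot p)⁻¹)⁻¹ =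
      (qRoot p - (qRoot p)⁻¹)⁻¹ ^ 2 * (qRoot p - (qRoot p)⁻¹) := by
    rw [pow_two, mul_assoc, hκ, mul_one]
  rw [casimir, h]
  nth_rewrite 2 [h2]
  module

theorem K_comm_FE : K p * (F p * E p) = F p * E p * K p := by
  rw [← mul_assoc, K_mul_F, smul_mul_assoc, mul_assoc, K_mul_E, mul_smul_comm, smul_smul,
    q_neg_two_mul_two, one_smul, mul_assoc]

/-- To commute with E, the form with EF is used on one side and the form with FE on the other, so
that both produce EFE; the K-parts agree after q² is moved across. F is treated in the same way. -/
theorem casimir_comm (u : UqSl2 p) : Commute (casimir p) u := by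
  have hq := qRoot_ne_zero p
  have e1 : (qRoot p)⁻¹ * qRoot p ^ (2 : ℤ) = qRoot p := by
    rw [zpow_two, inv_mul_cancel_left₀ hq]
  have e2 : qRoot p * qRoot p ^ (-2 : ℤ) = (qRoot p)⁻¹ := by
    rw [zpow_neg, zpow_two, mul_inv, mul_inv_cancel_left₀ hq]
  induction u using induction_gen with
  | hc c => exact (Algebra.commutes c _).symm
  | hE =>
    change casimir p * E p = E p * casimir p
    nth_rewrite 1 [casimir_eq]
    rw [casimir]
    simp only [add_mul, mul_add, smul_mul_assoc, mul_smul_comm, K_mul_E, Kinv_mul_E, smul_smul,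
      e1, e2, mul_assoc]
  | hK =>
    change casimir p * K p = K p * casimir p
    rw [casimir, mul_add, K_comm_FE]
    simp only [add_mul, mul_add, smul_mul_assoc, mul_smul_comm, K_mul_Kinv, Kinv_mul_K]
  | hF =>
    change casimir p * F p = F p * casimir p
    nth_rewrite 2 [casimir_eq]
    rw [casimir]
    simp only [add_mul, mul_add, smul_mul_assoc, mul_smul_comm, K_mul_F, Kinv_mul_F, smul_smul,
      e1, e2, mul_assoc]
  | hadd a b ha hb => exact ha.add_right hb
  | hmul a b ha hb => exact ha.mul_right hb

/-- The value of the Casimir element on `X⁺_r`. -/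
def casimirValue (r : ℤ) : ℂ :=
  (qRoot p - (qRoot p)⁻¹)⁻¹ ^ 2 * (qRoot p ^ r + qRoot p ^ (-r))

/-! ### Weight vectors -/

section weights
variable {p} {M : Type*} [AddCommGroup M] [Module ℂ M] [Module (UqSl2 p) M]
  [IsScalarTower ℂ (UqSl2 p) M]

theorem smul_smul_comm' (u : UqSl2 p) (c : ℂ) (x : M) : u • c • x = c • u • x :=
  (smul_comm c u x).symm

theorem Kinv_smul_of_weight {x : M} {a : ℂ} (ha : a ≠ 0) (hx : K p • x = a • x) :
    Kinv p • x = a⁻¹ • x := by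
  have h : x = a • Kinv p • x := by
    rw [← smul_smul_comm', ← hx, ← mul_smul, Kinv_mul_K, one_smul]
  nth_rewrite 2 [h]
  rw [smul_smul, inv_mul_cancel₀ ha, one_smul]

theorem K_smul_E_smul {x : M} {a : ℂ} (hx : K p • x = a • x) :
    K p • E p • x = (qRoot p ^ (2 : ℤ) * a) • E p • x := by
  rw [← mul_smul, K_mul_E, smul_assoc, mul_smul, hx, smul_smul_comm', smul_smul]

theorem K_smul_F_smul {x : M} {a : ℂ} (hx : K p • x = a • x) :
    K p • F p • x = (qRoot p ^ (-2 : ℤ) * a) • F p • x := by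
  rw [← mul_smul, K_mul_F, smul_assoc, mul_smul, hx, smul_smul_comm', smul_smul]

theorem K_smul_E_pow_smul {x : M} {n : ℤ} (hx : K p • x = (qRoot p ^ n) • x) (b : ℕ) :
    K p • E p ^ b • x = (qRoot p ^ (n + 2 * b)) • E p ^ b • x := by
  induction b with
  | zero => simpa using hx
  | succ b ih =>
    rw [pow_succ', mul_smul, K_smul_E_smul ih, ← zpow_add₀ (qRoot_ne_zero p)]
    congr 2
    push_cast
    ring

theorem K_smul_F_pow_smul {x : M} {n : ℤ} (hx : K p • x = (qRoot p ^ n) • x) (a : ℕ) :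
    K p • F p ^ a • x = (qRoot p ^ (n - 2 * a)) • F p ^ a • x := by
  induction a with
  | zero => simpa using hx
  | succ b ih =>
    rw [pow_succ', mul_smul, K_smul_F_smul ih, ← zpow_add₀ (qRoot_ne_zero p)]
    congr 2
    push_cast
    ring

theorem K_smul_monomial {v : M} (hv : K p • v = v) (b a : ℕ) :
    K p • E p ^ b • F p ^ a • v = (qRoot p ^ (2 * ((b : ℤ) - a))) • E p ^ b • F p ^ a • v := by
  have h0 : K p • v = (qRoot p ^ (0 : ℤ)) • v := by rw [zpow_zero, one_smul, hv]
  rw [K_smul_E_pow_smul (K_smul_F_pow_smul h0 a)]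
  congr 2
  ring

theorem casimir_smul_of_E_smul_eq_zero {x : M} {n : ℤ} (hx : K p • x = (qRoot p ^ n) • x)
    (hE : E p • x = 0) : casimir p • x = casimirValue p (n + 1) • x := by
  have hq := qRoot_ne_zero p
  rw [casimir, add_smul, mul_smul, hE, smul_zero, zero_add, smul_assoc, add_smul, smul_assoc,
    smul_assoc, hx, Kinv_smul_of_weight (zpow_ne_zero _ hq) hx, casimirValue, zpow_add_one₀ hq,
    neg_add, zpow_add₀ hq, zpow_neg_one, zpow_neg]
  module

variable (p) in
-- On a weight vector the K-part of the Casimir element is a scalar, so EF differs from a central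
-- element by a number.
theorem E_F_smul_of_weight {x : M} {n : ℤ} (hx : K p • x = (qRoot p ^ n) • x) :
    E p • F p • x = casimir p • x - casimirValue p (n - 1) • x := by
  have hq := qRoot_ne_zero p
  rw [casimir_eq, add_smul, mul_smul, smul_assoc _ (_ + _), add_smul, smul_assoc,
    smul_assoc, hx, Kinv_smul_of_weight (zpow_ne_zero _ hq) hx, casimirValue, zpow_sub_one₀ hq,
    neg_sub, sub_eq_add_neg 1, zpow_add₀ hq, zpow_one, zpow_neg]
  generalize E p • F p • x = y
  module

/-- The span of the vectors `E^b F^a v`. -/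
def monomialSpan (v : M) : Submodule ℂ M :=
  Submodule.span ℂ (Set.range fun ba : Fin p × Fin p => E p ^ (ba.1 : ℕ) • F p ^ (ba.2 : ℕ) • v)

theorem monomial_mem (v : M) (b a : ℕ) : E p ^ b • F p ^ a • v ∈ monomialSpan (p := p) v := by
  by_cases hb : b < p
  · by_cases ha : a < p
    · exact Submodule.subset_span ⟨(⟨b, hb⟩, ⟨a, ha⟩), rfl⟩
    · rw [← Nat.add_sub_of_le (not_lt.mp ha), pow_add, (sat_gen p).F_pow, zero_mul, zero_smul,
        smul_zero]
      exact zero_mem _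
  · rw [← Nat.add_sub_of_le (not_lt.mp hb), pow_add, (sat_gen p).E_pow, zero_mul, zero_smul]
    exact zero_mem _

theorem smul_mem_monomialSpan_of_forall {v : M} {u : UqSl2 p}
    (h : ∀ b a : ℕ, u • E p ^ b • F p ^ a • v ∈ monomialSpan (p := p) v) {y : M}
    (hy : y ∈ monomialSpan (p := p) v) : u • y ∈ monomialSpan (p := p) v := by
  induction hy using Submodule.span_induction with
  | mem y hy =>
    obtain ⟨⟨b, a⟩, rfl⟩ := hy
    exact h b a
  | zero => rw [smul_zero]; exact zero_mem _
  | add y y' _ _ h h' => rw [smul_add]; exact add_mem h h'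
  | smul c y _ h => rw [smul_smul_comm']; exact Submodule.smul_mem _ c h

/-- The spanning half of a PBW theorem for U modulo K = 1 on `v`: only E and F remain, and they can
be ordered. -/
theorem smul_mem_monomialSpan {v : M} (hv : K p • v = v) (u : UqSl2 p) {y : M}
    (hy : y ∈ monomialSpan (p := p) v) : u • y ∈ monomialSpan (p := p) v := by
  have hE : ∀ y ∈ monomialSpan (p := p) v, E p • y ∈ monomialSpan (p := p) v := fun y hy =>
    smul_mem_monomialSpan_of_forall (fun b a => by
      rw [← mul_smul, ← pow_succ']; exact monomial_mem v _ _) hy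
  induction u using induction_gen generalizing y with
  | hc c => rw [algebraMap_smul]; exact Submodule.smul_mem _ c hy
  | hE => exact hE y hy
  | hK =>
    refine smul_mem_monomialSpan_of_forall (fun b a => ?_) hy
    rw [K_smul_monomial hv]
    exact Submodule.smul_mem _ _ (monomial_mem v b a)
  | hF =>
    refine smul_mem_monomialSpan_of_forall (fun b a => ?_) hy
    induction b with
    | zero =>
      rw [pow_zero, one_smul, ← mul_smul, ← pow_succ']
      simpa using monomial_mem v 0 (a + 1)
    | succ b ih =>
      -- Moving F past one E costs a multiple of K − K⁻¹, which acts on the weight vector E^bF^a v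
      -- by a scalar.
      have h : F p * E p = E p * F p - (qRoot p - (qRoot p)⁻¹)⁻¹ • (K p - Kinv p) := by
        rw [← EF_sub]; abel
      have hk := K_smul_monomial hv b a
      rw [pow_succ', mul_smul, ← mul_smul (F p), h, sub_smul, mul_smul, smul_assoc, sub_smul, hk,
        Kinv_smul_of_weight (zpow_ne_zero _ (qRoot_ne_zero p)) hk]
      exact sub_mem (hE _ ih) (Submodule.smul_mem _ _ (sub_mem
        (Submodule.smul_mem _ _ (monomial_mem v b a))
        (Submodule.smul_mem _ _ (monomial_mem v b a))))
  | hadd a b ha hb => rw [add_smul]; exact add_mem (ha hy) (hb hy)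
  | hmul a b ha hb => rw [mul_smul]; exact ha (hb hy)

theorem smul_self_mem_monomialSpan {v : M} (hv : K p • v = v) (u : UqSl2 p) :
    u • v ∈ monomialSpan (p := p) v :=
  smul_mem_monomialSpan hv u (by simpa using monomial_mem v 0 0)

end weights

/-! ### The projector to weight zero -/

/-- The idempotent that projects to the vectors fixed by `K`. -/
def weightZero : UqSl2 p := ((2 * p : ℂ)⁻¹) • ∑ j ∈ Finset.range (2 * p), K p ^ j

theorem K_mul_weightZero : K p * weightZero p = weightZero p := by
  rw [weightZero, mul_smul_comm, Finset.mul_sum]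
  congr 1
  simp only [← pow_succ']
  have h1 := Finset.sum_range_succ (fun j => K p ^ j) (2 * p)
  have h2 := Finset.sum_range_succ' (fun j => K p ^ j) (2 * p)
  rw [h1, (sat_gen p).K_pow, pow_zero] at h2
  exact (add_right_cancel h2).symm

section weightZero
variable {p} {M : Type*} [AddCommGroup M] [Module ℂ M] [Module (UqSl2 p) M]
  [IsScalarTower ℂ (UqSl2 p) M]

theorem K_smul_weightZero_smul (x : M) : K p • weightZero p • x = weightZero p • x := by
  rw [← mul_smul, K_mul_weightZero]

theorem weightZero_smul_of_weight {x : M} {a : ℂ} (hx : K p • x = a • x) :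
    weightZero p • x = ((2 * p : ℂ)⁻¹ * ∑ j ∈ Finset.range (2 * p), a ^ j) • x := by
  have h : ∀ j : ℕ, K p ^ j • x = a ^ j • x := by
    intro j
    induction j with
    | zero => simp
    | succ j ih => rw [pow_succ', mul_smul, ih, smul_smul_comm', hx, smul_smul, pow_succ]
  rw [weightZero, smul_assoc, Finset.sum_smul, mul_smul, Finset.sum_smul]
  simp only [h]

theorem weightZero_smul_of_K_smul_eq {x : M} (hx : K p • x = x) : weightZero p • x = x := by
  have hp : (p : ℂ) ≠ 0 := by exact_mod_cast p_ne_zero p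
  have h : (2 * p : ℂ) ≠ 0 := mul_ne_zero two_ne_zero hp
  rw [weightZero_smul_of_weight (a := 1) (by rw [hx, one_smul])]
  simp only [one_pow, Finset.sum_const, Finset.card_range, nsmul_eq_mul, mul_one, Nat.cast_mul,
    Nat.cast_ofNat, inv_mul_cancel₀ h, one_smul]

/-- The projection of `x` is a multiple of `x`, hence scaled by `a` under K, but it is also fixed by
K. -/
theorem weightZero_smul_of_weight_ne {x : M} {a : ℂ} (ha : a ≠ 1) (hx : K p • x = a • x) :
    weightZero p • x = 0 := by
  have h := weightZero_smul_of_weight hx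
  have h2 := K_smul_weightZero_smul (p := p) x
  rw [h, smul_smul_comm', hx, smul_comm, ← h] at h2
  have h3 : (a - 1) • weightZero p • x = 0 := by rw [sub_smul, one_smul, h2, sub_self]
  exact (smul_eq_zero.mp h3).resolve_left (sub_ne_zero.mpr ha)

/-- In a module generated by a K-fixed vector, only the E^aF^a v contribute to weight zero, and each
of them is a polynomial in the Casimir element applied to v, peeled off one factor EF at a time. So
the weight-zero part is cyclic over a commutative polynomial ring. -/
theorem exists_aeval_casimir_smul {v : M} (hv : K p • v = v)
    (hgen : ∀ x : M, ∃ u : UqSl2 p, u • v = x) {w : M} (hw : K p • w = w) :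
    ∃ g : Polynomial ℂ, w = Polynomial.aeval (casimir p) g • v := by
  have hdiag : ∀ a : ℕ, ∃ g : Polynomial ℂ,
      E p ^ a • F p ^ a • v = Polynomial.aeval (casimir p) g • v := by
    intro a
    induction a with
    | zero => exact ⟨1, by simp⟩
    | succ a ih =>
      obtain ⟨g, hg⟩ := ih
      have h0 : K p • v = (qRoot p ^ (0 : ℤ)) • v := by rw [zpow_zero, one_smul, hv]
      have hF := K_smul_F_pow_smul h0 a
      -- The vector F^a v has weight q^{−2a}, on which EF is the Casimir element minus this value.
      refine ⟨(Polynomial.X - Polynomial.C (casimirValue p (0 - 2 * (a : ℤ) - 1))) * g, ?_⟩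
      rw [pow_succ, pow_succ' (F p), mul_smul, mul_smul, E_F_smul_of_weight p hF, smul_sub,
        ← mul_smul _ (casimir p), ((casimir_comm p _).eq).symm, mul_smul, hg, smul_smul_comm', hg,
        map_mul, mul_smul, map_sub, Polynomial.aeval_X, Polynomial.aeval_C, sub_smul,
        algebraMap_smul]
  have key : ∀ y ∈ monomialSpan (p := p) v, ∃ g : Polynomial ℂ,
      weightZero p • y = Polynomial.aeval (casimir p) g • v := by
    intro y hy
    induction hy using Submodule.span_induction with
    | mem y hy =>
      obtain ⟨⟨b, a⟩, rfl⟩ := hy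
      have hk := K_smul_monomial hv (b : ℕ) (a : ℕ)
      by_cases hab : b = a
      · subst hab
        rw [weightZero_smul_of_K_smul_eq]
        · exact hdiag b
        · rw [hk, sub_self, mul_zero, zpow_zero, one_smul]
      · refine ⟨0, ?_⟩
        rw [map_zero, zero_smul, weightZero_smul_of_weight_ne _ hk]
        rw [Ne, qRoot_zpow_eq_one_iff]
        -- Weight zero means 2p ∣ 2(b − a); as 0 ≤ a, b < p, this forces a = b.
        rintro ⟨k, hk⟩
        have h1 : (b : ℤ) - a = p * k := by linarith
        have h2 := b.2
        have h3 := a.2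
        have h4 : (p : ℤ) ∣ (b : ℤ) - a := ⟨k, h1⟩
        have h5 := Int.eq_zero_of_abs_lt_dvd h4 (by rw [abs_lt]; constructor <;> omega)
        exact hab (Fin.ext (by omega))
    | zero => exact ⟨0, by simp⟩
    | add y y' _ _ h h' =>
      obtain ⟨g, hg⟩ := h
      obtain ⟨g', hg'⟩ := h'
      exact ⟨g + g', by rw [smul_add, hg, hg', map_add, add_smul]⟩
    | smul c y _ h =>
      obtain ⟨g, hg⟩ := h
      exact ⟨c • g, by rw [smul_smul_comm', hg, map_smul, smul_assoc]⟩
  obtain ⟨u, hu⟩ := hgen w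
  obtain ⟨g, hg⟩ := key (u • v) (smul_self_mem_monomialSpan hv u)
  exact ⟨g, by rw [← hg, hu, weightZero_smul_of_K_smul_eq hw]⟩

end weightZero

end UqSl2

/-! ### Modules of dimension p² generated in weight zero, and Casimir eigenspaces. -/

namespace UqSl2

set_option linter.unusedSectionVars false

/-- A generator of weight zero of a module of dimension `p²`. -/
structure IsWeightZeroGenerator (p : ℕ) {M : Type*} [AddCommGroup M] [Module ℂ M]
    [Module (UqSl2 p) M] (v : M) : Prop where
  K_smul : K p • v = v
  exists_smul : ∀ x : M, ∃ u : UqSl2 p, u • v = x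
  finrank_eq : Module.finrank ℂ M = p * p

section
variable {p : ℕ} [hp2 : Fact (2 ≤ p)] {M : Type*} [AddCommGroup M] [Module ℂ M]
  [Module (UqSl2 p) M] [IsScalarTower ℂ (UqSl2 p) M]

namespace IsWeightZeroGenerator
variable {v : M} (hv : IsWeightZeroGenerator p v)
include hv

theorem monomialSpan_eq_top : monomialSpan (p := p) v = ⊤ :=
  eq_top_iff.mpr fun x _ => by
    obtain ⟨u, rfl⟩ := hv.exists_smul x
    exact smul_self_mem_monomialSpan hv.K_smul u

theorem finiteDimensional : FiniteDimensional ℂ M :=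
  ⟨by rw [← hv.monomialSpan_eq_top]; exact Submodule.fg_span (Set.finite_range _)⟩

theorem linearIndependent : LinearIndependent ℂ
    (fun ba : Fin p × Fin p => E p ^ (ba.1 : ℕ) • F p ^ (ba.2 : ℕ) • v) :=
  linearIndependent_of_top_le_span_of_card_eq_finrank hv.monomialSpan_eq_top.ge
    (by rw [hv.finrank_eq, Fintype.card_prod, Fintype.card_fin])

/-- Write u times the projector e in terms of the E^bF^a e. Applied to v, the same coefficients
express uv = 0 in the independent vectors E^bF^a v, so they vanish. -/
theorem mul_weightZero_eq_zero {u : UqSl2 p} (hu : u • v = 0) : u * weightZero p = 0 := by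
  have h := smul_self_mem_monomialSpan (v := weightZero p) (K_mul_weightZero p) u
  obtain ⟨c, hc⟩ := (Submodule.mem_span_range_iff_exists_fun ℂ).mp h
  have h2 : u • v = ∑ ba : Fin p × Fin p, c ba • E p ^ (ba.1 : ℕ) • F p ^ (ba.2 : ℕ) • v := by
    have hw := weightZero_smul_of_K_smul_eq hv.K_smul
    calc u • v = (u • weightZero p) • v := by rw [smul_eq_mul, mul_smul, hw]
      _ = _ := by
        rw [← hc, Finset.sum_smul]
        simp only [smul_assoc, hw]
  rw [hu] at h2
  have h3 := Fintype.linearIndependent_iff.mp hv.linearIndependent c h2.symm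
  rw [← smul_eq_mul, ← hc]
  exact Finset.sum_eq_zero fun ba _ => by rw [h3 ba, zero_smul]

/-- The homomorphism from a module with a generator of weight zero to `U` that takes `u v`
to `u` times the projector to weight zero. -/
theorem exists_section : ∃ s : M →ₗ[UqSl2 p] UqSl2 p, ∀ u, s (u • v) = u * weightZero p := by
  have hsurj : Function.Surjective (LinearMap.toSpanSingleton (UqSl2 p) M v) := fun x => by
    obtain ⟨u, hu⟩ := hv.exists_smul x
    exact ⟨u, hu⟩
  let e := (LinearMap.toSpanSingleton (UqSl2 p) M v).quotKerEquivOfSurjective hsurj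
  let f := (LinearMap.ker (LinearMap.toSpanSingleton (UqSl2 p) M v)).liftQ
    (LinearMap.toSpanSingleton (UqSl2 p) (UqSl2 p) (weightZero p))
    (fun u hu => hv.mul_weightZero_eq_zero hu)
  refine ⟨f ∘ₗ e.symm.toLinearMap, fun u => ?_⟩
  have : e.symm (u • v) = Submodule.Quotient.mk u := by
    rw [LinearEquiv.symm_apply_eq]
    rfl
  rw [LinearMap.comp_apply, LinearEquiv.coe_coe, this]
  rfl

/-- The section sends v to the projector onto weight zero, and u ↦ uv sends it back to v, so M is a
retract of U. -/
theorem projective : Module.Projective (UqSl2 p) M := by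
  obtain ⟨s, hs⟩ := hv.exists_section
  refine Module.Projective.of_split s (LinearMap.toSpanSingleton (UqSl2 p) M v) ?_
  ext x
  obtain ⟨u, rfl⟩ := hv.exists_smul x
  rw [LinearMap.comp_apply, hs, LinearMap.toSpanSingleton_apply, mul_smul,
    weightZero_smul_of_K_smul_eq hv.K_smul]
  rfl

/-- Composition M → U → X: v goes to the projector e, and then to ex = x. -/
theorem exists_hom {X : Type*} [AddCommGroup X] [Module ℂ X] [Module (UqSl2 p) X]
    [IsScalarTower ℂ (UqSl2 p) X] {x : X} (hx : K p • x = x) :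
    ∃ φ : M →ₗ[UqSl2 p] X, φ v = x := by
  obtain ⟨s, hs⟩ := hv.exists_section
  refine ⟨LinearMap.toSpanSingleton (UqSl2 p) X x ∘ₗ s, ?_⟩
  rw [LinearMap.comp_apply]
  nth_rewrite 1 [← one_smul (UqSl2 p) v]
  rw [hs, one_mul, LinearMap.toSpanSingleton_apply, weightZero_smul_of_K_smul_eq hx]

/-- All weights are even powers of q, since v has weight zero and E, F shift weights by q^{±2}. -/
theorem K_pow_smul (x : M) : K p ^ p • x = x := by
  have hx : x ∈ monomialSpan (p := p) v := by rw [hv.monomialSpan_eq_top]; trivial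
  induction hx using Submodule.span_induction with
  | mem y hy =>
    obtain ⟨⟨b, a⟩, rfl⟩ := hy
    have h : ∀ n : ℕ, K p ^ n • E p ^ (b : ℕ) • F p ^ (a : ℕ) • v =
        ((qRoot p ^ (2 * ((b : ℤ) - a))) ^ n) • E p ^ (b : ℕ) • F p ^ (a : ℕ) • v := by
      intro n
      induction n with
      | zero => simp
      | succ n ih =>
        rw [pow_succ', mul_smul, ih, smul_smul_comm', K_smul_monomial hv.K_smul, smul_smul,
          pow_succ]
    have h1 : (qRoot p ^ (2 * ((b : ℤ) - a))) ^ p = 1 := by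
      rw [← zpow_natCast, ← zpow_mul, qRoot_zpow_eq_one_iff]
      exact ⟨b - a, by ring⟩
    rw [h, h1, one_smul]
  | zero => rw [smul_zero]
  | add y y' _ _ h h' => rw [smul_add, h, h']
  | smul c y _ h => rw [smul_smul_comm', h]

end IsWeightZeroGenerator

/-! ### Generalized eigenspaces of the Casimir element -/

variable (p M) in
/-- The operator of the Casimir element. -/
def casimirOp : Module.End ℂ M := Algebra.lsmul ℂ ℂ M (casimir p)

theorem casimirOp_apply (x : M) : casimirOp p M x = casimir p • x := rfl

variable (p M) in
/-- A generalized eigenspace of the Casimir element. -/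
def casimirSubmodule (c : ℂ) : Submodule (UqSl2 p) M where
  carrier := (casimirOp p M).maxGenEigenspace c
  add_mem' := add_mem
  zero_mem' := zero_mem _
  smul_mem' u x hx := by
    refine Module.End.mapsTo_maxGenEigenspace_of_comm (f := casimirOp p M)
      (g := Algebra.lsmul ℂ ℂ M u) ?_ c hx
    exact (casimir_comm p u).map (Algebra.lsmul ℂ ℂ M)

theorem mem_casimirSubmodule {c : ℂ} {x : M} :
    x ∈ casimirSubmodule p M c ↔ ∃ k : ℕ, (casimir p - algebraMap ℂ _ c) ^ k • x = 0 := by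
  change x ∈ (casimirOp p M).maxGenEigenspace c ↔ _
  rw [Module.End.mem_maxGenEigenspace]
  refine exists_congr fun k => ?_
  have : casimirOp p M - c • 1 = Algebra.lsmul ℂ ℂ M (casimir p - algebraMap ℂ _ c) := by
    rw [map_sub, AlgHom.commutes, Algebra.algebraMap_eq_smul_one]; rfl
  rw [this, ← map_pow]
  rfl

theorem mem_casimirSubmodule_map {M' : Type*} [AddCommGroup M'] [Module ℂ M']
    [Module (UqSl2 p) M'] [IsScalarTower ℂ (UqSl2 p) M'] (e : M ≃ₗ[UqSl2 p] M') {c : ℂ} {x : M} :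
    e x ∈ casimirSubmodule p M' c ↔ x ∈ casimirSubmodule p M c := by
  rw [mem_casimirSubmodule, mem_casimirSubmodule]
  refine exists_congr fun k => ?_
  rw [← map_smul, LinearEquiv.map_eq_zero_iff]

theorem aeval_casimir_smul {X : Type*} [AddCommGroup X] [Module ℂ X] [Module (UqSl2 p) X]
    [IsScalarTower ℂ (UqSl2 p) X] {x : X} {c : ℂ} (hx : casimir p • x = c • x)
    (g : Polynomial ℂ) : Polynomial.aeval (casimir p) g • x = g.eval c • x := by
  induction g using Polynomial.induction_on' with
  | add f g hf hg => rw [map_add, add_smul, hf, hg, Polynomial.eval_add, add_smul]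
  | monomial n a =>
    have h : ∀ n : ℕ, casimir p ^ n • x = c ^ n • x := by
      intro n
      induction n with
      | zero => simp
      | succ n ih => rw [pow_succ', mul_smul, ih, smul_smul_comm', hx, smul_smul, pow_succ]
    rw [Polynomial.aeval_monomial, mul_smul, h, algebraMap_smul, Polynomial.eval_monomial,
      mul_smul]

theorem aeval_casimir_comm (g : Polynomial ℂ) (u : UqSl2 p) :
    Commute (Polynomial.aeval (casimir p) g) u := by
  have := (casimir_comm p u)
  induction g using Polynomial.induction_on' with
  | add f g hf hg => rw [map_add]; exact hf.add_left hg
  | monomial n a =>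
    rw [Polynomial.aeval_monomial]
    exact Commute.mul_left (Algebra.commutes a u) (this.pow_left n)

/-- Write w = g(C)v. Applying φ shows g(c) ≠ 0, so g is coprime to (x − c)^k, and on a vector killed
by (C − c)^k a Bézout relation inverts g(C). Hence y = uv in the generalized eigenspace equals
a(C)u·w, because C is central. -/
theorem casimirSubmodule_le_span {v : M} (hv : IsWeightZeroGenerator p v)
    {X : Type*} [AddCommGroup X] [Module ℂ X] [Module (UqSl2 p) X]
    [IsScalarTower ℂ (UqSl2 p) X] (φ : M →ₗ[UqSl2 p] X) {c : ℂ}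
    (hc : casimir p • φ v = c • φ v) {w : M} (hw : K p • w = w) (hφ : φ w ≠ 0) :
    casimirSubmodule p M c ≤ Submodule.span (UqSl2 p) {w} := by
  obtain ⟨g, rfl⟩ := exists_aeval_casimir_smul hv.K_smul hv.exists_smul hw
  have hg : g.eval c ≠ 0 := by
    intro h
    rw [map_smul, aeval_casimir_smul hc, h, zero_smul] at hφ
    exact hφ rfl
  intro y hy
  obtain ⟨k, hk⟩ := mem_casimirSubmodule.mp hy
  have hcop : IsCoprime g ((Polynomial.X - Polynomial.C c) ^ k) := by
    refine IsCoprime.pow_right (IsCoprime.symm ?_)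
    rw [(Polynomial.irreducible_X_sub_C c).coprime_iff_not_dvd, Polynomial.dvd_iff_isRoot]
    exact hg
  obtain ⟨a, b, hab⟩ := hcop
  obtain ⟨u, rfl⟩ := hv.exists_smul y
  have h1 : u • v = (Polynomial.aeval (casimir p) a * u) •
      Polynomial.aeval (casimir p) g • v := by
    calc u • v = Polynomial.aeval (casimir p) (a * g + b * (Polynomial.X - Polynomial.C c) ^ k) •
          u • v := by rw [hab, map_one, one_smul]
      _ = (Polynomial.aeval (casimir p) a * Polynomial.aeval (casimir p) g) • u • v := by
        rw [map_add, add_smul, map_mul _ b, mul_smul, map_pow, map_sub, Polynomial.aeval_X,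
          Polynomial.aeval_C, hk, smul_zero, add_zero, map_mul]
      _ = _ := by
        rw [← mul_smul, ← mul_smul, mul_assoc, (aeval_casimir_comm g u).eq, mul_assoc]
  rw [h1]
  exact Submodule.smul_mem _ _ (Submodule.mem_span_singleton_self _)

end

/-! ### The values of the Casimir element. -/

section values
variable (p : ℕ) [hp2 : Fact (2 ≤ p)]

theorem casimirValue_neg (n : ℤ) : casimirValue p (-n) = casimirValue p n := by
  rw [casimirValue, casimirValue, neg_neg, add_comm]

theorem casimirValue_add (n k : ℤ) : casimirValue p (n + 2 * p * k) = casimirValue p n := by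
  have h : qRoot p ^ (2 * p * k) = 1 := (qRoot_zpow_eq_one_iff p _).mpr ⟨k, rfl⟩
  rw [casimirValue, casimirValue, neg_add, zpow_add₀ (qRoot_ne_zero p),
    zpow_add₀ (qRoot_ne_zero p), zpow_neg _ (2 * p * k), h, inv_one, mul_one, mul_one]

/-- The value depends on n only modulo 2p and up to sign. Reducing m modulo p puts 2m + 1 between 1
and 2p − 1, and a number above p is reflected to 2p minus itself, which is odd again. -/
theorem exists_oddIndex (m : ℤ) : ∃ r : OddIndex p, casimirValue p (2 * m + 1) =
    casimirValue p (r : ℕ) := by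
  have hp := hp2.out
  have h0 := Int.emod_nonneg m (show (p : ℤ) ≠ 0 by omega)
  have h1 := Int.emod_lt_of_pos m (show (0 : ℤ) < p by omega)
  have h2 : casimirValue p (2 * m + 1) = casimirValue p (2 * (m % p) + 1) := by
    rw [← casimirValue_add p (2 * (m % p) + 1) (m / p)]
    congr 1
    have := Int.emod_add_mul_ediv m p
    linarith
  -- For even p the bound is p − 1, and an odd number cannot equal p.
  have hnu : ∀ r : ℕ, Odd r → r ≤ p → r ≤ nu p := by
    intro r hr hle
    unfold nu
    split_ifs with h
    · exact hle
    · have : r ≠ p := fun h' => h (h' ▸ hr)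
      omega
  obtain ⟨s, hs⟩ := Int.eq_ofNat_of_zero_le h0
  rw [h2, hs]
  by_cases h : 2 * s + 1 ≤ p
  · have ho : Odd (2 * s + 1) := ⟨s, rfl⟩
    exact ⟨⟨2 * s + 1, ho, hnu _ ho h⟩, by push_cast; rfl⟩
  · have ho : Odd (2 * p - (2 * s + 1)) := ⟨p - s - 1, by omega⟩
    refine ⟨⟨2 * p - (2 * s + 1), ho, hnu _ ho (by omega)⟩, ?_⟩
    rw [← casimirValue_neg, ← casimirValue_add p _ 1]
    congr 1
    simp only
    omega

/-- Equality of two values factors as (q^{r−s} − 1)(q^{r+s} − 1) = 0, so 2p divides r − s or r + s.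
As 1 ≤ r, s ≤ p, the second case forces r = s = p. -/
theorem casimirValue_injective :
    Function.Injective fun r : OddIndex p => casimirValue p ((r : ℕ) : ℤ) := by
  intro r s h
  have hq := qRoot_ne_zero p
  have hκ := pow_ne_zero 2 (inv_ne_zero (qRoot_sub_inv_ne_zero p))
  have hr := r.2.2.trans (nu_le p)
  have hs := s.2.2.trans (nu_le p)
  have hr0 := r.2.1.pos
  have hs0 := s.2.1.pos
  have h1 := mul_left_cancel₀ hκ h
  have h2 : (qRoot p ^ (((r : ℕ) : ℤ) - (s : ℕ)) - 1) * (qRoot p ^ (((r : ℕ) : ℤ) + (s : ℕ)) - 1) =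
      0 := by
    rw [zpow_neg, zpow_neg] at h1
    rw [zpow_sub₀ hq, zpow_add₀ hq]
    have hr' := zpow_ne_zero ((r : ℕ) : ℤ) hq
    have hs' := zpow_ne_zero ((s : ℕ) : ℤ) hq
    generalize qRoot p ^ ((r : ℕ) : ℤ) = a at *
    generalize qRoot p ^ ((s : ℕ) : ℤ) = b at *
    field_simp at h1 ⊢
    linear_combination h1
  apply Subtype.ext
  rcases mul_eq_zero.mp h2 with h3 | h3
  · have := (qRoot_zpow_eq_one_iff p _).mp (sub_eq_zero.mp h3)
    have := Int.eq_zero_of_abs_lt_dvd this (by rw [abs_lt]; constructor <;> omega)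
    omega
  · have := Int.le_of_dvd (by omega) ((qRoot_zpow_eq_one_iff p _).mp (sub_eq_zero.mp h3))
    omega

end values

/-! ### Eigenvalues of the Casimir element. -/

section decomposition
variable {p : ℕ} [hp2 : Fact (2 ≤ p)] {M : Type*} [AddCommGroup M] [Module ℂ M]
  [Module (UqSl2 p) M] [IsScalarTower ℂ (UqSl2 p) M] {v : M}

/-- K preserves a Casimir eigenspace, so a joint eigenvector exists. Raising it by E as far as
possible gives a highest weight vector in the same eigenspace, where the eigenvalue is determined by
the weight. -/
theorem IsWeightZeroGenerator.exists_of_hasEigenvalue (hv : IsWeightZeroGenerator p v) {c : ℂ}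
    (hc : (casimirOp p M).HasEigenvalue c) : ∃ r : OddIndex p, c = casimirValue p (r : ℕ) := by
  have := hv.finiteDimensional
  have hstab : ∀ x ∈ (casimirOp p M).eigenspace c,
      Algebra.lsmul ℂ ℂ M (K p) x ∈ (casimirOp p M).eigenspace c := by
    intro x hx
    rw [Module.End.mem_eigenspace_iff, casimirOp_apply] at *
    rw [Algebra.lsmul_coe, ← mul_smul, (casimir_comm p _).eq, mul_smul, hx, smul_smul_comm']
  have : Nontrivial ((casimirOp p M).eigenspace c) := Submodule.nontrivial_iff_ne_bot.mpr hc
  obtain ⟨l, hl⟩ := Module.End.exists_eigenvalue ((Algebra.lsmul ℂ ℂ M (K p)).restrict hstab)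
  obtain ⟨⟨x, hxc⟩, hx⟩ := hl.exists_hasEigenvector
  have hx0 : x ≠ 0 := fun h => hx.2 (Subtype.ext h)
  have hxK : K p • x = l • x := congrArg Subtype.val hx.apply_eq_smul
  rw [Module.End.mem_eigenspace_iff, casimirOp_apply] at hxc
  have hpow : ∀ n : ℕ, K p ^ n • x = l ^ n • x := by
    intro n
    induction n with
    | zero => simp
    | succ n ih => rw [pow_succ', mul_smul, ih, smul_smul_comm', hxK, smul_smul, pow_succ]
  -- Since K^p = 1 on M, the weight is a power of q². This evenness is why only odd r occur.
  have hl : l ^ p = 1 := by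
    have h := hpow p
    rw [hv.K_pow_smul] at h
    by_contra hne
    have h2 : (l ^ p - 1) • x = 0 := by rw [sub_smul, ← h, one_smul, sub_self]
    exact hx0 ((smul_eq_zero.mp h2).resolve_left (sub_ne_zero.mpr hne))
  have : NeZero p := ⟨p_ne_zero p⟩
  obtain ⟨n, -, hn⟩ := (qRoot_sq_isPrimitiveRoot p (p_ne_zero p)).eq_pow_of_pow_eq_one hl
  rw [← zpow_natCast, ← zpow_mul] at hn
  classical
  -- The least vanishing power of E is positive because x ≠ 0; the vector just before it is a
  -- highest weight vector.
  have hex : ∃ a, E p ^ a • x = 0 := ⟨p, by rw [(sat_gen p).E_pow, zero_smul]⟩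
  obtain ⟨a, ha⟩ : ∃ a, Nat.find hex = a + 1 := by
    refine Nat.exists_eq_succ_of_ne_zero fun h => hx0 ?_
    have := Nat.find_spec hex
    rwa [h, pow_zero, one_smul] at this
  have hy0 : E p ^ a • x ≠ 0 := Nat.find_min hex (by omega)
  have hy1 : E p • E p ^ a • x = 0 := by
    rw [← mul_smul, ← pow_succ', ← ha]
    exact Nat.find_spec hex
  have hyK := K_smul_E_pow_smul (n := 2 * (n : ℤ)) (by rw [hn]; exact hxK) a
  have hyC := casimir_smul_of_E_smul_eq_zero hyK hy1
  rw [← mul_smul, (casimir_comm p _).eq, mul_smul, hxc, smul_smul_comm'] at hyC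
  obtain ⟨r, hr⟩ := exists_oddIndex p (n + a)
  refine ⟨r, ?_⟩
  rw [← hr]
  have h3 := smul_left_injective ℂ hy0 hyC
  rw [h3]
  congr 1
  ring

end decomposition

end UqSl2

/-! ### Facts on `X⁺_r` -/

namespace XPlus

set_option linter.unusedSectionVars false

variable (p r : ℕ) [hp2 : Fact (2 ≤ p)] (hr : r ≤ p)

instance : IsScalarTower ℂ (UqSl2 p) (XPlus p r hr) :=
  ⟨fun c u x => by
    change rep p r hr (c • u) x = c • rep p r hr u x
    rw [map_smul]; rfl⟩

theorem E_smul (x : XPlus p r hr) : UqSl2.E p • x = opE p r x :=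
  LinearMap.congr_fun (UqSl2.lift_E (XPlus.sat hr)) x

theorem K_smul (x : XPlus p r hr) : UqSl2.K p • x = opK p r x :=
  LinearMap.congr_fun (UqSl2.lift_K (XPlus.sat hr)) x

theorem F_smul (x : XPlus p r hr) : UqSl2.F p • x = opF r x :=
  LinearMap.congr_fun (UqSl2.lift_F (XPlus.sat hr)) x

/-- The basis vectors of `X⁺_r`. -/
def basisVec (n : Fin r) : XPlus p r hr := (Pi.single n 1 : Fin r → ℂ)

theorem basisVec_ne_zero (n : Fin r) : basisVec p r hr n ≠ 0 := by
  intro h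
  have := congrFun h n
  simp [basisVec] at this
  exact one_ne_zero this

theorem K_smul_basisVec (n : Fin r) : UqSl2.K p • basisVec p r hr n =
    (qRoot p ^ ((r : ℤ) - 1 - 2 * (n : ℤ))) • basisVec p r hr n := by
  rw [K_smul]
  funext m
  change qRoot p ^ ((r : ℤ) - 1 - 2 * (m : ℤ)) * (Pi.single n 1 : Fin r → ℂ) m =
    qRoot p ^ ((r : ℤ) - 1 - 2 * (n : ℤ)) * (Pi.single n 1 : Fin r → ℂ) m
  by_cases h : m = n
  · rw [h]
  · rw [Pi.single_eq_of_ne h, mul_zero, mul_zero]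

theorem F_smul_basisVec (n : Fin r) (h : (n : ℕ) + 1 < r) :
    UqSl2.F p • basisVec p r hr n = basisVec p r hr ⟨n + 1, h⟩ := by
  rw [F_smul]
  funext m
  change opF r (Pi.single n 1) m = (Pi.single _ 1 : Fin r → ℂ) m
  rw [opF_apply]
  simp only [Pi.single_apply, Fin.ext_iff]
  split_ifs <;> first | rfl | omega

theorem E_smul_basisVec (n : Fin r) (h : (n : ℕ) + 1 < r) :
    UqSl2.E p • basisVec p r hr ⟨n + 1, h⟩ =
      (qInt p ((n : ℤ) + 1) * qInt p ((r : ℤ) - (n + 1))) • basisVec p r hr n := by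
  rw [E_smul]
  funext m
  change opE p r (Pi.single _ 1) m = _ * (Pi.single n 1 : Fin r → ℂ) m
  rw [opE_apply]
  by_cases hm : m = n
  · subst hm
    rw [dif_pos h, Pi.single_eq_same, Pi.single_eq_same]
  · rw [Pi.single_eq_of_ne hm, mul_zero]
    split_ifs with h'
    · rw [Pi.single_eq_of_ne, mul_zero]
      intro h2
      exact hm (Fin.ext (by simpa using congrArg Fin.val h2))
    · rfl

theorem E_smul_basisVec_zero (n : Fin r) (h : (n : ℕ) = 0) :
    UqSl2.E p • basisVec p r hr n = 0 := by
  rw [E_smul]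
  funext m
  change opE p r (Pi.single n 1) m = 0
  rw [opE_apply]
  split_ifs with h'
  · rw [Pi.single_eq_of_ne, mul_zero]
    intro h2
    have := congrArg Fin.val h2
    simp only at this
    omega
  · rfl

theorem span_basisVec : Submodule.span ℂ (Set.range (basisVec p r hr)) = ⊤ := by
  have h : (fun n => (Pi.single n 1 : Fin r → ℂ)) = ⇑(Pi.basisFun ℂ (Fin r)) := by
    funext n
    rw [Pi.basisFun_apply]
  have h2 := (Pi.basisFun ℂ (Fin r)).span_eq
  rw [← h] at h2
  exact h2

/-- The vector e_0 is killed by E and has weight q^{r−1}; the others are obtained from it by F,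
which commutes with the Casimir element. -/
theorem casimir_smul (x : XPlus p r hr) :
    UqSl2.casimir p • x = UqSl2.casimirValue p r • x := by
  have hx : x ∈ Submodule.span ℂ (Set.range (basisVec p r hr)) := by
    rw [span_basisVec]; trivial
  induction hx using Submodule.span_induction with
  | mem x hx =>
    obtain ⟨n, rfl⟩ := hx
    obtain ⟨n, hn⟩ := n
    induction n with
    | zero =>
      rw [UqSl2.casimir_smul_of_E_smul_eq_zero (K_smul_basisVec p r hr _)
        (E_smul_basisVec_zero p r hr _ rfl)]
      congr 2
      simp only
      push_cast
      ring
    | succ n ih =>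
      have h := F_smul_basisVec p r hr ⟨n, by omega⟩ hn
      rw [← h, ← mul_smul, (UqSl2.casimir_comm p _).eq, mul_smul, ih (by omega),
        UqSl2.smul_smul_comm']
  | zero => rw [smul_zero, smul_zero]
  | add y y' _ _ h h' => rw [smul_add, h, h', smul_add]
  | smul c y _ h => rw [UqSl2.smul_smul_comm', h, smul_comm]

/-- E brings any basis vector down to e_0 with coefficients [k+1][r−k−1], nonzero because r ≤ p, and
F then reaches all the others. -/
theorem span_singleton_basisVec (n : Fin r) :
    Submodule.span (UqSl2 p) {basisVec p r hr n} = ⊤ := by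
  set S := Submodule.span (UqSl2 p) {basisVec p r hr n} with hS
  have hn : basisVec p r hr n ∈ S := Submodule.mem_span_singleton_self _
  have hc : ∀ (c : ℂ), c ≠ 0 → ∀ x : XPlus p r hr, c • x ∈ S → x ∈ S := by
    intro c hc x hx
    have := (S.restrictScalars ℂ).smul_mem c⁻¹ hx
    rwa [smul_smul, inv_mul_cancel₀ hc, one_smul] at this
  have hdown : ∀ k, ∀ hk : k < r, basisVec p r hr ⟨k, hk⟩ ∈ S →
      basisVec p r hr ⟨0, by omega⟩ ∈ S := by
    intro k
    induction k with
    | zero => intro hk h; exact h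
    | succ k ih =>
      intro hk h
      refine ih (by omega) (hc (qInt p ((k : ℤ) + 1) * qInt p ((r : ℤ) - (k + 1))) ?_ _ ?_)
      · exact mul_ne_zero (qInt_ne_zero p (by omega) (by omega))
          (qInt_ne_zero p (by omega) (by omega))
      · rw [← E_smul_basisVec p r hr ⟨k, by omega⟩ hk]
        exact S.smul_mem _ h
  have hup : ∀ k, ∀ hk : k < r, basisVec p r hr ⟨k, hk⟩ ∈ S := by
    intro k
    induction k with
    | zero => intro hk; exact hdown n n.2 hn
    | succ k ih =>
      intro hk
      rw [← F_smul_basisVec p r hr ⟨k, by omega⟩ hk]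
      exact S.smul_mem _ (ih (by omega))
  have hle : Submodule.span ℂ (Set.range (basisVec p r hr)) ≤ S.restrictScalars ℂ := by
    rw [Submodule.span_le]
    rintro _ ⟨k, rfl⟩
    exact hup k k.2
  rw [span_basisVec] at hle
  exact eq_top_iff.mpr fun x _ => hle (Submodule.mem_top (x := x))

/-- The middle basis vector of `X⁺_r` for odd `r`. -/
def middle (hodd : Odd r) : XPlus p r hr :=
  basisVec p r hr ⟨(r - 1) / 2, by have := hodd.pos; omega⟩

/-- The exponent r − 1 − 2n vanishes at n = (r − 1)/2, an integer exactly for odd r. -/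
theorem K_smul_middle (hodd : Odd r) :
    UqSl2.K p • middle p r hr hodd = middle p r hr hodd := by
  rw [middle, K_smul_basisVec]
  obtain ⟨k, rfl⟩ := hodd
  have : ((2 * k + 1 : ℕ) : ℤ) - 1 - 2 * (((2 * k + 1 - 1) / 2 : ℕ) : ℤ) = 0 := by omega
  simp only [this, zpow_zero, one_smul]

end XPlus

/-! ### Decomposition of the generated module into projective covers. -/

namespace UqSl2

set_option linter.unusedSectionVars false

section decomposition
variable {p : ℕ} [hp2 : Fact (2 ≤ p)] {M : Type*} [AddCommGroup M] [Module ℂ M]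
  [Module (UqSl2 p) M] [IsScalarTower ℂ (UqSl2 p) M] {v : M}

variable (p M) in
/-- The summands: the generalized eigenspaces of the Casimir element. -/
def oddSummand (r : OddIndex p) : Submodule (UqSl2 p) M :=
  casimirSubmodule p M (casimirValue p (r : ℕ))

variable (p M) in
theorem iSupIndep_oddSummand_restrictScalars :
    iSupIndep fun r : OddIndex p => (oddSummand p M r).restrictScalars ℂ :=
  (casimirOp p M).independent_maxGenEigenspace.comp (casimirValue_injective p)

/-- Over ℂ the generalized eigenspaces exhaust a finite-dimensional module; those for numbers that
are not eigenvalues are zero, and every eigenvalue belongs to an odd index. -/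
theorem iSup_oddSummand_restrictScalars (hv : IsWeightZeroGenerator p v) :
    ⨆ r : OddIndex p, (oddSummand p M r).restrictScalars ℂ = ⊤ := by
  have := hv.finiteDimensional
  rw [eq_top_iff, ← Module.End.iSup_maxGenEigenspace_eq_top (casimirOp p M)]
  refine iSup_le fun c => ?_
  by_cases hc : (casimirOp p M).HasEigenvalue c
  · obtain ⟨r, rfl⟩ := hv.exists_of_hasEigenvalue hc
    exact le_iSup (fun r : OddIndex p => (oddSummand p M r).restrictScalars ℂ) r
  · have : (casimirOp p M).maxGenEigenspace c = ⊥ := by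
      by_contra h
      have h' : (casimirOp p M).HasUnifEigenvalue c ⊤ := h
      exact hc (h'.lt zero_lt_one)
    rw [this]
    exact bot_le

theorem isInternal_oddSummand (hv : IsWeightZeroGenerator p v) :
    DirectSum.IsInternal (oddSummand p M) := by
  refine DirectSum.isInternal_submodule_of_iSupIndep_of_iSup_eq_top (fun r => ?_) ?_
  · rw [← Submodule.disjoint_restrictScalars_iff ℂ]
    simp only [Submodule.restrictScalars_iSup]
    exact iSupIndep_oddSummand_restrictScalars p M r
  · rw [← Submodule.restrictScalars_eq_top_iff ℂ, Submodule.restrictScalars_iSup]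
    exact iSup_oddSummand_restrictScalars hv

theorem exists_retraction (hv : IsWeightZeroGenerator p v) (r : OddIndex p) :
    ∃ f : M →ₗ[UqSl2 p] oddSummand p M r, ∀ x : oddSummand p M r, f x = x := by
  classical
  have h := isInternal_oddSummand hv
  let e := LinearEquiv.ofBijective (DirectSum.coeLinearMap (oddSummand p M)) h
  refine ⟨DirectSum.component (UqSl2 p) _ _ r ∘ₗ e.symm.toLinearMap, fun x => ?_⟩
  have : e.symm x = DirectSum.lof (UqSl2 p) _ (fun r => oddSummand p M r) r x := by
    rw [LinearEquiv.symm_apply_eq]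
    exact (DirectSum.coeLinearMap_lof (oddSummand p M) r x).symm
  rw [LinearMap.comp_apply, LinearEquiv.coe_coe, this, DirectSum.component.lof_self]

theorem oddSummand_le_span (hv : IsWeightZeroGenerator p v) (r : OddIndex p)
    (φ : M →ₗ[UqSl2 p] XPlus p r (r.2.2.trans (nu_le p))) {w : M} (hw : K p • w = w)
    (hφ : φ w ≠ 0) : oddSummand p M r ≤ Submodule.span (UqSl2 p) {w} :=
  casimirSubmodule_le_span hv φ (XPlus.casimir_smul p r _ _) hw hφ

/-- The weight-zero vector `w` alone generates the summand. This criterion carries both essentiality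
and indecomposability. -/
theorem eq_top_of_map_ne_zero (hv : IsWeightZeroGenerator p v) (r : OddIndex p)
    (φ : M →ₗ[UqSl2 p] XPlus p r (r.2.2.trans (nu_le p)))
    (N : Submodule (UqSl2 p) (oddSummand p M r)) {w : oddSummand p M r} (hwN : w ∈ N)
    (hw : K p • w = w) (hφ : φ w ≠ 0) : N = ⊤ := by
  have h := oddSummand_le_span hv r φ (w := (w : M)) (congrArg Subtype.val hw) hφ
  refine eq_top_iff.mpr fun y _ => ?_
  obtain ⟨u, hu⟩ := Submodule.mem_span_singleton.mp (h y.2)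
  have : y = u • w := Subtype.ext hu.symm
  rw [this]
  exact N.smul_mem u hwN

/-- The image of v generates the simple module, so φ is onto. Its restriction to the r-th summand
remains onto because φ kills every other summand. -/
theorem map_oddSummand_eq_top (hv : IsWeightZeroGenerator p v) (r : OddIndex p)
    (φ : M →ₗ[UqSl2 p] XPlus p r (r.2.2.trans (nu_le p)))
    (hφ : φ v = XPlus.middle p r _ r.2.1) (x : XPlus p r (r.2.2.trans (nu_le p))) :
    ∃ y ∈ oddSummand p M r, φ y = x := by
  have hx : x ∈ Submodule.span (UqSl2 p) {XPlus.middle p r (r.2.2.trans (nu_le p)) r.2.1} := by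
    rw [XPlus.middle, XPlus.span_singleton_basisVec]; trivial
  obtain ⟨u, rfl⟩ := Submodule.mem_span_singleton.mp hx
  rw [← hφ, ← map_smul]
  have hu : u • v ∈ ⨆ r : OddIndex p, (oddSummand p M r).restrictScalars ℂ := by
    rw [iSup_oddSummand_restrictScalars hv]; trivial
  generalize u • v = y at hu
  refine Submodule.iSup_induction _ (motive := fun y => ∃ z ∈ oddSummand p M r, φ z = φ y) hu
    ?_ ⟨0, zero_mem _, rfl⟩ ?_
  · intro s y hy
    by_cases hs : s = r
    · subst hs
      exact ⟨y, hy, rfl⟩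
    -- On X⁺_r the Casimir element is the value at r, so a power of its difference with the value at
    -- s acts as a nonzero scalar, yet it kills φ(y).
    · refine ⟨0, zero_mem _, ?_⟩
      obtain ⟨k, hk⟩ := mem_casimirSubmodule.mp hy
      have hc := XPlus.casimir_smul p r (r.2.2.trans (nu_le p)) (φ y)
      have h1 := aeval_casimir_smul hc
        ((Polynomial.X - Polynomial.C (casimirValue p (s : ℕ))) ^ k)
      rw [map_pow, map_sub, Polynomial.aeval_X, Polynomial.aeval_C, ← map_smul, hk, map_zero,
        Polynomial.eval_pow, Polynomial.eval_sub, Polynomial.eval_X, Polynomial.eval_C] at h1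
      rw [map_zero]
      refine ((smul_eq_zero.mp h1.symm).resolve_left (pow_ne_zero _ (sub_ne_zero.mpr ?_))).symm
      exact fun h => hs (casimirValue_injective p h).symm
  · rintro a b ⟨a', ha, ha'⟩ ⟨b', hb, hb'⟩
    exact ⟨a' + b', add_mem ha hb, by rw [map_add, map_add, ha', hb']⟩

/-- Projectivity passes to direct summands. If N together with the kernel is everything, then some n
in N has the same image as v, and its weight-zero part still has nonzero image. -/
theorem exists_projectiveCover (hv : IsWeightZeroGenerator p v) (r : OddIndex p) :
    ∃ π : oddSummand p M r →ₗ[UqSl2 p] XPlus p r (r.2.2.trans (nu_le p)),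
      IsProjectiveCover (UqSl2 p) π := by
  obtain ⟨φ, hφ⟩ := hv.exists_hom (XPlus.K_smul_middle p r (r.2.2.trans (nu_le p)) r.2.1)
  have hmid : XPlus.middle p r (r.2.2.trans (nu_le p)) r.2.1 ≠ 0 :=
    XPlus.basisVec_ne_zero p r _ _
  refine ⟨φ ∘ₗ (oddSummand p M r).subtype, ?_, ?_, ?_⟩
  · have := hv.projective
    obtain ⟨f, hf⟩ := exists_retraction hv r
    exact Module.Projective.of_split (oddSummand p M r).subtype f (LinearMap.ext hf)
  · intro x
    obtain ⟨y, hy, rfl⟩ := map_oddSummand_eq_top hv r φ hφ x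
    exact ⟨⟨y, hy⟩, rfl⟩
  · intro N hN
    obtain ⟨y, hy, hy'⟩ := map_oddSummand_eq_top hv r φ hφ (φ v)
    have hyN : (⟨y, hy⟩ : oddSummand p M r) ∈
        N ⊔ LinearMap.ker (φ ∘ₗ (oddSummand p M r).subtype) := by rw [hN]; trivial
    obtain ⟨n, hn, k, hk, hnk⟩ := Submodule.mem_sup.mp hyN
    have h1 : φ n = φ v := by
      have hk' : φ k = 0 := hk
      rw [← hy', ← add_zero (φ n), ← hk', ← map_add]
      exact congrArg (fun z : oddSummand p M r => φ z) hnk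
    -- The weight-zero projector is an element of U: it preserves N, and it fixes the image of v,
    -- which is K-fixed.
    refine eq_top_of_map_ne_zero hv r φ N (N.smul_mem (weightZero p) hn)
      (K_smul_weightZero_smul n) ?_
    rw [Submodule.coe_smul, map_smul, h1, hφ,
      weightZero_smul_of_K_smul_eq (XPlus.K_smul_middle p r _ r.2.1)]
    exact hmid

/-- Split a vector with the same image as v along A and B and project to weight zero. One of the two
components has nonzero image, so the corresponding submodule is the whole summand. -/
theorem isIndecomposableModule_oddSummand (hv : IsWeightZeroGenerator p v) (r : OddIndex p) :
    IsIndecomposableModule (UqSl2 p) (oddSummand p M r) := by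
  obtain ⟨φ, hφ⟩ := hv.exists_hom (XPlus.K_smul_middle p r (r.2.2.trans (nu_le p)) r.2.1)
  have hmid : XPlus.middle p r (r.2.2.trans (nu_le p)) r.2.1 ≠ 0 :=
    XPlus.basisVec_ne_zero p r _ _
  obtain ⟨y, hy, hy'⟩ := map_oddSummand_eq_top hv r φ hφ (φ v)
  have hv0 : φ v ≠ 0 := by rw [hφ]; exact hmid
  refine ⟨⟨⟨y, hy⟩, 0, fun h => hv0 ?_⟩, fun A B hAB => ?_⟩
  · rw [← hy', show y = 0 from congrArg Subtype.val h, map_zero]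
  have hyAB : (⟨y, hy⟩ : oddSummand p M r) ∈ A ⊔ B := by rw [hAB.sup_eq_top]; trivial
  obtain ⟨a, ha, b, hb, hab⟩ := Submodule.mem_sup.mp hyAB
  have h1 : φ (weightZero p • a : oddSummand p M r) + φ (weightZero p • b : oddSummand p M r) =
      φ v := by
    rw [Submodule.coe_smul, Submodule.coe_smul, ← map_add, ← smul_add, map_smul]
    have : φ ((a : M) + b) = φ v := by
      rw [← hy']
      exact congrArg (fun z : oddSummand p M r => φ z) hab
    rw [this, hφ, weightZero_smul_of_K_smul_eq (XPlus.K_smul_middle p r _ r.2.1)]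
  by_cases h : φ (weightZero p • a : oddSummand p M r) = 0
  · left
    rw [h, zero_add] at h1
    have hB := eq_top_of_map_ne_zero hv r φ B (B.smul_mem (weightZero p) hb)
      (K_smul_weightZero_smul b) (by rw [h1]; exact hv0)
    have := hAB.inf_eq_bot
    rwa [hB, inf_top_eq] at this
  · right
    have hA := eq_top_of_map_ne_zero hv r φ A (A.smul_mem (weightZero p) ha)
      (K_smul_weightZero_smul a) h
    have := hAB.inf_eq_bot
    rwa [hA, top_inf_eq] at this

theorem isOddProjectiveDecomposition (hv : IsWeightZeroGenerator p v) :
    IsOddProjectiveDecomposition p (oddSummand p M) where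
  isInternal := isInternal_oddSummand hv
  indecomposable := isIndecomposableModule_oddSummand hv
  cover := exists_projectiveCover hv

end decomposition

end UqSl2

theorem XPlus.E_smul_eq_zero (p r : ℕ) [Fact (2 ≤ p)] (hr : r ≤ p) (h : r = 1)
    (x : XPlus p r hr) : UqSl2.E p • x = 0 := by
  have h0 : ∀ y : Fin r → ℂ, XPlus.opE p r y = 0 := fun y => by
    funext m
    rw [XPlus.opE_apply, dif_neg (by omega)]
    rfl
  exact (XPlus.E_smul p r hr x).trans (h0 x)

/-! ### The algebra on z, ∂ as a module generated in weight zero. -/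

namespace QDiff

set_option linter.unusedSectionVars false

variable (p : ℕ) [hp2 : Fact (2 ≤ p)]

/-- The algebra on `z`, `∂` as a `U`-module. -/
abbrev uModule : Module (UqSl2 p) (QDiff p) := (weylData p).module

attribute [local instance] uModule

theorem uIsScalarTower : IsScalarTower ℂ (UqSl2 p) (QDiff p) := (weylData p).isScalarTower

attribute [local instance] uIsScalarTower

theorem E_smul_eq (a : QDiff p) : UqSl2.E p • a = (weylData p).opE a := (weylData p).E_smul a
theorem F_smul_eq (a : QDiff p) : UqSl2.F p • a = (weylData p).opF a := (weylData p).F_smul a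
theorem K_smul_eq (a : QDiff p) : UqSl2.K p • a = (weylData p).k a := (weylData p).K_smul a

theorem z_pow_of_le {m : ℕ} (h : p ≤ m) : z p ^ m = 0 := pow_eq_zero_of_le h (z_pow p)
theorem D_pow_of_le {m : ℕ} (h : p ≤ m) : D p ^ m = 0 := pow_eq_zero_of_le h (D_pow p)

theorem isStandardAction : IsStandardAction p where
  E_z m := (E_smul_eq p _).trans ((weylData p).opE_z_pow m)
  K_z m := by
    have := (K_smul_eq p _).trans ((weylData p).k_z_pow m)
    rw [← Nat.cast_ofNat, ← Nat.cast_mul, zpow_natCast] at this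
    exact this
  F_z m := (F_smul_eq p _).trans ((weylData p).opF_z_pow m)
  E_D n := (E_smul_eq p _).trans ((weylData p).opE_D_pow n)
  K_D n := (K_smul_eq p _).trans ((weylData p).k_D_pow n)
  F_D n := (F_smul_eq p _).trans ((weylData p).opF_D_pow n)

theorem E_smul_monomial (a b : ℕ) : UqSl2.E p • (z p ^ a * D p ^ b) =
    (-(qRoot p ^ a * qInt p a) * qRoot p ^ (-2 * (b : ℤ))) • (z p ^ (a + 1) * D p ^ b) +
      (qRoot p ^ (1 - (b : ℤ)) * qInt p b) • (z p ^ a * D p ^ (b - 1)) :=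
  (E_smul_eq p _).trans ((weylData p).opE_monomial a b)

theorem F_smul_monomial (a b : ℕ) : UqSl2.F p • (z p ^ a * D p ^ b) =
    (qInt p a * qRoot p ^ (1 - (a : ℤ))) • (z p ^ (a - 1) * D p ^ b) +
      (qRoot p ^ (-2 * (a : ℤ)) * -(qRoot p ^ b * qInt p b)) • (z p ^ a * D p ^ (b + 1)) :=
  (F_smul_eq p _).trans ((weylData p).opF_monomial a b)

theorem K_smul_monomial (a b : ℕ) : UqSl2.K p • (z p ^ a * D p ^ b) =
    (qRoot p ^ (2 * ((a : ℤ) - b))) • (z p ^ a * D p ^ b) :=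
  (K_smul_eq p _).trans ((weylData p).k_monomial a b)

theorem E_smul_t : UqSl2.E p • t p = z p := (E_smul_eq p _).trans (weylData p).opE_t
theorem F_smul_t : UqSl2.F p • t p = D p := (F_smul_eq p _).trans (weylData p).opF_t
theorem K_smul_t : UqSl2.K p • t p = t p := (K_smul_eq p _).trans (weylData p).k_t

theorem E_smul_D : UqSl2.E p • D p = 1 := by
  have := (isStandardAction p).E_D 1
  simpa [qInt_one] using this

theorem F_smul_z : UqSl2.F p • z p = 1 := by
  have := (isStandardAction p).F_z 1
  simpa [qInt_one] using this

theorem E_smul_one : UqSl2.E p • (1 : QDiff p) = 0 := by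
  have := (isStandardAction p).E_z 0
  simpa [qInt] using this

theorem F_smul_one : UqSl2.F p • (1 : QDiff p) = 0 := by
  have := (isStandardAction p).F_D 0
  simpa [qInt] using this

theorem K_smul_one : UqSl2.K p • (1 : QDiff p) = 1 := by
  have := (isStandardAction p).K_D 0
  simpa using this

variable {p} in
theorem mem_of_smul_mem (S : Submodule (UqSl2 p) (QDiff p)) {c : ℂ} (hc : c ≠ 0) {x : QDiff p}
    (h : c • x ∈ S) : x ∈ S := by
  rw [← inv_smul_smul₀ hc x]
  exact S.smul_of_tower_mem _ h

/-- On z^a∂^{p−1} the second term of F contains ∂^p = 0, so F lowers the power of z. After that E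
lowers the power of ∂, modulo z^{a+1}∂^b, which is already available. -/
theorem monomial_mem_of_top_mem (S : Submodule (UqSl2 p) (QDiff p))
    (hS : z p ^ (p - 1) * D p ^ (p - 1) ∈ S) (a b : ℕ) (hb : b ≤ p - 1) :
    z p ^ a * D p ^ b ∈ S := by
  have hp := hp2.out
  have hq := qRoot_ne_zero p
  induction hb using Nat.decreasingInduction generalizing a with
  | self =>
    by_cases ha : p ≤ a
    · rw [z_pow_of_le p ha, zero_mul]; exact zero_mem _
    have ha' : a ≤ p - 1 := by omega
    induction ha' using Nat.decreasingInduction with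
    | self => exact hS
    | of_succ a ha ih =>
      have h := S.smul_mem (UqSl2.F p) (ih (by omega))
      rw [F_smul_monomial, D_pow_of_le p (m := p - 1 + 1) (by omega), mul_zero, smul_zero,
        add_zero, Nat.add_sub_cancel] at h
      refine mem_of_smul_mem S (mul_ne_zero (qInt_ne_zero p ?_ ?_) (zpow_ne_zero _ hq)) h <;> omega
  | of_succ b hb ih =>
    have h := S.smul_mem (UqSl2.E p) (ih a)
    rw [E_smul_monomial, Nat.add_sub_cancel,
      Submodule.add_mem_iff_right _ (S.smul_of_tower_mem _ (ih (a + 1)))] at h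
    refine mem_of_smul_mem S (mul_ne_zero (zpow_ne_zero _ hq) (qInt_ne_zero p ?_ ?_)) h <;> omega

theorem isWeightZeroGenerator :
    UqSl2.IsWeightZeroGenerator p (z p ^ (p - 1) * D p ^ (p - 1)) where
  K_smul := by rw [K_smul_monomial, sub_self, mul_zero, zpow_zero, one_smul]
  finrank_eq := finrank_eq p
  exists_smul x := by
    rw [← Submodule.mem_span_singleton]
    have hle : Submodule.span ℂ
        (Set.range fun ab : Fin p × Fin p => z p ^ (ab.1 : ℕ) * D p ^ (ab.2 : ℕ)) ≤
        (Submodule.span (UqSl2 p) {z p ^ (p - 1) * D p ^ (p - 1)}).restrictScalars ℂ := by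
      rw [Submodule.span_le]
      rintro _ ⟨ab, rfl⟩
      exact monomial_mem_of_top_mem p _ (Submodule.mem_span_singleton_self _) _ _ (by omega)
    rw [span_monomial] at hle
    exact hle (Submodule.mem_top (x := x))

/-! ### The wing diagram -/

theorem coord_monomial {a b c d : ℕ} (ha : a < p) (hb : b < p) (hc : c < p) (hd : d < p) :
    (monomialBasis p).coord (⟨a, ha⟩, ⟨b, hb⟩) (z p ^ c * D p ^ d) =
      if c = a ∧ d = b then 1 else 0 := by
  rw [← monomialBasis_apply p (⟨c, hc⟩, ⟨d, hd⟩), Module.Basis.coord_apply,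
    Module.Basis.repr_self, Finsupp.single_apply]
  simp only [Prod.mk.injEq, Fin.mk.injEq]

theorem coord_t {a b : ℕ} (ha : a < p) (hb : b < p) :
    (monomialBasis p).coord (⟨a, ha⟩, ⟨b, hb⟩) (t p) =
      if a = b ∧ 0 < a then (qInt p a)⁻¹ else 0 := by
  have h1 : ∀ i ∈ Finset.Icc 1 (p - 1), (monomialBasis p).coord (⟨a, ha⟩, ⟨b, hb⟩)
      ((qInt p i)⁻¹ • (z p ^ i * D p ^ i)) = if i = a ∧ i = b then (qInt p i)⁻¹ else 0 := by
    intro i hi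
    rw [Finset.mem_Icc] at hi
    rw [map_smul, coord_monomial p ha hb (c := i) (d := i) (by omega) (by omega), smul_ite,
      smul_eq_mul, mul_one, smul_zero]
  rw [t, map_sum, Finset.sum_congr rfl h1]
  split_ifs with h
  · obtain ⟨rfl, h⟩ := h
    simp only [and_self]
    rw [Finset.sum_ite_eq', if_pos (Finset.mem_Icc.mpr (by omega))]
  · refine Finset.sum_eq_zero fun i hi => ?_
    rw [Finset.mem_Icc] at hi
    rw [if_neg (by omega)]

/-- The coordinates dual to the wing. -/
def wingIndex : Fin p ⊕ Fin (p - 1) ⊕ Unit → Fin p × Fin p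
  | .inl i => (i, ⟨0, have := hp2.out; by omega⟩)
  | .inr (.inl i) => (⟨0, have := hp2.out; by omega⟩, ⟨i + 1, by omega⟩)
  | .inr (.inr _) => (⟨1, hp2.out⟩, ⟨1, hp2.out⟩)

/-- The monomial z∂ occurs only in t, with coefficient 1/[1] = 1, and t contains no pure power, so
these coordinates are dual to the wing. -/
theorem coord_wingIndex (i j : Fin p ⊕ Fin (p - 1) ⊕ Unit) :
    (monomialBasis p).coord (wingIndex p i) (wing p j) = if i = j then 1 else 0 := by
  have hp := hp2.out
  have hz : ∀ m : ℕ, z p ^ m = z p ^ m * D p ^ 0 := fun m => by rw [pow_zero, mul_one]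
  have hD : ∀ m : ℕ, D p ^ m = z p ^ 0 * D p ^ m := fun m => by rw [pow_zero, one_mul]
  rcases i with i | i | i <;> rcases j with j | j | j <;> simp only [wing, wingIndex] <;>
    first
    | rw [hz, coord_monomial p _ _ (by omega) (by omega)]
    | rw [hD, coord_monomial p _ _ (by omega) (by omega)]
    | rw [coord_t]
  all_goals
    simp only [Sum.inl.injEq, Sum.inr.injEq, Fin.ext_iff, reduceCtorEq, if_false, zero_lt_one,
      and_self, Nat.cast_one, qInt_one, inv_one, and_true, true_and, and_false, false_and, add_left_inj]
    try split_ifs <;> first | rfl | omega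

theorem linearIndependent_wing : LinearIndependent ℂ (wing p) := by
  refine LinearIndependent.of_pairwise_dual_eq_zero_one (wing p)
    (fun i => (monomialBasis p).coord (wingIndex p i)) ?_ ?_
  · intro i j h
    rw [coord_wingIndex, if_neg h]
  · intro i
    rw [coord_wingIndex, if_pos rfl]

theorem isWingDiagram : IsWingDiagram p where
  linearIndependent := linearIndependent_wing p
  E_t := E_smul_t p
  F_t := F_smul_t p
  K_t := K_smul_t p
  left m h1 h2 := by
    refine ⟨⟨_, ?_, (isStandardAction p).E_z m⟩, ⟨_, ?_, (isStandardAction p).F_z (m + 1)⟩⟩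
    · exact neg_ne_zero.mpr (mul_ne_zero (pow_ne_zero _ (qRoot_ne_zero p))
        (qInt_ne_zero p (by omega) (by omega)))
    · exact mul_ne_zero (qInt_ne_zero p (by omega) (by omega)) (zpow_ne_zero _ (qRoot_ne_zero p))
  right m h1 h2 := by
    refine ⟨⟨_, ?_, (isStandardAction p).F_D m⟩, ⟨_, ?_, (isStandardAction p).E_D (m + 1)⟩⟩
    · exact neg_ne_zero.mpr (mul_ne_zero (pow_ne_zero _ (qRoot_ne_zero p))
        (qInt_ne_zero p (by omega) (by omega)))
    · exact mul_ne_zero (zpow_ne_zero _ (qRoot_ne_zero p)) (qInt_ne_zero p (by omega) (by omega))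
  E_end := by rw [(isStandardAction p).E_z, z_pow_of_le p (by omega), smul_zero]
  F_end := by rw [(isStandardAction p).F_D, D_pow_of_le p (by omega), smul_zero]
  F_z := F_smul_z p
  E_D := E_smul_D p
  E_one := E_smul_one p
  F_one := F_smul_one p

/-! ### The span of the wing -/

theorem z_pow_mem_span_wing (m : ℕ) : z p ^ m ∈ Submodule.span ℂ (Set.range (wing p)) := by
  by_cases h : m < p
  · exact Submodule.subset_span ⟨.inl ⟨m, h⟩, rfl⟩
  · rw [z_pow_of_le p (not_lt.mp h)]; exact zero_mem _

theorem D_pow_mem_span_wing (m : ℕ) : D p ^ m ∈ Submodule.span ℂ (Set.range (wing p)) := by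
  by_cases h : m < p
  · rcases m with _ | m
    · simpa using z_pow_mem_span_wing p 0
    · exact Submodule.subset_span ⟨.inr (.inl ⟨m, by omega⟩), rfl⟩
  · rw [D_pow_of_le p (not_lt.mp h)]; exact zero_mem _

theorem t_mem_span_wing : t p ∈ Submodule.span ℂ (Set.range (wing p)) :=
  Submodule.subset_span ⟨.inr (.inr ()), rfl⟩

theorem smul_mem_span_wing (u : UqSl2 p) {x : QDiff p}
    (hx : x ∈ Submodule.span ℂ (Set.range (wing p))) :
    u • x ∈ Submodule.span ℂ (Set.range (wing p)) := by
  have key : ∀ u : UqSl2 p, (∀ i, u • wing p i ∈ Submodule.span ℂ (Set.range (wing p))) →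
      ∀ x ∈ Submodule.span ℂ (Set.range (wing p)),
        u • x ∈ Submodule.span ℂ (Set.range (wing p)) := by
    intro u h x hx
    have hle : Submodule.span ℂ (Set.range (wing p)) ≤
        (Submodule.span ℂ (Set.range (wing p))).comap (Algebra.lsmul ℂ ℂ (QDiff p) u) := by
      rw [Submodule.span_le]
      rintro _ ⟨i, rfl⟩
      exact h i
    exact hle hx
  have hs := isStandardAction p
  induction u using UqSl2.induction_gen generalizing x with
  | hc c => rw [algebraMap_smul]; exact Submodule.smul_mem _ _ hx
  | hE =>
    refine key _ (fun i => ?_) x hx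
    rcases i with i | i | i <;> simp only [wing]
    · rw [hs.E_z]; exact Submodule.smul_mem _ _ (z_pow_mem_span_wing p _)
    · rw [hs.E_D]; exact Submodule.smul_mem _ _ (D_pow_mem_span_wing p _)
    · rw [E_smul_t]; simpa using z_pow_mem_span_wing p 1
  | hK =>
    refine key _ (fun i => ?_) x hx
    rcases i with i | i | i <;> simp only [wing]
    · rw [hs.K_z]; exact Submodule.smul_mem _ _ (z_pow_mem_span_wing p _)
    · rw [hs.K_D]; exact Submodule.smul_mem _ _ (D_pow_mem_span_wing p _)
    · rw [K_smul_t]; exact t_mem_span_wing p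
  | hF =>
    refine key _ (fun i => ?_) x hx
    rcases i with i | i | i <;> simp only [wing]
    · rw [hs.F_z]; exact Submodule.smul_mem _ _ (z_pow_mem_span_wing p _)
    · rw [hs.F_D]; exact Submodule.smul_mem _ _ (D_pow_mem_span_wing p _)
    · rw [F_smul_t]; simpa using D_pow_mem_span_wing p 1
  | hadd u v hu hv => rw [add_smul]; exact add_mem (hu hx) (hv hx)
  | hmul u v hu hv => rw [mul_smul]; exact hu (hv hx)

theorem wing_mem_of_t_mem (S : Submodule (UqSl2 p) (QDiff p)) (ht : t p ∈ S) (i) :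
    wing p i ∈ S := by
  have hp := hp2.out
  have hd := isWingDiagram p
  have hz : z p ∈ S := by rw [← hd.E_t]; exact S.smul_mem _ ht
  have hD : D p ∈ S := by rw [← hd.F_t]; exact S.smul_mem _ ht
  have h1 : 1 ∈ S := by rw [← hd.F_z]; exact S.smul_mem _ hz
  have hzm : ∀ m, m + 1 ≤ p - 1 → z p ^ (m + 1) ∈ S := by
    intro m
    induction m with
    | zero => intro _; simpa using hz
    | succ m ih =>
      intro hm
      obtain ⟨c, hc, h⟩ := (hd.left (m + 1) (by omega) hm).1
      exact mem_of_smul_mem S hc (h ▸ S.smul_mem _ (ih (by omega)))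
  have hDm : ∀ m, m + 1 ≤ p - 1 → D p ^ (m + 1) ∈ S := by
    intro m
    induction m with
    | zero => intro _; simpa using hD
    | succ m ih =>
      intro hm
      obtain ⟨c, hc, h⟩ := (hd.right (m + 1) (by omega) hm).1
      exact mem_of_smul_mem S hc (h ▸ S.smul_mem _ (ih (by omega)))
  rcases i with ⟨_ | i, hi⟩ | i | i
  · simpa [wing] using h1
  · exact hzm i (by omega)
  · exact hDm i (by omega)
  · exact ht

/-- In weight zero C minus its value c at 1 is EF, the values at ±1 being equal. So (C − c)t = EFt =
E∂ = 1, and (C − c)1 = 0 because E kills 1: the exponent 2 suffices. -/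
theorem t_mem_casimirSubmodule :
    t p ∈ UqSl2.casimirSubmodule p (QDiff p) (UqSl2.casimirValue p 1) := by
  rw [UqSl2.mem_casimirSubmodule]
  refine ⟨2, ?_⟩
  have h1 := UqSl2.E_F_smul_of_weight p (x := t p) (n := 0) (by rw [K_smul_t, zpow_zero, one_smul])
  rw [F_smul_t, E_smul_D, zero_sub, UqSl2.casimirValue_neg] at h1
  have h2 := UqSl2.casimir_smul_of_E_smul_eq_zero (p := p) (x := (1 : QDiff p)) (n := 0)
    (by rw [K_smul_one, zpow_zero, one_smul]) (E_smul_one p)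
  rw [zero_add] at h2
  rw [pow_two, mul_smul, sub_smul _ _ (t p), algebraMap_smul, ← h1, sub_smul, algebraMap_smul, h2,
    sub_self]

/-- Homomorphisms to `X⁺_1` on the elements `z^j ∂^j`. -/
theorem map_monomial_of_E_smul_eq_zero {X : Type*} [AddCommGroup X] [Module ℂ X]
    [Module (UqSl2 p) X] [IsScalarTower ℂ (UqSl2 p) X] (hX : ∀ x : X, UqSl2.E p • x = 0)
    (φ : QDiff p →ₗ[UqSl2 p] X) (j : ℕ) (hj : j + 1 < p) :
    φ (z p ^ (j + 1) * D p ^ (j + 1)) =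
      (qRoot p ^ (2 * (j : ℤ)) * qInt p (j + 1)) • φ (z p * D p) := by
  have hq := qRoot_ne_zero p
  induction j with
  | zero => simp [qInt_one]
  | succ j ih =>
    -- E applied to z^{j+1}∂^{j+2} combines z^{j+2}∂^{j+2} and z^{j+1}∂^{j+1}; as φ kills it,
    -- consecutive diagonal monomials have proportional images.
    have h := hX (φ (z p ^ (j + 1) * D p ^ (j + 1 + 1)))
    rw [← map_smul, E_smul_monomial, Nat.add_sub_cancel, map_add,
      φ.map_smul_of_tower, φ.map_smul_of_tower, ih (by omega), smul_smul] at h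
    have hj0 : qInt p ((j + 1 : ℕ) : ℤ) ≠ 0 := qInt_ne_zero p (by omega) (by omega)
    have hne : qRoot p ^ (j + 1) * qInt p ((j + 1 : ℕ) : ℤ) *
        qRoot p ^ (-2 * ((j + 1 + 1 : ℕ) : ℤ)) ≠ 0 :=
      mul_ne_zero (mul_ne_zero (pow_ne_zero _ hq) hj0) (zpow_ne_zero _ hq)
    refine smul_right_injective X hne ?_
    simp only []
    rw [neg_mul, neg_smul, neg_add_eq_zero] at h
    rw [h, smul_smul]
    congr 1
    rw [← zpow_natCast]
    have e : qRoot p ^ (1 - ((j + 1 + 1 : ℕ) : ℤ)) * qRoot p ^ (2 * (j : ℤ)) =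
      qRoot p ^ ((j + 1 : ℕ) : ℤ) * qRoot p ^ (-2 * ((j + 1 + 1 : ℕ) : ℤ)) *
        qRoot p ^ (2 * ((j + 1 : ℕ) : ℤ)) := by
      rw [← zpow_add₀ hq, ← zpow_add₀ hq, ← zpow_add₀ hq]
      congr 1
      push_cast
      ring
    push_cast at e ⊢
    linear_combination (qInt p (j + 1) * qInt p (j + 1 + 1)) * e

/-- The factors [i] cancel in t, so φ(t) = (1 + q² + … + q^{2(p−2)})φ(z∂) = −q^{2(p−1)}φ(z∂). And
φ(z∂) is nonzero because the image of the top monomial is a multiple of it. -/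
theorem map_t_ne_zero {X : Type*} [AddCommGroup X] [Module ℂ X]
    [Module (UqSl2 p) X] [IsScalarTower ℂ (UqSl2 p) X] (hX : ∀ x : X, UqSl2.E p • x = 0)
    (φ : QDiff p →ₗ[UqSl2 p] X) (hφ : φ (z p ^ (p - 1) * D p ^ (p - 1)) ≠ 0) : φ (t p) ≠ 0 := by
  have hp := hp2.out
  have h1 : φ (z p * D p) ≠ 0 := by
    intro h
    refine hφ ?_
    have := map_monomial_of_E_smul_eq_zero p hX φ (p - 2) (by omega)
    rwa [h, smul_zero, show p - 2 + 1 = p - 1 by omega] at this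
  have hr := qRoot_sq_isPrimitiveRoot p (UqSl2.p_ne_zero p)
  have h2 : φ (t p) = (∑ j ∈ Finset.range (p - 1), (qRoot p ^ (2 : ℤ)) ^ j) • φ (z p * D p) := by
    rw [t, Finset.sum_smul, map_sum, ← Finset.Ico_add_one_right_eq_Icc,
      Finset.sum_Ico_eq_sum_range]
    refine Finset.sum_congr rfl fun j hj => ?_
    rw [Finset.mem_range] at hj
    rw [φ.map_smul_of_tower, add_comm 1 j, map_monomial_of_E_smul_eq_zero p hX φ j (by omega),
      smul_smul, Nat.cast_succ, mul_comm, mul_assoc,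
      mul_inv_cancel₀ (qInt_ne_zero p (by omega) (by omega)), mul_one, zpow_mul, zpow_natCast]
  have h3 : ∑ j ∈ Finset.range (p - 1), (qRoot p ^ (2 : ℤ)) ^ j +
      (qRoot p ^ (2 : ℤ)) ^ (p - 1) = 0 := by
    rw [← Finset.sum_range_succ, Nat.sub_add_cancel (by omega)]
    exact hr.geom_sum_eq_zero (by omega)
  rw [h2, eq_neg_of_add_eq_zero_left h3]
  exact smul_ne_zero (neg_ne_zero.mpr (pow_ne_zero _ (zpow_ne_zero _ (qRoot_ne_zero p)))) h1

/-- The element t is K-fixed, lies in the summand and has nonzero image in X⁺_1, so it generates the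
summand; the diagram identifies Ut with the span of the wing. -/
theorem oddSummand_one (r : OddIndex p) (hr : (r : ℕ) = 1) :
    (UqSl2.oddSummand p (QDiff p) r : Set (QDiff p)) =
      (Submodule.span ℂ (Set.range (wing p)) : Set (QDiff p)) := by
  have hv := isWeightZeroGenerator p
  obtain ⟨φ, hφ⟩ := hv.exists_hom (XPlus.K_smul_middle p r (r.2.2.trans (nu_le p)) r.2.1)
  have hφt : φ (t p) ≠ 0 := map_t_ne_zero p (XPlus.E_smul_eq_zero p r _ hr) φ (by
    rw [hφ]; exact XPlus.basisVec_ne_zero p r _ _)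
  have hle := UqSl2.oddSummand_le_span hv r φ (K_smul_t p) hφt
  have ht : t p ∈ UqSl2.oddSummand p (QDiff p) r := by
    rw [UqSl2.oddSummand, hr]
    exact_mod_cast t_mem_casimirSubmodule p
  refine Set.Subset.antisymm (fun x hx => ?_) ?_
  · obtain ⟨u, rfl⟩ := Submodule.mem_span_singleton.mp (hle hx)
    exact smul_mem_span_wing p u (t_mem_span_wing p)
  · have : Submodule.span ℂ (Set.range (wing p)) ≤
        (UqSl2.oddSummand p (QDiff p) r).restrictScalars ℂ := by
      rw [Submodule.span_le]
      rintro _ ⟨i, rfl⟩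
      exact wing_mem_of_t_mem p _ ht i
    exact this

/-! ### Matrices -/

theorem toMat_smul (u : UqSl2 p) (a : QDiff p) : letI := (matWeylData p).module
    toMat p (u • a) = u • toMat p a := by
  refine (weylData p).map_smul_of_intertwines (matWeylData p) (toMat p) (toMat_z p) (toMat_D p)
    ?_ u a
  intro a
  change ((toMat p).comp (weylData p).k) a = ((matWeylData p).k.comp (toMat p)) a
  congr 1
  apply algHom_ext
  · have h := (matWeylData p).k_z
    change toMat p ((weylData p).k (weylData p).z) = (matWeylData p).k (toMat p (z p))
    rw [(weylData p).k_z, map_smul, toMat_z]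
    exact ((congrArg _ (toMat_z p)).trans h.symm)
  · have h := (matWeylData p).k_D
    change toMat p ((weylData p).k (weylData p).D) = (matWeylData p).k (toMat p (D p))
    rw [(weylData p).k_D, map_smul, toMat_D]
    exact ((congrArg _ (toMat_D p)).trans h.symm)

theorem matEquiv_toMat (a : QDiff p) : matEquiv p (toMat p a) = a :=
  (AlgEquiv.ofBijective (toMat p) (toMat_bijective p)).symm_apply_apply a

theorem matEquiv_smul (u : UqSl2 p) (X : Matrix (Fin p) (Fin p) ℂ) :
    letI := (matWeylData p).module
    matEquiv p (u • X) = u • matEquiv p X := by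
  obtain ⟨a, rfl⟩ := (toMat_bijective p).2 X
  rw [← toMat_smul, matEquiv_toMat, matEquiv_toMat]

end QDiff

/-- Generators of weight zero are carried along isomorphisms. -/
theorem UqSl2.IsWeightZeroGenerator.of_equiv {p : ℕ} [Fact (2 ≤ p)] {M M' : Type*}
    [AddCommGroup M] [Module ℂ M] [Module (UqSl2 p) M] [IsScalarTower ℂ (UqSl2 p) M]
    [AddCommGroup M'] [Module ℂ M'] [Module (UqSl2 p) M'] [IsScalarTower ℂ (UqSl2 p) M']
    (e : M' ≃ₗ[UqSl2 p] M) {v : M} (hv : IsWeightZeroGenerator p v) :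
    IsWeightZeroGenerator p (e.symm v) where
  K_smul := by rw [← map_smul, hv.K_smul]
  exists_smul x := by
    obtain ⟨u, hu⟩ := hv.exists_smul (e x)
    exact ⟨u, by rw [← map_smul, hu, LinearEquiv.symm_apply_apply]⟩
  finrank_eq := (e.restrictScalars ℂ).finrank_eq.trans hv.finrank_eq

end

theorem mainTheorem1 (p : ℕ) [Fact (2 ≤ p)] :
    ∃ (_ : Module (UqSl2 p) (Matrix (Fin p) (Fin p) ℂ))
      (_ : IsScalarTower ℂ (UqSl2 p) (Matrix (Fin p) (Fin p) ℂ))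
      (_ : Module (UqSl2 p) (QDiff p)) (_ : IsScalarTower ℂ (UqSl2 p) (QDiff p))
      (_ : Module (UqSl2 p) (QDeRham p)) (_ : IsScalarTower ℂ (UqSl2 p) (QDeRham p))
      (N : OddIndex p → Submodule (UqSl2 p) (Matrix (Fin p) (Fin p) ℂ))
      (N' : OddIndex p → Submodule (UqSl2 p) (QDiff p))
      (Φ : Matrix (Fin p) (Fin p) ℂ ≃ₐ[ℂ] QDiff p)
      (d : QDeRham p →ₗ[ℂ] QDeRham p),
      -- (1) the explicit formulas define a representation of `U` on matrices
      ((∀ X : Matrix (Fin p) (Fin p) ℂ, UqSl2.E p • X = matE p X) ∧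
        (∀ X : Matrix (Fin p) (Fin p) ℂ, UqSl2.K p • X = matK p X) ∧
        (∀ X : Matrix (Fin p) (Fin p) ℂ, UqSl2.F p • X = matF p X)) ∧
      -- (2) matrices form a `U`-module algebra
      IsModuleAlgebra (UqSl2 p) (Matrix (Fin p) (Fin p) ℂ) ∧
      -- (3) the decomposition, for matrices and for the algebra on `z`, `∂`
      IsOddProjectiveDecomposition p N ∧
      IsOddProjectiveDecomposition p N' ∧
      -- (4) the isomorphism of `U`-module algebras, which matches the decompositions
      (QDiff.IsStandardAction p ∧
        IsModuleAlgebra (UqSl2 p) (QDiff p) ∧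
        (∀ (h : UqSl2 p) (X : Matrix (Fin p) (Fin p) ℂ), Φ (h • X) = h • Φ X) ∧
        Φ (matZ p) = QDiff.z p ∧ Φ (matD p) = QDiff.D p ∧
        (∀ r, Φ '' (N r : Set (Matrix (Fin p) (Fin p) ℂ)) = (N' r : Set (QDiff p)))) ∧
      -- (5) the summand `P⁺₁` and its diagram
      ((∀ r : OddIndex p, (r : ℕ) = 1 →
          (N' r : Set (QDiff p)) = (Submodule.span ℂ (Set.range (QDiff.wing p)) : Set _)) ∧
        QDiff.IsWingDiagram p) ∧
      -- (6) the quantum de Rham complex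
      (Function.Bijective (QDeRham.mulMap p) ∧
        Function.Injective (QDeRham.even p) ∧
        (∀ (h : UqSl2 p) (a : QDiff p), QDeRham.even p (h • a) = h • QDeRham.even p a) ∧
        QDeRham.IsStandardAction p ∧
        IsDifferentialModuleAlgebra (UqSl2 p) (QDeRham.forms p) d ∧
        d (QDeRham.z p) = QDeRham.zeta p ∧ d (QDeRham.D p) = QDeRham.delta p ∧
        d (QDeRham.zeta p) = 0 ∧ d (QDeRham.delta p) = 0 ∧
        Algebra.adjoin ℂ ((QDeRham.forms p 0 : Set (QDeRham p)) ∪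
          d '' (QDeRham.forms p 0 : Set (QDeRham p))) = ⊤) := by
  let := (matWeylData p).module
  have := (matWeylData p).isScalarTower
  let := (QDiff.weylData p).module
  have := (QDiff.weylData p).isScalarTower
  let e : Matrix (Fin p) (Fin p) ℂ ≃ₗ[UqSl2 p] QDiff p :=
    { (QDiff.matEquiv p) with map_smul' := QDiff.matEquiv_smul p }
  have hv := QDiff.isWeightZeroGenerator p
  have hz : QDiff.matEquiv p (matZ p) = QDiff.z p := by
    rw [← QDiff.toMat_z, QDiff.matEquiv_toMat]
  have hD : QDiff.matEquiv p (matD p) = QDiff.D p := by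
    rw [← QDiff.toMat_D, QDiff.matEquiv_toMat]
  refine ⟨(matWeylData p).module, (matWeylData p).isScalarTower, (QDiff.weylData p).module,
    (QDiff.weylData p).isScalarTower, (QDeRham.weylData p).module,
    (QDeRham.weylData p).isScalarTower, UqSl2.oddSummand p _, UqSl2.oddSummand p _,
    QDiff.matEquiv p, QDeRham.d p, ⟨fun X => ?_, fun X => ?_, fun X => ?_⟩,
    (matWeylData p).isModuleAlgebra, UqSl2.isOddProjectiveDecomposition (hv.of_equiv e),
    UqSl2.isOddProjectiveDecomposition hv,
    ⟨QDiff.isStandardAction p, (QDiff.weylData p).isModuleAlgebra, QDiff.matEquiv_smul p, hz, hD,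
      fun r => ?_⟩,
    ⟨QDiff.oddSummand_one p, QDiff.isWingDiagram p⟩,
    ⟨QDeRham.mulMap_bijective p, QDeRham.even_injective p, QDeRham.even_smul p,
      QDeRham.isStandardAction p, QDeRham.isDifferentialModuleAlgebra p, QDeRham.d_z p,
      QDeRham.d_D p, QDeRham.d_zeta p, QDeRham.d_delta p, QDeRham.adjoin_eq_top p⟩⟩
  · exact ((matWeylData p).E_smul X).trans (matWeylData_opE p X)
  · exact ((matWeylData p).K_smul X).trans (matWeylData_k p X)
  · exact ((matWeylData p).F_smul X).trans (matWeylData_opF p X)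
  -- The summands on both sides are generalized eigenspaces of the same central element, so every
  -- U-isomorphism matches them.
  · refine Set.Subset.antisymm ?_ fun y hy => ?_
    · rintro _ ⟨x, hx, rfl⟩
      exact (UqSl2.mem_casimirSubmodule_map e).mpr hx
    · refine ⟨e.symm y, (UqSl2.mem_casimirSubmodule_map e).mp ?_, e.apply_symm_apply y⟩
      rw [e.apply_symm_apply]
      exact hy
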